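/- **Setting.** A *virtual birack* is a set $X$ with bijections $B,V:X\times X\to X\times X$, written $B(x,y)=(y^x,x_y)$ and $V(x,y)=(y^{\tilde x},x_{\tilde y})$, such that: (i) there are unique bijections $S_B,S_V$ of $X\times X$ with $S_B(y^x,x)=(x_y,y)$ and $S_V(y^{\tilde x},x)=(x_{\tilde y},y)$ for all $x,y$; (ii) with $\Delta(x)=(x,x)$, both components of $S_B\circ\Delta$ and of $S_B^{-1}\circ\Delta$ are bijections of $X$; (iii) $V^2=\mathrm{Id}$ and $(S_V\Delta)_1=(S_V\Delta)_2$; (iv) $(B\times 1)(1\times B)(B\times 1)=(1\times B)(B\times 1)(1\times B)$, the same for $V$, and $(B\times 1)(1\times V)(V\times 1)=(1\times V)(V\times 1)(1\times B)$. Put $\alpha=((S_B^{-1}\Delta)_2)^{-1}$ and $\pi=(S_B^{-1}\Delta)_1\circ\alpha$; the *birack rank* $N$ of a finite $X$ is the order of $\pi$. An *$X$-shadow* is a set $\mathcal S$ with a map $\mathcal S\times X\to \mathcal S$, $(A,x)\mapsto A\cdot x$, such that each $A\mapsto A\cdot x$ is bijective, with inverse $A\mapsto A\cdot^{-1}x$,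 and $(A\cdot y_x)\cdot x^y=(A\cdot y_{\tilde x})\cdot x^{\tilde y}=(A\cdot x)\cdot y$. The commutative ring $\mathbb Z[X,\mathcal S]$ is the quotient of $\mathbb Z[v_{A,x,y}^{\pm1},t_{A,x,y}^{\pm1},r_{A,x,y}^{\pm1},s_{A,x,y}]$ ($A\in \mathcal S$, $x,y\in X$) by the following relations, for all $A\in \mathcal S$ and $x,y,z\in X$. Abbreviate, as index triples, $1=(A,y,z)$, $2=(A\cdot y_z,x,z^y)$, $3=(A,x_{z^y},y_z)$, $1'=(A\cdot z,x,y)$, $2'=(A,x_y,z)$, $3'=(A\cdot (x_y)_z,y^x,z^{x_y})$; let $\tilde 2,\tilde 3,\tilde 2',\tilde 3'$ be the triples obtained from $2,3,2',3'$ by putting a tilde on every operation (so $\tilde 2'=(A,x_{\tilde y},z)$, $\tilde 3'=(A\cdot(x_{\tilde y})_{\tilde z},y^{\tilde x},z^{\widetilde{x_{\tilde y}}})$), and put $\hat 3=(A,x_{\widetilde{z^y}},y_z)$. The relations are $$v_{A,y^{\tilde x},x_{\tilde y}}=v_{A,x,y},\qquad v_{\tilde2}v_{1}=v_{\tilde3'}v_{\tilde2'},\quad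 v_{\tilde3'}v_{\tilde3}=v_{1'}v_{1},\quad v_{1'}v_{\tilde2'}=v_{\tilde2}v_{\tilde3},$$ $$v_{2}v_{\hat3}=v_{1'}v_{\tilde2'},\quad v_{\hat3}r_1=r_{\tilde3'}v_{1'},\quad v_2t_1=t_{\tilde3'}v_{\tilde2'},\quad v_2s_1=s_{\tilde3'}v_{1'},$$ $$r_3r_2=r_{2'}r_{1'},\quad t_3r_1=r_{3'}t_{1'},\quad s_3r_2=r_{3'}s_{1'},\quad t_2t_1=t_{3'}t_{2'},\quad t_2s_1=s_{3'}t_{1'},\quad s_2=t_{3'}s_{2'}r_{1'}+s_{3'}s_{1'},$$ $$\prod_{k=0}^{N-1}\bigl(t_{A_k,x_k,\alpha(x_k)}\,r_{A_k,x_k,\alpha(x_k)}+s_{A_k,x_k,\alpha(x_k)}\bigr)=1,\qquad x_k=\pi^k(x),\ A_k=A\cdot^{-1}\alpha(x_k).$$ Let $D$ be an oriented virtual link diagram in the plane; its semiarcs are obtained by dividing it at classical and virtual crossings. Turn each crossing so that both strands point upwards. An *$X,\mathcal S$-labeling* $f$ of $D$ labels the semiarcs by $X$ and the regions of the plane by $\mathcal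 S$ such that: if the region to the right of a semiarc labeled $x$ has label $A$, the region to its left has label $A\cdot x$; if the incoming semiarcs (left, right) are labeled $x,y$, then the outgoing ones (left, right) are labeled $y^x,x_y$ at a positive crossing and $y^{\tilde x},x_{\tilde y}$ at a virtual one; at a negative crossing this holds with incoming and outgoing semiarcs exchanged. The *fundamental module* $\mathbb Z[f]$ is the $\mathbb Z[X,\mathcal S]$-module with one generator (bead) for each semiarc and, at each crossing, with $A$ the label of the region to its right and $a,b,c,d$ the beads on the semiarcs labeled as above by $x$, $y$, $y^x$, $x_y$ (respectively $x,y,y^{\tilde x},x_{\tilde y}$), the relations $c=t_{A,x,y}b+s_{A,x,y}a$, $d=r_{A,x,y}a$ at a classical crossing and $c=v_{A,x,y}b$, $d=v_{A,x,y}^{-1}a$ at a virtual one. **Theorem.** Let $X$ be a finite virtual birack of birack rank $N$, $\mathcal S$ an $X$-shadow and $G$ a $\mathbb Z[X,\mathcal S]$-module. For an oriented virtual link $L$ of $c$ components and each $\mathbf w\in(\mathbb Z_N)^c$, the link $L$ has a diagram whose writhe vector (the self-writhes of the components) is congruent to $\mathbf w$ mod $N$; choose one, and call it $(L,\mathbf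 w)$. Let $\mathcal L((L,\mathbf w),X,\mathcal S)$ be the set of its $X,\mathcal S$-labelings. Then the multiset of modules, up to isomorphism, $$\Phi^{M,G}_{X,\mathcal S}(L)=\{\mathrm{Hom}_{\mathbb Z[X,\mathcal S]}(\mathbb Z[f],G): f\in\mathcal L((L,\mathbf w),X,\mathcal S),\ \mathbf w\in(\mathbb Z_N)^c\}$$ and, for finite $\mathcal S$, the polynomial $$\Phi^{G}_{X,\mathcal S}(L)=\sum_{\mathbf w\in(\mathbb Z_N)^c}\ \sum_{f\in\mathcal L((L,\mathbf w),X,\mathcal S)}u^{|\mathrm{Hom}_{\mathbb Z[X,\mathcal S]}(\mathbb Z[f],G)|}$$ (where $u^{\infty}$ is read as $u^0$) do not depend on the chosen diagrams, and if $L$ and $L'$ are virtually isotopic oriented virtual links, then $\Phi^{M,G}_{X,\mathcal S}(L)=\Phi^{M,G}_{X,\mathcal S}(L')$ and $\Phi^{G}_{X,\mathcal S}(L)=\Phi^{G}_{X,\mathcal S}(L')$. -/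

import Mathlib

/-! # Virtual biracks, shadows, and the virtual shadow module invariants of virtual links -/

noncomputable section

namespace VirtualShadow

/-! ## Virtual biracks -/

/-- `F × Id` on `X × X × X`. -/
def leftMap {X : Type*} (F : X × X ≃ X × X) (p : X × X × X) : X × X × X :=
  ((F (p.1, p.2.1)).1, (F (p.1, p.2.1)).2, p.2.2)

/-- `Id × F` on `X × X × X`. -/
def rightMap {X : Type*} (F : X × X ≃ X × X) (p : X × X × X) : X × X × X := (p.1, F p.2)

/-- A virtual birack structure on `X`: invertible maps `B, V : X × X → X × X`, both sideways
invertible (`sideB`, `sideV` are the sideways maps, unique among invertible maps), with `B`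
diagonally invertible, `V` self-inverse and diagonal fixing, satisfying the three set-theoretic
Yang-Baxter equations. -/
structure VirtualBirack (X : Type*) where
  B : X × X ≃ X × X
  V : X × X ≃ X × X
  sideB : X × X ≃ X × X
  sideV : X × X ≃ X × X
  sideB_spec : ∀ x y, sideB ((B (x, y)).1, x) = ((B (x, y)).2, y)
  sideB_unique : ∀ T : X × X ≃ X × X,
    (∀ x y, T ((B (x, y)).1, x) = ((B (x, y)).2, y)) → T = sideB
  sideV_spec : ∀ x y, sideV ((V (x, y)).1, x) = ((V (x, y)).2, y)
  sideV_unique : ∀ T : X × X ≃ X × X,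
    (∀ x y, T ((V (x, y)).1, x) = ((V (x, y)).2, y)) → T = sideV
  diag_fst : Function.Bijective fun x => (sideB (x, x)).1
  diag_snd : Function.Bijective fun x => (sideB (x, x)).2
  diag_symm_fst : Function.Bijective fun x => (sideB.symm (x, x)).1
  diag_symm_snd : Function.Bijective fun x => (sideB.symm (x, x)).2
  V_V : ∀ p, V (V p) = p
  V_diag : ∀ x, (sideV (x, x)).1 = (sideV (x, x)).2
  yang_baxter_B : ∀ p : X × X × X,
    leftMap B (rightMap B (leftMap B p)) = rightMap B (leftMap B (rightMap B p))
  yang_baxter_V : ∀ p : X × X × X,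
    leftMap V (rightMap V (leftMap V p)) = rightMap V (leftMap V (rightMap V p))
  yang_baxter_mixed : ∀ p : X × X × X,
    leftMap B (rightMap V (leftMap V p)) = rightMap V (leftMap V (rightMap B p))

namespace VirtualBirack

variable {X : Type*} (b : VirtualBirack X)

/-- `x^y`, where `B (x, y) = (y^x, x_y)`. -/
def up (x y : X) : X := (b.B (y, x)).1

/-- `x_y`, where `B (x, y) = (y^x, x_y)`. -/
def lo (x y : X) : X := (b.B (x, y)).2

/-- `x^{~y}`, where `V (x, y) = (y^{~x}, x_{~y})`. -/
def vup (x y : X) : X := (b.V (y, x)).1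

/-- `x_{~y}`, where `V (x, y) = (y^{~x}, x_{~y})`. -/
def vlo (x y : X) : X := (b.V (x, y)).2

/-- `α = ((S⁻¹ ∘ Δ)₂)⁻¹`, where `S` is the sideways map of `B`. -/
def alpha : Equiv.Perm X := (Equiv.ofBijective _ b.diag_symm_snd).symm

/-- The kink map `π = (S⁻¹ ∘ Δ)₁ ∘ α`. -/
def kink : Equiv.Perm X := b.alpha.trans (Equiv.ofBijective _ b.diag_symm_fst)

/-- The birack rank: the least `N > 0` with `π ^ N = Id` (it exists when `X` is finite). -/
def rank : ℕ := orderOf b.kink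

end VirtualBirack

/-- An `X`-shadow structure on `S`: a right invertible right action `A · x = act x A`. -/
structure Shadow {X : Type*} (b : VirtualBirack X) (S : Type*) where
  act : X → Equiv.Perm S
  act_B : ∀ A x y, act (b.up x y) (act (b.lo y x) A) = act y (act x A)
  act_V : ∀ A x y, act (b.vup x y) (act (b.vlo y x) A) = act y (act x A)

/-! ## The virtual birack shadow algebra -/

/-- The variables of the polynomial algebra; `vi`, `ti`, `ri` become the inverses of
`v`, `t`, `r`. -/
inductive Gen (X S : Type*)
  | v (A : S) (x y : X)
  | t (A : S) (x y : X)
  | r (A : S) (x y : X)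
  | s (A : S) (x y : X)
  | vi (A : S) (x y : X)
  | ti (A : S) (x y : X)
  | ri (A : S) (x y : X)

section Algebra

variable {X S : Type*} (b : VirtualBirack X) (σ : Shadow b S)

/-- The coefficient `t_{A',x,α(x)} r_{A',x,α(x)} + s_{A',x,α(x)}`, `A' = A ·⁻¹ α(x)`, which a bead
acquires at a positive kink. -/
def kinkCoeff (A : S) (x : X) : MvPolynomial (Gen X S) ℤ :=
  let y := b.alpha x
  let A' := (σ.act y).symm A
  .X (.t A' x y) * .X (.r A' x y) + .X (.s A' x y)

open Gen in
/-- The generators of the ideal `I`. -/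
inductive IdealGen : MvPolynomial (Gen X S) ℤ → Prop
  | v_inv (A x y) : IdealGen (.X (v A x y) * .X (vi A x y) - 1)
  | t_inv (A x y) : IdealGen (.X (t A x y) * .X (ti A x y) - 1)
  | r_inv (A x y) : IdealGen (.X (r A x y) * .X (ri A x y) - 1)
  /- move vII -/
  | vII (A x y) : IdealGen (.X (v A (b.vup y x) (b.vlo x y)) - .X (v A x y))
  /- move vIII -/
  | vIII₁ (A x y z) : IdealGen
      (.X (v (σ.act (b.vlo y z) A) x (b.vup z y)) * .X (v A y z)
        - .X (v (σ.act (b.vlo (b.vlo x y) z) A) (b.vup y x) (b.vup z (b.vlo x y)))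
          * .X (v A (b.vlo x y) z))
  | vIII₂ (A x y z) : IdealGen
      (.X (v (σ.act (b.vlo (b.vlo x y) z) A) (b.vup y x) (b.vup z (b.vlo x y)))
          * .X (v A (b.vlo x (b.vup z y)) (b.vlo y z))
        - .X (v (σ.act z A) x y) * .X (v A y z))
  | vIII₃ (A x y z) : IdealGen
      (.X (v (σ.act z A) x y) * .X (v A (b.vlo x y) z)
        - .X (v (σ.act (b.vlo y z) A) x (b.vup z y))
          * .X (v A (b.vlo x (b.vup z y)) (b.vlo y z)))
  /- the mixed move v -/
  | mixed₁ (A x y z) : IdealGen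
      (.X (v (σ.act (b.lo y z) A) x (b.up z y)) * .X (v A (b.vlo x (b.up z y)) (b.lo y z))
        - .X (v (σ.act z A) x y) * .X (v A (b.vlo x y) z))
  | mixed₂ (A x y z) : IdealGen
      (.X (v A (b.vlo x (b.up z y)) (b.lo y z)) * .X (r A y z)
        - .X (r (σ.act (b.vlo (b.vlo x y) z) A) (b.vup y x) (b.vup z (b.vlo x y)))
          * .X (v (σ.act z A) x y))
  | mixed₃ (A x y z) : IdealGen
      (.X (v (σ.act (b.lo y z) A) x (b.up z y)) * .X (t A y z)
        - .X (t (σ.act (b.vlo (b.vlo x y) z) A) (b.vup y x) (b.vup z (b.vlo x y)))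
          * .X (v A (b.vlo x y) z))
  | mixed₄ (A x y z) : IdealGen
      (.X (v (σ.act (b.lo y z) A) x (b.up z y)) * .X (s A y z)
        - .X (s (σ.act (b.vlo (b.vlo x y) z) A) (b.vup y x) (b.vup z (b.vlo x y)))
          * .X (v (σ.act z A) x y))
  /- move III -/
  | III₁ (A x y z) : IdealGen
      (.X (r A (b.lo x (b.up z y)) (b.lo y z)) * .X (r (σ.act (b.lo y z) A) x (b.up z y))
        - .X (r A (b.lo x y) z) * .X (r (σ.act z A) x y))
  | III₂ (A x y z) : IdealGen
      (.X (t A (b.lo x (b.up z y)) (b.lo y z)) * .X (r A y z)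
        - .X (r (σ.act (b.lo (b.lo x y) z) A) (b.up y x) (b.up z (b.lo x y)))
          * .X (t (σ.act z A) x y))
  | III₃ (A x y z) : IdealGen
      (.X (s A (b.lo x (b.up z y)) (b.lo y z)) * .X (r (σ.act (b.lo y z) A) x (b.up z y))
        - .X (r (σ.act (b.lo (b.lo x y) z) A) (b.up y x) (b.up z (b.lo x y)))
          * .X (s (σ.act z A) x y))
  | III₄ (A x y z) : IdealGen
      (.X (t (σ.act (b.lo y z) A) x (b.up z y)) * .X (t A y z)
        - .X (t (σ.act (b.lo (b.lo x y) z) A) (b.up y x) (b.up z (b.lo x y)))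
          * .X (t A (b.lo x y) z))
  | III₅ (A x y z) : IdealGen
      (.X (t (σ.act (b.lo y z) A) x (b.up z y)) * .X (s A y z)
        - .X (s (σ.act (b.lo (b.lo x y) z) A) (b.up y x) (b.up z (b.lo x y)))
          * .X (t (σ.act z A) x y))
  | III₆ (A x y z) : IdealGen
      (.X (s (σ.act (b.lo y z) A) x (b.up z y))
        - .X (t (σ.act (b.lo (b.lo x y) z) A) (b.up y x) (b.up z (b.lo x y)))
          * .X (s A (b.lo x y) z) * .X (r (σ.act z A) x y)
        - .X (s (σ.act (b.lo (b.lo x y) z) A) (b.up y x) (b.up z (b.lo x y)))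
          * .X (s (σ.act z A) x y))
  /- the `N`-phone cord move -/
  | phone (A x) : IdealGen
      (1 - ∏ k ∈ Finset.range b.rank, kinkCoeff b σ A ((b.kink ^ k) x))

/-- The virtual birack shadow algebra `ℤ[X,S]`. -/
def Alg : Type _ :=
  MvPolynomial (Gen X S) ℤ ⧸ Ideal.span {q | IdealGen b σ q}

instance : CommRing (Alg b σ) :=
  inferInstanceAs (CommRing (MvPolynomial (Gen X S) ℤ ⧸ Ideal.span {q | IdealGen b σ q}))

/-- The class of a variable in `ℤ[X,S]`. -/
def Alg.gen (g : Gen X S) : Alg b σ :=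
  Ideal.Quotient.mk (Ideal.span {q | IdealGen b σ q}) (MvPolynomial.X g)

end Algebra

/-! ## Oriented virtual link diagrams

A diagram in the plane, in general position for the height function, is cut by horizontal lines
into slices, read from bottom to top. Each slice contains exactly one maximum, minimum, classical
crossing or virtual crossing, and vertical strands to its left and right. Strands carry their
direction and the number of the link component they belong to. -/

/-- A strand crossing a horizontal line: its direction and its component number. -/
structure Strand (c : ℕ) where
  up : Bool
  comp : Fin c

/-- The strand with opposite direction on the same component. -/
def Strand.rev {c : ℕ} (s : Strand c) : Strand c := ⟨!s.up, s.comp⟩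

/-- `above`: the strand from bottom left to top right passes over the other one;
`below`: it passes under; `virt`: virtual crossing. -/
inductive CrossKind
  | above
  | below
  | virt

/-- The kind of the crossing seen when the roles of the two strands are exchanged. -/
def CrossKind.swap : CrossKind → CrossKind
  | above => below
  | below => above
  | virt => virt

/-- An elementary piece: a minimum (with its two ends at the top), a maximum (with its two ends at
the bottom), or a crossing, `sl` running from bottom left to top right and `sr` from bottom right
to top left (or the reverse, according to their directions). -/
inductive Piece (c : ℕ)
  | cup (s : Strand c)
  | cap (s : Strand c)
  | cross (k : CrossKind) (sl sr : Strand c)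

/-- The strands at the bottom of a piece, from left to right. -/
def Piece.bot {c : ℕ} : Piece c → List (Strand c)
  | cup _ => []
  | cap s => [s, s.rev]
  | cross _ sl sr => [sl, sr]

/-- The strands at the top of a piece, from left to right. -/
def Piece.top {c : ℕ} : Piece c → List (Strand c)
  | cup s => [s, s.rev]
  | cap _ => []
  | cross _ sl sr => [sr, sl]

/-- A slice: a piece with vertical strands to its left and right. -/
structure Slice (c : ℕ) where
  left : List (Strand c)
  piece : Piece c
  right : List (Strand c)

def Slice.bot {c : ℕ} (s : Slice c) : List (Strand c) := s.left ++ s.piece.bot ++ s.right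

def Slice.top {c : ℕ} (s : Slice c) : List (Strand c) := s.left ++ s.piece.top ++ s.right

/-- `Runs a w b`: the slices of `w` fit on top of each other, from the strands `a` at the bottom to
the strands `b` at the top. -/
def Runs {c : ℕ} : List (Strand c) → List (Slice c) → List (Strand c) → Prop
  | a, [], b => a = b
  | a, s :: w, b => s.bot = a ∧ Runs s.top w b

section Word

variable {c : ℕ} (w : List (Slice c))

/-- The strands met by the horizontal line at the bottom of slice number `k`; none above the last
slice. -/
def level (k : ℕ) : List (Strand c) :=
  match w[k]? with
  | some s => s.bot
  | none => []

/-- The points where the strands meet the horizontal lines: `(k, i)` is strand number `i` on line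
number `k`. -/
def Point : Type := {p : ℕ × ℕ // p.2 < (level w p.1).length}

/-- The intervals into which the strands cut the horizontal lines: `(k, i)` is the interval to the
left of strand number `i` on line number `k`, the last one lying to the right of all strands. -/
def Gap : Type := {p : ℕ × ℕ // p.1 ≤ w.length ∧ p.2 ≤ (level w p.1).length}

def Point.strand {w : List (Slice c)} (p : Point w) : Strand c := (level w p.1.1)[p.1.2]'p.2

/-- Consecutive points along the diagram, no crossing lying between them. -/
inductive ArcGlue : ℕ × ℕ → ℕ × ℕ → Prop
  | left (k i : ℕ) (s : Slice c) (hs : w[k]? = some s) (hi : i < s.left.length) :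
      ArcGlue (k, i) (k + 1, i)
  | right (k i : ℕ) (s : Slice c) (hs : w[k]? = some s) (hi : i < s.right.length) :
      ArcGlue (k, s.left.length + s.piece.bot.length + i)
        (k + 1, s.left.length + s.piece.top.length + i)
  | cup (k : ℕ) (l r : List (Strand c)) (s : Strand c) (hs : w[k]? = some ⟨l, .cup s, r⟩) :
      ArcGlue (k + 1, l.length) (k + 1, l.length + 1)
  | cap (k : ℕ) (l r : List (Strand c)) (s : Strand c) (hs : w[k]? = some ⟨l, .cap s, r⟩) :
      ArcGlue (k, l.length) (k, l.length + 1)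

/-- Consecutive points along a component: as before, or straight across a crossing. -/
inductive CompGlue : ℕ × ℕ → ℕ × ℕ → Prop
  | arc (p q : ℕ × ℕ) (h : ArcGlue w p q) : CompGlue p q
  | cross_left (k : ℕ) (l r : List (Strand c)) (κ : CrossKind) (sl sr : Strand c)
      (hs : w[k]? = some ⟨l, .cross κ sl sr, r⟩) :
      CompGlue (k, l.length) (k + 1, l.length + 1)
  | cross_right (k : ℕ) (l r : List (Strand c)) (κ : CrossKind) (sl sr : Strand c)
      (hs : w[k]? = some ⟨l, .cross κ sl sr, r⟩) :
      CompGlue (k, l.length + 1) (k + 1, l.length)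

/-- Intervals on consecutive lines that lie in the same region of the plane. -/
inductive GapGlue : ℕ × ℕ → ℕ × ℕ → Prop
  | left (k i : ℕ) (s : Slice c) (hs : w[k]? = some s) (hi : i ≤ s.left.length) :
      GapGlue (k, i) (k + 1, i)
  | right (k i : ℕ) (s : Slice c) (hs : w[k]? = some s) (hi : i ≤ s.right.length) :
      GapGlue (k, s.left.length + s.piece.bot.length + i)
        (k + 1, s.left.length + s.piece.top.length + i)

/-- The semiarcs: the diagram is divided at classical and at virtual crossings. -/
def Semiarc : Type := Quot fun p q : Point w => ArcGlue w p.1 q.1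

/-- The components of the link. -/
def Component : Type := Quot fun p q : Point w => CompGlue w p.1 q.1

/-- The regions of the plane between the semiarcs. -/
def Region : Type := Quot fun p q : Gap w => GapGlue w p.1 q.1

def Point.arc {w : List (Slice c)} (p : Point w) : Semiarc w := Quot.mk _ p

def Point.component {w : List (Slice c)} (p : Point w) : Component w := Quot.mk _ p

def Gap.region {w : List (Slice c)} (g : Gap w) : Region w := Quot.mk _ g

end Word

/-- Sign of a crossing: positive, negative, or virtual. -/
inductive CrossSign
  | pos
  | neg
  | virt

/-- The sign of an oriented crossing. -/
def crossSign {c : ℕ} (k : CrossKind) (sl sr : Strand c) : CrossSign :=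
  match k, sl.up == sr.up with
  | .virt, _ => .virt
  | .above, true => .pos
  | .above, false => .neg
  | .below, true => .neg
  | .below, false => .pos

/-- The contribution of a piece to the writhe of component number `i`: `±1` for a classical
crossing of this component with itself. -/
def Piece.writhe {c : ℕ} (i : Fin c) : Piece c → ℤ
  | cup _ => 0
  | cap _ => 0
  | cross k sl sr =>
    if sl.comp = i ∧ sr.comp = i then
      match crossSign k sl sr with
      | .pos => 1
      | .neg => -1
      | .virt => 0
    else 0

/-- A diagram of an oriented virtual link of `c` components, numbered by `Fin c`. -/
structure LinkDiagram (c : ℕ) where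
  slices : List (Slice c)
  closed : Runs [] slices []
  /-- Each number is carried by exactly one component. -/
  numbered : ∀ i : Fin c, ∃! C : Component slices,
    ∃ p : Point slices, p.component = C ∧ p.strand.comp = i

/-- The writhe vector (blackboard framing) of a diagram. -/
def LinkDiagram.writhe {c : ℕ} (D : LinkDiagram c) (i : Fin c) : ℤ :=
  (D.slices.map fun s => s.piece.writhe i).sum

/-! ## Virtual isotopy -/

/-- For three strands `1, 2, 3` crossing each other pairwise in crossings `k₁₂, k₁₃, k₂₃`, a
triangle move is allowed when all crossings are virtual, when exactly one is classical, or when all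
are classical and there is a top, a middle and a bottom strand. -/
def Triangle : CrossKind → CrossKind → CrossKind → Prop
  | .virt, .virt, _ => True
  | .virt, _, .virt => True
  | _, .virt, .virt => True
  | .virt, _, _ => False
  | _, .virt, _ => False
  | _, _, .virt => False
  | k₁₂, k₁₃, k₂₃ => k₁₃ = k₁₂ ∨ k₁₃ = k₂₃

/-- The local moves. -/
inductive LocalMove {c : ℕ} : List (Slice c) → List (Slice c) → Prop
  /- Planar isotopy: two pieces side by side exchange their heights. -/
  | exchange (p q : Piece c) (m : List (Strand c)) :
      LocalMove [⟨[], p, m ++ q.bot⟩, ⟨p.top ++ m, q, []⟩]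
        [⟨p.bot ++ m, q, []⟩, ⟨[], p, m ++ q.top⟩]
  /- Planar isotopy: a minimum and a maximum cancel. -/
  | zigzag (s : Strand c) : LocalMove [⟨[], .cup s, [s]⟩, ⟨[s], .cap s.rev, []⟩] []
  | zagzig (s : Strand c) : LocalMove [⟨[s], .cup s.rev, []⟩, ⟨[], .cap s, [s]⟩] []
  /- Planar isotopy: a crossing slides over a maximum or under a minimum. -/
  | slide_cap (k : CrossKind) (s t : Strand c) :
      LocalMove [⟨[t], .cross k s t.rev, []⟩, ⟨[], .cap t, [s]⟩]
        [⟨[], .cross k.swap t s, [t.rev]⟩, ⟨[s], .cap t, []⟩]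
  | slide_cup (k : CrossKind) (s t : Strand c) :
      LocalMove [⟨[], .cup t, [s]⟩, ⟨[t], .cross k t.rev s, []⟩]
        [⟨[s], .cup t, []⟩, ⟨[], .cross k.swap s t, [t.rev]⟩]
  /- Moves I and vI: a kink is removed. -/
  | kink_right (k : CrossKind) (s : Strand c) :
      LocalMove [⟨[s], .cup s, []⟩, ⟨[], .cross k s s, [s.rev]⟩, ⟨[s], .cap s, []⟩] []
  | kink_left (k : CrossKind) (s : Strand c) :
      LocalMove
        [⟨[], .cup s.rev, [s]⟩, ⟨[s.rev], .cross k s s, []⟩, ⟨[], .cap s.rev, [s]⟩] []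
  /- Moves II and vII. -/
  | bigon (k : CrossKind) (s t : Strand c) :
      LocalMove [⟨[], .cross k s t, []⟩, ⟨[], .cross k.swap t s, []⟩] []
  /- Moves III, vIII and the mixed move v. -/
  | triangle (k₁₂ k₁₃ k₂₃ : CrossKind) (h : Triangle k₁₂ k₁₃ k₂₃) (s₁ s₂ s₃ : Strand c) :
      LocalMove
        [⟨[], .cross k₁₂ s₁ s₂, [s₃]⟩, ⟨[s₂], .cross k₁₃ s₁ s₃, []⟩,
          ⟨[], .cross k₂₃ s₂ s₃, [s₁]⟩]
        [⟨[s₁], .cross k₂₃ s₂ s₃, []⟩, ⟨[], .cross k₁₃ s₁ s₃, [s₂]⟩,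
          ⟨[s₃], .cross k₁₂ s₁ s₂, []⟩]

/-- Put a stack of slices between vertical strands `l` on the left and `r` on the right. -/
def widen {c : ℕ} (l r : List (Strand c)) (m : List (Slice c)) : List (Slice c) :=
  m.map fun s => ⟨l ++ s.left, s.piece, s.right ++ r⟩

/-- `E` arises from `D` by a local move on some part of the diagram. -/
def MoveStep {c : ℕ} (D E : LinkDiagram c) : Prop :=
  ∃ (u v : List (Slice c)) (l r : List (Strand c)) (m m' : List (Slice c)),
    LocalMove m m' ∧ D.slices = u ++ widen l r m ++ v ∧ E.slices = u ++ widen l r m' ++ v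

/-- Virtual isotopy respecting the numbers of the components. -/
def NumberedIsotopic {c : ℕ} (D E : LinkDiagram c) : Prop := Relation.EqvGen MoveStep D E

/-- Change the component numbers by `τ`. -/
def Strand.renumber {c : ℕ} (τ : Equiv.Perm (Fin c)) (s : Strand c) : Strand c :=
  ⟨s.up, τ s.comp⟩

def Piece.renumber {c : ℕ} (τ : Equiv.Perm (Fin c)) : Piece c → Piece c
  | cup s => cup (s.renumber τ)
  | cap s => cap (s.renumber τ)
  | cross k sl sr => cross k (sl.renumber τ) (sr.renumber τ)

def Slice.renumber {c : ℕ} (τ : Equiv.Perm (Fin c)) (s : Slice c) : Slice c :=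
  ⟨s.left.map (Strand.renumber τ), s.piece.renumber τ, s.right.map (Strand.renumber τ)⟩

/-- Virtual isotopy of (unnumbered) oriented virtual links: generated by the moves and by arbitrary
renumberings of the components. -/
def VirtuallyIsotopic {c : ℕ} : LinkDiagram c → LinkDiagram c → Prop :=
  Relation.EqvGen fun D E =>
    MoveStep D E ∨ ∃ τ : Equiv.Perm (Fin c), E.slices = D.slices.map (Slice.renumber τ)

/-! ## Shadow labelings -/

/-- A crossing of a diagram, with the four points and the four regions around it. -/
structure Crossing {c : ℕ} (w : List (Slice c)) where
  height : ℕ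
  left : List (Strand c)
  right : List (Strand c)
  kind : CrossKind
  sl : Strand c
  sr : Strand c
  slice_eq : w[height]? = some ⟨left, .cross kind sl sr, right⟩
  bl : Point w
  br : Point w
  tl : Point w
  tr : Point w
  bl_eq : bl.1 = (height, left.length)
  br_eq : br.1 = (height, left.length + 1)
  tl_eq : tl.1 = (height + 1, left.length)
  tr_eq : tr.1 = (height + 1, left.length + 1)
  west : Gap w
  south : Gap w
  north : Gap w
  east : Gap w
  west_eq : west.1 = (height, left.length)
  south_eq : south.1 = (height, left.length + 1)
  north_eq : north.1 = (height + 1, left.length + 1)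
  east_eq : east.1 = (height, left.length + 2)

namespace Crossing

variable {c : ℕ} {w : List (Slice c)} (χ : Crossing w)

def sign : CrossSign := crossSign χ.kind χ.sl χ.sr

/-- Turn the crossing until both strands point upwards. Then `inL`, `inR` are the incoming
semiarcs at the bottom left and bottom right, `outL`, `outR` the outgoing semiarcs at the top left
and top right, and `side` is the region on the right. -/
def inL : Semiarc w :=
  match χ.sl.up, χ.sr.up with
  | true, true => χ.bl.arc
  | true, false => χ.tl.arc
  | false, true => χ.br.arc
  | false, false => χ.tr.arc

def inR : Semiarc w :=
  match χ.sl.up, χ.sr.up with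
  | true, true => χ.br.arc
  | true, false => χ.bl.arc
  | false, true => χ.tr.arc
  | false, false => χ.tl.arc

def outL : Semiarc w :=
  match χ.sl.up, χ.sr.up with
  | true, true => χ.tl.arc
  | true, false => χ.tr.arc
  | false, true => χ.bl.arc
  | false, false => χ.br.arc

def outR : Semiarc w :=
  match χ.sl.up, χ.sr.up with
  | true, true => χ.tr.arc
  | true, false => χ.br.arc
  | false, true => χ.tl.arc
  | false, false => χ.bl.arc

def side : Region w :=
  match χ.sl.up, χ.sr.up with
  | true, true => χ.east.region
  | true, false => χ.south.region
  | false, true => χ.north.region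
  | false, false => χ.west.region

end Crossing

section Labeling

variable {X S : Type*} (b : VirtualBirack X) (σ : Shadow b S)

/-- An `X,S`-labeling of a diagram: elements of `X` on the semiarcs and of `S` on the regions. At a
positive crossing `B (inL, inR) = (outL, outR)`, at a negative one `B (outL, outR) = (inL, inR)`, at
a virtual one `V (inL, inR) = (outL, outR)`. If a semiarc is labeled `x` and the region to its right
`A`, then the region to its left is labeled `A · x`. -/
structure Labeling {c : ℕ} (w : List (Slice c)) where
  arc : Semiarc w → X
  region : Region w → S
  crossing : ∀ χ : Crossing w,
    match χ.sign with
    | .pos => b.B (arc χ.inL, arc χ.inR) = (arc χ.outL, arc χ.outR)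
    | .neg => b.B (arc χ.outL, arc χ.outR) = (arc χ.inL, arc χ.inR)
    | .virt => b.V (arc χ.inL, arc χ.inR) = (arc χ.outL, arc χ.outR)
  shadow : ∀ (p : Point w) (g h : Gap w), g.1 = p.1 → h.1 = (p.1.1, p.1.2 + 1) →
    if p.strand.up then region g.region = σ.act (arc p.arc) (region h.region)
    else region h.region = σ.act (arc p.arc) (region g.region)

variable {b σ}

/-- The free `ℤ[X,S]`-module on the beads: one generator for each semiarc. -/
def bead {c : ℕ} {w : List (Slice c)} (a : Semiarc w) : Semiarc w →₀ Alg b σ :=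
  Finsupp.single a 1

open Gen in
/-- The bead relations of a labeled diagram. At a positive crossing with
`(x, y) = (inL, inR)`, beads `a` on `inL`, `b` on `inR`, `c` on `outL`, `d` on `outR` satisfy
`c = t b + s a` and `d = r a`, the coefficients having indices `A, x, y`, with `A` the label of the
region `side`; a negative crossing is the inverse of a positive one; at a virtual crossing `c = v b`
and `d = v⁻¹ a`. -/
inductive BeadRel {c : ℕ} {w : List (Slice c)} (f : Labeling b σ w) :
    (Semiarc w →₀ Alg b σ) → Prop
  | pos_left (χ : Crossing w) (h : χ.sign = .pos) : BeadRel f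
      (bead χ.outL
        - (Alg.gen b σ (t (f.region χ.side) (f.arc χ.inL) (f.arc χ.inR)) • bead χ.inR
          + Alg.gen b σ (s (f.region χ.side) (f.arc χ.inL) (f.arc χ.inR)) • bead χ.inL))
  | pos_right (χ : Crossing w) (h : χ.sign = .pos) : BeadRel f
      (bead χ.outR
        - Alg.gen b σ (r (f.region χ.side) (f.arc χ.inL) (f.arc χ.inR)) • bead χ.inL)
  | neg_left (χ : Crossing w) (h : χ.sign = .neg) : BeadRel f
      (bead χ.inL
        - (Alg.gen b σ (t (f.region χ.side) (f.arc χ.outL) (f.arc χ.outR)) • bead χ.outR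
          + Alg.gen b σ (s (f.region χ.side) (f.arc χ.outL) (f.arc χ.outR)) • bead χ.outL))
  | neg_right (χ : Crossing w) (h : χ.sign = .neg) : BeadRel f
      (bead χ.inR
        - Alg.gen b σ (r (f.region χ.side) (f.arc χ.outL) (f.arc χ.outR)) • bead χ.outL)
  | virt_left (χ : Crossing w) (h : χ.sign = .virt) : BeadRel f
      (bead χ.outL
        - Alg.gen b σ (v (f.region χ.side) (f.arc χ.inL) (f.arc χ.inR)) • bead χ.inR)
  | virt_right (χ : Crossing w) (h : χ.sign = .virt) : BeadRel f
      (bead χ.outR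
        - Alg.gen b σ (vi (f.region χ.side) (f.arc χ.inL) (f.arc χ.inR)) • bead χ.inL)

/-- The fundamental `ℤ[X,S]`-module `ℤ[f]` of a labeling `f`. -/
abbrev FundModule {c : ℕ} {w : List (Slice c)} (f : Labeling b σ w) : Type _ :=
  (Semiarc w →₀ Alg b σ) ⧸ Submodule.span (Alg b σ) {q | BeadRel f q}

/-- `Hom(ℤ[f], G)`, the homomorphisms of `ℤ[X,S]`-modules. -/
abbrev HomModule {c : ℕ} {w : List (Slice c)} (f : Labeling b σ w)
    (G : Type*) [AddCommGroup G] [Module (Alg b σ) G] : Type _ :=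
  FundModule f →ₗ[Alg b σ] G

end Labeling

/-! ## The invariants -/

/-- For every `w ∈ (ℤ_N)^c`, a diagram `(L, w)` of the link of `D` with writhe vector `w`. -/
structure FramingTile {c : ℕ} (D : LinkDiagram c) (N : ℕ) where
  diagram : (Fin c → ZMod N) → LinkDiagram c
  isotopic : ∀ w, NumberedIsotopic D (diagram w)
  writhe_eq : ∀ w i, ((diagram w).writhe i : ZMod N) = w i

section Invariants

variable {X S : Type*} {b : VirtualBirack X} (σ : Shadow b S)
  (G : Type*) [AddCommGroup G] [Module (Alg b σ) G]
  {c c' : ℕ} {D : LinkDiagram c} {D' : LinkDiagram c'}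

/-- The index set of the virtual shadow module multiset: all labelings of all `(L, w)`. -/
abbrev TileLabeling (F : FramingTile D b.rank) : Type _ :=
  Σ w : Fin c → ZMod b.rank, Labeling b σ (F.diagram w).slices

/-- Equality of the virtual shadow module multisets: the two families of modules
`Hom(ℤ[f], G)` agree up to order and isomorphism. The isomorphisms are linear over the ring of
`ℤ[X,S]`-endomorphisms of `G`, which acts on `Hom(ℤ[f], G)` by composition; so they are linear over
`ℤ[X,S]` and, when `G` is itself a commutative ring over which `ℤ[X,S]` acts, over `G`. -/
def SameModuleMultiset (F : FramingTile D b.rank) (F' : FramingTile D' b.rank) : Prop :=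
  ∃ e : TileLabeling σ F ≃ TileLabeling σ F', ∀ f : TileLabeling σ F,
    Nonempty (HomModule f.2 G ≃ₗ[Module.End (Alg b σ) G] HomModule (e f).2 G)

/-- The virtual shadow module polynomial `∑_w ∑_f u ^ |Hom(ℤ[f], G)|`. The sums are finite when `X`
and `S` are finite. (An infinite `Hom(ℤ[f], G)` contributes `u ^ 0`, a finite one never does.) -/
def modulePolynomial (F : FramingTile D b.rank) : Polynomial ℤ :=
  ∑ᶠ (w : Fin c → ZMod b.rank) (f : Labeling b σ (F.diagram w).slices),
    Polynomial.X ^ Nat.card (HomModule f G)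

end Invariants

end VirtualShadow

end

noncomputable section

namespace VirtualShadow

universe uX uS uG

/-! ## Relations in the virtual birack shadow algebra -/

section AlgebraRelations

variable {X S : Type*} {b : VirtualBirack X} {σ : Shadow b S}

/-! A labeling `f` together with a homomorphism from its fundamental module to `G` is the same thing
as a labeling of semiarcs by `X × G` and of regions by `S`, subject at each crossing to one local
rule, `CrossRel`, which joins the (virtual) birack operation to the bead relations. So everything
reduces to matching such enriched labelings of two diagrams whose framings agree modulo the rank, in
a way compatible with linear maps of `G`.

Cut along its slices, a diagram becomes a word, and an enriched labeling becomes a path of labels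
from level to level. For a local move it is enough that the two stacks allow the same labels at
bottom and top, and that inner labels are determined by these (`Rigid`); then `PathIso.of_sat`
matches the paths, and naturality is automatic. Bigons cancel because a crossing is invertible
(`crossRel_flip`), crossings slide over extrema because the rule is invariant under quarter turns
(`crossRel_turn`), and all triangle moves follow by these symmetries from three upward ones:
`triangleRule_above`, `triangleRule_virt` and `triangleRule_mixed`. There the Yang-Baxter equations
handle the colors, the shadow axioms the regions, and the relations of the algebra the beads.

A classical kink is not invisible: it acts on its strand by a permutation `kinkPerm` or its inverse.
For a loop on one side this is read off from the definition of `π`; for a loop on the other side it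
is deduced with the Whitney trick (`whitney`). By the last relation of the algebra the `N`-th power
of this permutation is the identity. Twists by kinks pass through crossings (a triangle move,
`CrossRel.kink_pass`) and round extrema (`turn_twist`), so in a diagram decorated with kinks only
their number on each component matters (`LinkDiagram.deco_iso_of_total_eq`). Each move then
preserves labelings as long as, on each component, the writhe plus the number of decorating kinks
stays fixed (`MoveStep.linked`). Multiples of `N` drop out, so diagrams with congruent writhe
vectors have naturally matching labelings (`Linked.pathIso`).

Finally, naturality in `G` recovers the modules from these bijections of sets: the zero map
separates the labelings, endomorphisms of `G` give linearity, and maps from `G × G` to `G` give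
additivity (`HomEquiv.nonempty_linearEquiv`). Diagrams with prescribed writhes modulo `N` exist
because positive kinks can be inserted on any component (`LinkDiagram.exists_kink`). -/

lemma Alg.mk_eq_zero {q : MvPolynomial (Gen X S) ℤ} (h : IdealGen b σ q) :
    (Ideal.Quotient.mk (Ideal.span {q | IdealGen b σ q}) q) = 0 :=
  Ideal.Quotient.eq_zero_iff_mem.2 (Ideal.subset_span h)

/-- The quotient map onto `ℤ[X,S]`. -/
def Alg.mk (b : VirtualBirack X) (σ : Shadow b S) : MvPolynomial (Gen X S) ℤ →+* Alg b σ :=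
  Ideal.Quotient.mk (Ideal.span {q | IdealGen b σ q})

lemma Alg.mk_X (g : Gen X S) : Alg.mk b σ (.X g) = Alg.gen b σ g := rfl

lemma Alg.mk_rel {q : MvPolynomial (Gen X S) ℤ} (h : IdealGen b σ q) : Alg.mk b σ q = 0 :=
  Alg.mk_eq_zero h

variable (σ)

/-- The coefficients of the bead relations. -/
abbrev cv (A : S) (x y : X) : Alg b σ := Alg.gen b σ (.v A x y)
abbrev ct (A : S) (x y : X) : Alg b σ := Alg.gen b σ (.t A x y)
abbrev cr (A : S) (x y : X) : Alg b σ := Alg.gen b σ (.r A x y)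
abbrev cs (A : S) (x y : X) : Alg b σ := Alg.gen b σ (.s A x y)
abbrev cvi (A : S) (x y : X) : Alg b σ := Alg.gen b σ (.vi A x y)
abbrev cti (A : S) (x y : X) : Alg b σ := Alg.gen b σ (.ti A x y)
abbrev cri (A : S) (x y : X) : Alg b σ := Alg.gen b σ (.ri A x y)

variable {σ}

lemma cv_inv (A : S) (x y : X) : cv σ A x y * cvi σ A x y = 1 := by
  have h := Alg.mk_rel (b := b) (σ := σ) (.v_inv A x y)
  simpa only [map_sub, map_mul, map_add, map_one, Alg.mk_X, sub_eq_zero] using h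

lemma ct_inv (A : S) (x y : X) : ct σ A x y * cti σ A x y = 1 := by
  have h := Alg.mk_rel (b := b) (σ := σ) (.t_inv A x y)
  simpa only [map_sub, map_mul, map_add, map_one, Alg.mk_X, sub_eq_zero] using h

lemma cr_inv (A : S) (x y : X) : cr σ A x y * cri σ A x y = 1 := by
  have h := Alg.mk_rel (b := b) (σ := σ) (.r_inv A x y)
  simpa only [map_sub, map_mul, map_add, map_one, Alg.mk_X, sub_eq_zero] using h

end AlgebraRelations

/-! ## The labeling rule at a crossing -/

/-- The opposite sign. -/
def CrossSign.opp : CrossSign → CrossSign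
  | pos => neg
  | neg => pos
  | virt => virt

/-- The sign of a crossing of the given kind; the flag tells whether both strands point in the same
vertical direction. -/
def CrossKind.sign : CrossKind → Bool → CrossSign
  | virt, _ => .virt
  | above, true => .pos
  | above, false => .neg
  | below, true => .neg
  | below, false => .pos

lemma crossSign_eq {c : ℕ} (k : CrossKind) (sl sr : Strand c) :
    crossSign k sl sr = k.sign (sl.up == sr.up) := by
  unfold crossSign
  cases k <;> cases (sl.up == sr.up) <;> rfl

lemma CrossKind.sign_swap (k : CrossKind) (e : Bool) : k.swap.sign e = (k.sign e).opp := by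
  cases k <;> cases e <;> rfl

lemma CrossKind.swap_swap (k : CrossKind) : k.swap.swap = k := by cases k <;> rfl

lemma CrossKind.sign_not (k : CrossKind) (e : Bool) : k.swap.sign (!e) = k.sign e := by
  cases k <;> cases e <;> rfl

section Labels

variable {X S G : Type*} {b : VirtualBirack X} (σ : Shadow b S)

/-- The label of the region to the right of a strand with the given direction and label, in terms of
the label of the region to its left. -/
def step (A : S) (u : Bool) (l : X × G) : S :=
  match u with
  | true => (σ.act l.1).symm A
  | false => σ.act l.1 A

@[simp] lemma step_not (A : S) (u : Bool) (l : X × G) :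
    step σ (step σ A u l) (!u) l = A := by
  cases u <;> simp [step]

variable {σ} in
lemma step_up {A E : S} {x : X} {a : G} (h : A = σ.act x E) : step σ A true (x, a) = E := by
  subst h; simp [step]

variable [AddCommGroup G] [Module (Alg b σ) G]

/-- Labels and beads around an upward positive crossing with region `A` on its right: incoming
`p, q`, outgoing `r, s`. -/
def PosRel (A : S) (p q r s : X × G) : Prop :=
  b.B (p.1, q.1) = (r.1, s.1) ∧
    r.2 = ct σ A p.1 q.1 • q.2 + cs σ A p.1 q.1 • p.2 ∧ s.2 = cr σ A p.1 q.1 • p.2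

/-- Labels and beads around an upward virtual crossing with region `A` on its right. -/
def VirtRel (A : S) (p q r s : X × G) : Prop :=
  b.V (p.1, q.1) = (r.1, s.1) ∧ r.2 = cv σ A p.1 q.1 • q.2 ∧ s.2 = cvi σ A p.1 q.1 • p.2

/-- Labels and beads around an upward crossing of given sign with region `A` on its right. -/
def SignRel (g : CrossSign) (A : S) (p q r s : X × G) : Prop :=
  match g with
  | .pos => PosRel σ A p q r s
  | .neg => PosRel σ A r s p q
  | .virt => VirtRel σ A p q r s

/-- Labels and beads around a crossing with strands of directions `u₁, u₂`, region `A` on its left,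
`p, q` at the bottom and `r, s` at the top. -/
def CrossRel (k : CrossKind) (u₁ u₂ : Bool) (A : S) (p q r s : X × G) : Prop :=
  match u₁, u₂ with
  | true, true => SignRel σ (k.sign true) (step σ (step σ A true p) true q) p q r s
  | true, false => SignRel σ (k.sign false) (step σ A true p) r p s q
  | false, true => SignRel σ (k.sign false) (step σ A true r) q s p r
  | false, false => SignRel σ (k.sign true) A s r q p

variable {σ}

/-- This is the shadow axiom for `B`: both ways of walking from the right of the crossing to its
left end in the same region label. -/
lemma PosRel.region {A : S} {p q r s : X × G} (h : PosRel σ A p q r s) :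
    σ.act p.1 (σ.act q.1 A) = σ.act r.1 (σ.act s.1 A) := by
  have h1 := σ.act_B A q.1 p.1
  have := h.1
  simp only [VirtualBirack.up, VirtualBirack.lo, this] at h1
  exact h1.symm

lemma VirtRel.region {A : S} {p q r s : X × G} (h : VirtRel σ A p q r s) :
    σ.act p.1 (σ.act q.1 A) = σ.act r.1 (σ.act s.1 A) := by
  have h1 := σ.act_V A q.1 p.1
  have := h.1
  simp only [VirtualBirack.vup, VirtualBirack.vlo, this] at h1
  exact h1.symm

lemma SignRel.region {g : CrossSign} {A : S} {p q r s : X × G} (h : SignRel σ g A p q r s) :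
    σ.act p.1 (σ.act q.1 A) = σ.act r.1 (σ.act s.1 A) := by
  cases g
  · exact PosRel.region h
  · exact (PosRel.region h).symm
  · exact VirtRel.region h

/-- `V` is an involution, and relation vII gives both readings of the crossing the same coefficient;
since one strand is multiplied by `v` and the other by its inverse, the two factors trade places. -/
lemma VirtRel.inv {A : S} {p q r s : X × G} (h : VirtRel σ A p q r s) :
    VirtRel σ A r s p q := by
  obtain ⟨h1, h2, h3⟩ := h
  have hv : cv σ A r.1 s.1 = cv σ A p.1 q.1 := by
    have h := Alg.mk_rel (b := b) (σ := σ) (.vII A p.1 q.1)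
    simp only [VirtualBirack.vup, VirtualBirack.vlo, h1] at h
    simpa only [map_sub, Alg.mk_X, sub_eq_zero] using h
  have e1 := cv_inv (σ := σ) A p.1 q.1
  have e2 := cv_inv (σ := σ) A r.1 s.1
  refine ⟨by rw [← h1, b.V_V], ?_, ?_⟩
  · rw [h3, hv, smul_smul, e1, one_smul]
  · rw [h2, ← hv, smul_smul, mul_comm, e2, one_smul]

lemma signRel_opp {g : CrossSign} {A : S} {p q r s : X × G} :
    SignRel σ g.opp A r s p q ↔ SignRel σ g A p q r s := by
  cases g
  · exact Iff.rfl
  · exact Iff.rfl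
  · exact ⟨VirtRel.inv, VirtRel.inv⟩

/-- The labels of the regions around a crossing are consistent. -/
lemma CrossRel.region {k : CrossKind} {u₁ u₂ : Bool} {A : S} {p q r s : X × G}
    (h : CrossRel σ k u₁ u₂ A p q r s) :
    step σ (step σ A u₁ p) u₂ q = step σ (step σ A u₂ r) u₁ s := by
  cases u₁ <;> cases u₂ <;> have h1 := SignRel.region h <;> simp only [step] at h1 ⊢
  · exact h1.symm
  · rw [Equiv.apply_symm_apply] at h1; rw [← h1, Equiv.symm_apply_apply]
  · rw [Equiv.apply_symm_apply] at h1; rw [h1, Equiv.symm_apply_apply]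
  · rw [Equiv.apply_symm_apply, Equiv.apply_symm_apply] at h1
    conv_rhs => rw [h1]
    simp

/-- A crossing read from top to bottom. -/
lemma crossRel_flip {k : CrossKind} {u₁ u₂ : Bool} {A : S} {p q r s : X × G} :
    CrossRel σ k.swap u₂ u₁ A r s p q ↔ CrossRel σ k u₁ u₂ A p q r s := by
  have key : ∀ {k : CrossKind} {u₁ u₂ : Bool} {A : S} {p q r s : X × G},
      CrossRel σ k u₁ u₂ A p q r s → CrossRel σ k.swap u₂ u₁ A r s p q := by
    intro k u₁ u₂ A p q r s h
    have h1 := h.region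
    cases u₁ <;> cases u₂ <;> simp only [CrossRel, CrossKind.sign_swap] at h ⊢
    · exact signRel_opp.2 h
    · exact signRel_opp.2 h
    · exact signRel_opp.2 h
    · rw [← h1]; exact signRel_opp.2 h
  exact ⟨fun h => by simpa only [CrossKind.swap_swap] using key h, key⟩

/-- A crossing turned by a quarter turn. -/
lemma crossRel_turn {k : CrossKind} {u₁ u₂ : Bool} {A : S} {p q r s : X × G} :
    CrossRel σ k.swap u₂ (!u₁) (step σ A u₁ p) q s p r ↔ CrossRel σ k u₁ u₂ A p q r s := by
  cases u₁ <;> cases u₂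
  · simp only [CrossRel, Bool.not_false]
    rw [← CrossKind.sign_not k true, show step σ (step σ A false p) true p = A from
      step_not σ A false p]
    exact Iff.rfl
  -- The region on the right of the turned crossing is reached by two routes. They agree only
  -- because the labels around the crossing are consistent, which each implication must extract from
  -- its own hypothesis.
  · have e1 (h : CrossRel σ k false true A p q r s) :
        step σ (step σ (step σ A false p) true q) true s = step σ A true r := by
      rw [h.region]; exact step_not σ (step σ A true r) false s
    have e2 (h : CrossRel σ k.swap true true (step σ A false p) q s p r) :
        step σ (step σ (step σ A false p) true q) true s = step σ A true r := by
      rw [h.region, show step σ (step σ A false p) true p = A from step_not σ A false p]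
    constructor <;> intro h
    · have h1 := e2 h
      simp only [CrossRel] at h ⊢
      rwa [h1, ← Bool.not_false, CrossKind.sign_not] at h
    · have h1 := e1 h
      simp only [CrossRel, Bool.not_false] at h ⊢
      rwa [h1, ← Bool.not_false, CrossKind.sign_not]
  · simp only [CrossRel, Bool.not_true]
    rw [← CrossKind.sign_not k false]; exact Iff.rfl
  · simp only [CrossRel, Bool.not_true]
    rw [← CrossKind.sign_not k true]; exact Iff.rfl

/-- A crossing turned by a quarter turn in the other direction. -/
lemma crossRel_turn' {k : CrossKind} {u₁ u₂ : Bool} {A : S} {p q r s : X × G} :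
    CrossRel σ k.swap (!u₂) u₁ (step σ A u₂ r) r p s q ↔ CrossRel σ k u₁ u₂ A p q r s := by
  rw [← crossRel_turn (k := k.swap), step_not, Bool.not_not, CrossKind.swap_swap]

end Labels

lemma smul_inv_cancel {R M : Type*} [CommRing R] [AddCommGroup M] [Module R M] {a a' : R}
    (h : a * a' = 1) (x y : M) : x = a • y ↔ y = a' • x := by
  constructor
  · rintro rfl; rw [smul_smul, mul_comm, h, one_smul]
  · rintro rfl; rw [smul_smul, h, one_smul]

lemma existsUnique_prod_swap {α β : Type*} {P : α × β → Prop} (h : ∃! t : α × β, P t) :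
    ∃! t : β × α, P t.swap := by
  obtain ⟨⟨x, y⟩, h1, h2⟩ := h
  refine ⟨(y, x), h1, ?_⟩
  rintro ⟨y', x'⟩ h3
  have := h2 (x', y') h3
  simp only [Prod.mk.injEq] at this ⊢
  exact ⟨this.2, this.1⟩

/-! ### Solving a crossing for its outgoing or incoming ends -/

section Outgoing

variable {X S G : Type*} {b : VirtualBirack X} {σ : Shadow b S}
  [AddCommGroup G] [Module (Alg b σ) G]

lemma PosRel.existsUnique_out (A : S) (p q : X × G) :
    ∃! t : (X × G) × (X × G), PosRel σ A p q t.1 t.2 := by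
  refine ⟨(((b.B (p.1, q.1)).1, _), ((b.B (p.1, q.1)).2, _)), ⟨rfl, rfl, rfl⟩, ?_⟩
  rintro ⟨⟨x, a⟩, ⟨y, c⟩⟩ ⟨h1, h2, h3⟩
  simp only at h1 h2 h3
  simp [h1, h2, h3]

/-- On colors `b.B` is inverted; on beads the crossing is a triangular system whose diagonal entries
are the units `cr` and `ct`. -/
lemma PosRel.existsUnique_in (A : S) (r s : X × G) :
    ∃! t : (X × G) × (X × G), PosRel σ A t.1 t.2 r s := by
  obtain ⟨⟨x, y⟩, hxy⟩ := b.B.surjective (r.1, s.1)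
  have ht := ct_inv (σ := σ) A x y
  have hr := cr_inv (σ := σ) A x y
  refine ⟨((x, cri σ A x y • s.2),
    (y, cti σ A x y • (r.2 - cs σ A x y • cri σ A x y • s.2))), ⟨hxy, ?_, ?_⟩, ?_⟩
  · simp only [smul_smul]; rw [ht, one_smul, sub_add_cancel]
  · simp only [smul_smul]; rw [hr, one_smul]
  · rintro ⟨⟨x', a⟩, ⟨y', c⟩⟩ ⟨h1, h2, h3⟩
    have h4 := b.B.injective (h1.trans hxy.symm)
    simp only [Prod.mk.injEq] at h4
    obtain ⟨rfl, rfl⟩ := h4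
    simp only at h2 h3
    rw [smul_inv_cancel hr] at h3
    subst h3
    have h5 := sub_eq_iff_eq_add.2 h2
    rw [smul_inv_cancel ht] at h5
    rw [h5]

lemma VirtRel.existsUnique_out (A : S) (p q : X × G) :
    ∃! t : (X × G) × (X × G), VirtRel σ A p q t.1 t.2 := by
  refine ⟨(((b.V (p.1, q.1)).1, _), ((b.V (p.1, q.1)).2, _)), ⟨rfl, rfl, rfl⟩, ?_⟩
  rintro ⟨⟨x, a⟩, ⟨y, c⟩⟩ ⟨h1, h2, h3⟩
  simp only at h1 h2 h3
  simp [h1, h2, h3]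

end Outgoing

/-! ### Solving a crossing sideways -/

section Sideways

variable {X S G : Type*} [Finite X] {b : VirtualBirack X} {σ : Shadow b S}

/-- The axiom gives only one direction. For the converse every pair must have the form `((F z).1,
z.1)`: this map of `z` is injective because `T` recovers the second entry of `z` from its value,
hence surjective by finiteness. -/
lemma sideways_iff {F T : X × X ≃ X × X}
    (h : ∀ x y, T ((F (x, y)).1, x) = ((F (x, y)).2, y)) (x y p q : X) :
    F (x, y) = (p, q) ↔ T (p, x) = (q, y) := by
  have inj : Function.Injective fun z : X × X => ((F z).1, z.1) := by
    rintro ⟨x, y⟩ ⟨x', y'⟩ e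
    simp only [Prod.mk.injEq] at e
    obtain ⟨e1, rfl⟩ := e
    have h1 := h x y
    rw [e1, h x y'] at h1
    exact Prod.ext rfl (Prod.ext_iff.1 h1).2.symm
  constructor
  · intro e
    have := h x y
    rwa [e] at this
  · intro e
    obtain ⟨⟨x', y'⟩, e'⟩ := Finite.surjective_of_injective inj (p, x)
    simp only [Prod.mk.injEq] at e'
    obtain ⟨e1, rfl⟩ := e'
    have h1 := h x' y'
    rw [e1, e] at h1
    obtain ⟨h2, h3⟩ := Prod.ext_iff.1 h1
    simp only at h2 h3
    rw [h3, ← e1, h2]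

lemma B_iff (x y p q : X) : b.B (x, y) = (p, q) ↔ b.sideB (p, x) = (q, y) :=
  sideways_iff b.sideB_spec x y p q

lemma V_iff (x y p q : X) : b.V (x, y) = (p, q) ↔ b.sideV (p, x) = (q, y) :=
  sideways_iff b.sideV_spec x y p q

variable [AddCommGroup G] [Module (Alg b σ) G]

/-- Colors come from inverting the sideways map. On beads only `cr` has to be inverted, since the
other relation computes the remaining bead outright. -/
lemma PosRel.existsUnique_left (A : S) (q s : X × G) :
    ∃! t : (X × G) × (X × G), PosRel σ A t.1 q t.2 s := by
  obtain ⟨⟨z, x⟩, hxy⟩ := b.sideB.surjective (s.1, q.1)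
  have hr := cr_inv (σ := σ) A x q.1
  refine ⟨((x, cri σ A x q.1 • s.2),
    (z, ct σ A x q.1 • q.2 + cs σ A x q.1 • cri σ A x q.1 • s.2)),
      ⟨(B_iff _ _ _ _).2 hxy, rfl, ?_⟩, ?_⟩
  · simp only [smul_smul]; rw [hr, one_smul]
  · rintro ⟨⟨x', a⟩, ⟨z', c⟩⟩ ⟨h1, h2, h3⟩
    have h4 := b.sideB.injective (((B_iff _ _ _ _).1 h1).trans hxy.symm)
    simp only [Prod.mk.injEq] at h4
    obtain ⟨rfl, rfl⟩ := h4
    simp only at h2 h3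
    rw [smul_inv_cancel hr] at h3
    subst h3
    rw [h2]

/-- The labels `q, s` of the right strands are determined by those on the left and by the region
`act s A` that lies between the outgoing ends. -/
lemma PosRel.existsUnique_right (A : S) (p r : X × G) :
    ∃! t : (X × G) × (X × G), PosRel σ ((σ.act t.2.1).symm A) p t.1 r t.2 := by
  obtain ⟨⟨z, y⟩, hxy⟩ : ∃ u, u = b.sideB (r.1, p.1) := ⟨_, rfl⟩
  have ht := ct_inv (σ := σ) ((σ.act z).symm A) p.1 y
  refine ⟨((y, cti σ ((σ.act z).symm A) p.1 y • (r.2 - cs σ ((σ.act z).symm A) p.1 y • p.2)),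
    (z, cr σ ((σ.act z).symm A) p.1 y • p.2)),
      ⟨(B_iff _ _ _ _).2 hxy.symm, ?_, rfl⟩, ?_⟩
  · simp only [smul_smul]; rw [ht, one_smul, sub_add_cancel]
  · rintro ⟨⟨y', a⟩, ⟨z', c⟩⟩ ⟨h1, h2, h3⟩
    have h4 := hxy.trans ((B_iff _ _ _ _).1 h1)
    simp only [Prod.mk.injEq] at h4
    obtain ⟨rfl, rfl⟩ := h4
    simp only at h2 h3
    have h5 := sub_eq_iff_eq_add.2 h2
    rw [smul_inv_cancel ht] at h5
    rw [h5, h3]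

/-- The same for the other pair of ends. -/
lemma PosRel.existsUnique_right' (A : S) (p r : X × G) :
    ∃! t : (X × G) × (X × G), PosRel σ ((σ.act t.1.1).symm A) p t.1 r t.2 := by
  obtain ⟨⟨z, y⟩, hxy⟩ : ∃ u, u = b.sideB (r.1, p.1) := ⟨_, rfl⟩
  have ht := ct_inv (σ := σ) ((σ.act y).symm A) p.1 y
  refine ⟨((y, cti σ ((σ.act y).symm A) p.1 y • (r.2 - cs σ ((σ.act y).symm A) p.1 y • p.2)),
    (z, cr σ ((σ.act y).symm A) p.1 y • p.2)),
      ⟨(B_iff _ _ _ _).2 hxy.symm, ?_, rfl⟩, ?_⟩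
  · simp only [smul_smul]; rw [ht, one_smul, sub_add_cancel]
  · rintro ⟨⟨y', a⟩, ⟨z', c⟩⟩ ⟨h1, h2, h3⟩
    have h4 := hxy.trans ((B_iff _ _ _ _).1 h1)
    simp only [Prod.mk.injEq] at h4
    obtain ⟨rfl, rfl⟩ := h4
    simp only at h2 h3
    have h5 := sub_eq_iff_eq_add.2 h2
    rw [smul_inv_cancel ht] at h5
    rw [h5, h3]

lemma VirtRel.existsUnique_left (A : S) (q s : X × G) :
    ∃! t : (X × G) × (X × G), VirtRel σ A t.1 q t.2 s := by
  obtain ⟨⟨z, x⟩, hxy⟩ := b.sideV.surjective (s.1, q.1)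
  have hr := cv_inv (σ := σ) A x q.1
  refine ⟨((x, cv σ A x q.1 • s.2), (z, cv σ A x q.1 • q.2)),
      ⟨(V_iff _ _ _ _).2 hxy, rfl, ?_⟩, ?_⟩
  · simp only [smul_smul]; rw [mul_comm, hr, one_smul]
  · rintro ⟨⟨x', a⟩, ⟨z', c⟩⟩ ⟨h1, h2, h3⟩
    have h4 := b.sideV.injective (((V_iff _ _ _ _).1 h1).trans hxy.symm)
    simp only [Prod.mk.injEq] at h4
    obtain ⟨rfl, rfl⟩ := h4
    simp only at h2 h3
    rw [← smul_inv_cancel hr] at h3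
    rw [h2, h3]

lemma VirtRel.existsUnique_right (A : S) (p r : X × G) :
    ∃! t : (X × G) × (X × G), VirtRel σ ((σ.act t.2.1).symm A) p t.1 r t.2 := by
  obtain ⟨⟨z, y⟩, hxy⟩ : ∃ u, u = b.sideV (r.1, p.1) := ⟨_, rfl⟩
  have ht := cv_inv (σ := σ) ((σ.act z).symm A) p.1 y
  refine ⟨((y, cvi σ ((σ.act z).symm A) p.1 y • r.2),
    (z, cvi σ ((σ.act z).symm A) p.1 y • p.2)),
      ⟨(V_iff _ _ _ _).2 hxy.symm, ?_, rfl⟩, ?_⟩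
  · simp only [smul_smul]; rw [ht, one_smul]
  · rintro ⟨⟨y', a⟩, ⟨z', c⟩⟩ ⟨h1, h2, h3⟩
    have h4 := hxy.trans ((V_iff _ _ _ _).1 h1)
    simp only [Prod.mk.injEq] at h4
    obtain ⟨rfl, rfl⟩ := h4
    simp only at h2 h3
    rw [smul_inv_cancel ht] at h2
    rw [h2, h3]

/-- The labels at the bottom of a crossing determine those at the top. -/
lemma CrossRel.existsUnique (k : CrossKind) (u₁ u₂ : Bool) (A : S) (p q : X × G) :
    ∃! t : (X × G) × (X × G), CrossRel σ k u₁ u₂ A p q t.1 t.2 := by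
  cases u₁ <;> cases u₂ <;> simp only [CrossRel]
  · cases k.sign true <;> simp only [SignRel]
    · exact existsUnique_prod_swap (PosRel.existsUnique_in A q p)
    · exact existsUnique_prod_swap (PosRel.existsUnique_out A q p)
    -- With both strands pointing down the unknown ends are the incoming ones, and the involution
    -- makes them outgoing.
    · simp only [show ∀ s r : X × G, VirtRel σ A s r q p ↔ VirtRel σ A q p s r from
        fun s r => ⟨VirtRel.inv, VirtRel.inv⟩]
      exact existsUnique_prod_swap (VirtRel.existsUnique_out A q p)
  · cases k.sign false <;> simp only [SignRel, step]
    · exact existsUnique_prod_swap (PosRel.existsUnique_right A q p)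
    · exact PosRel.existsUnique_right' A p q
    · exact existsUnique_prod_swap (VirtRel.existsUnique_right A q p)
  · cases k.sign false <;> simp only [SignRel]
    · exact PosRel.existsUnique_left _ p q
    · exact existsUnique_prod_swap (PosRel.existsUnique_left _ q p)
    · exact VirtRel.existsUnique_left _ p q
  · cases k.sign true <;> simp only [SignRel]
    · exact PosRel.existsUnique_out _ p q
    · exact PosRel.existsUnique_in _ p q
    · exact VirtRel.existsUnique_out _ p q

lemma CrossRel.exists (k : CrossKind) (u₁ u₂ : Bool) (A : S) (p q : X × G) :
    ∃ r s, CrossRel σ k u₁ u₂ A p q r s := by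
  obtain ⟨⟨r, s⟩, h, -⟩ := CrossRel.existsUnique (σ := σ) k u₁ u₂ A p q
  exact ⟨r, s, h⟩

lemma CrossRel.unique {k : CrossKind} {u₁ u₂ : Bool} {A : S} {p q r s r' s' : X × G}
    (h : CrossRel σ k u₁ u₂ A p q r s) (h' : CrossRel σ k u₁ u₂ A p q r' s') :
    r = r' ∧ s = s' := by
  have := (CrossRel.existsUnique (σ := σ) k u₁ u₂ A p q).unique (y₁ := (r, s)) (y₂ := (r', s')) h h'
  simpa using this

lemma CrossRel.unique_bot {k : CrossKind} {u₁ u₂ : Bool} {A : S} {p q r s p' q' : X × G}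
    (h : CrossRel σ k u₁ u₂ A p q r s) (h' : CrossRel σ k u₁ u₂ A p' q' r s) :
    p = p' ∧ q = q' :=
  (crossRel_flip.2 h).unique (crossRel_flip.2 h')

lemma CrossRel.exists_bot (k : CrossKind) (u₁ u₂ : Bool) (A : S) (r s : X × G) :
    ∃ p q, CrossRel σ k u₁ u₂ A p q r s := by
  obtain ⟨p, q, h⟩ := CrossRel.exists (σ := σ) k.swap u₂ u₁ A r s
  exact ⟨p, q, crossRel_flip.1 h⟩

end Sideways

/-! ## The triangle moves on labels -/

section Triangle

variable {X S G : Type*} {b : VirtualBirack X} (σ : Shadow b S)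
  [AddCommGroup G] [Module (Alg b σ) G]

/-- The labels around the first side of a triangle move. -/
def TriLeft (k₁₂ k₁₃ k₂₃ : CrossKind) (u₁ u₂ u₃ : Bool) (A : S) (p₁ p₂ p₃ q₃ q₂ q₁ : X × G) :
    Prop :=
  ∃ m₁ m₂ m₃, CrossRel σ k₁₂ u₁ u₂ A p₁ p₂ m₂ m₁ ∧
    CrossRel σ k₁₃ u₁ u₃ (step σ A u₂ m₂) m₁ p₃ m₃ q₁ ∧ CrossRel σ k₂₃ u₂ u₃ A m₂ m₃ q₃ q₂

/-- The labels around the second side of a triangle move. -/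
def TriRight (k₁₂ k₁₃ k₂₃ : CrossKind) (u₁ u₂ u₃ : Bool) (A : S) (p₁ p₂ p₃ q₃ q₂ q₁ : X × G) :
    Prop :=
  ∃ n₁ n₂ n₃, CrossRel σ k₂₃ u₂ u₃ (step σ A u₁ p₁) p₂ p₃ n₃ n₂ ∧
    CrossRel σ k₁₃ u₁ u₃ A p₁ n₃ q₃ n₁ ∧ CrossRel σ k₁₂ u₁ u₂ (step σ A u₃ q₃) n₁ n₂ q₂ q₁

variable (G) in
/-- Labels are carried from the first side of a triangle move to the second. -/
def TriangleRule (k₁₂ k₁₃ k₂₃ : CrossKind) (u₁ u₂ u₃ : Bool) : Prop :=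
  ∀ (A : S) (p₁ p₂ p₃ q₃ q₂ q₁ : X × G),
    TriLeft σ k₁₂ k₁₃ k₂₃ u₁ u₂ u₃ A p₁ p₂ p₃ q₃ q₂ q₁ →
      TriRight σ k₁₂ k₁₃ k₂₃ u₁ u₂ u₃ A p₁ p₂ p₃ q₃ q₂ q₁

variable {σ}

/-! ### Symmetries of the triangle rule -/

section Finite

variable [Finite X]

lemma TriRight.unique {k₁₂ k₁₃ k₂₃ : CrossKind} {u₁ u₂ u₃ : Bool} {A : S}
    {p₁ p₂ p₃ q₃ q₂ q₁ q₃' q₂' q₁' : X × G}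
    (h : TriRight σ k₁₂ k₁₃ k₂₃ u₁ u₂ u₃ A p₁ p₂ p₃ q₃ q₂ q₁)
    (h' : TriRight σ k₁₂ k₁₃ k₂₃ u₁ u₂ u₃ A p₁ p₂ p₃ q₃' q₂' q₁') :
    q₃ = q₃' ∧ q₂ = q₂' ∧ q₁ = q₁' := by
  obtain ⟨n₁, n₂, n₃, h1, h2, h3⟩ := h
  obtain ⟨n₁', n₂', n₃', h1', h2', h3'⟩ := h'
  obtain ⟨rfl, rfl⟩ := h1.unique h1'
  obtain ⟨rfl, rfl⟩ := h2.unique h2'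
  obtain ⟨rfl, rfl⟩ := h3.unique h3'
  exact ⟨rfl, rfl, rfl⟩

/-- Each side of the move is the graph of a function of the three bottom labels, so inclusion of one
graph in the other is equality. -/
lemma TriangleRule.iff {k₁₂ k₁₃ k₂₃ : CrossKind} {u₁ u₂ u₃ : Bool}
    (H : TriangleRule G σ k₁₂ k₁₃ k₂₃ u₁ u₂ u₃) (A : S) (p₁ p₂ p₃ q₃ q₂ q₁ : X × G) :
    TriLeft σ k₁₂ k₁₃ k₂₃ u₁ u₂ u₃ A p₁ p₂ p₃ q₃ q₂ q₁ ↔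
      TriRight σ k₁₂ k₁₃ k₂₃ u₁ u₂ u₃ A p₁ p₂ p₃ q₃ q₂ q₁ := by
  refine ⟨H _ _ _ _ _ _ _, fun h => ?_⟩
  obtain ⟨m₂, m₁, h1⟩ := CrossRel.exists (σ := σ) k₁₂ u₁ u₂ A p₁ p₂
  obtain ⟨m₃, q₁', h2⟩ := CrossRel.exists (σ := σ) k₁₃ u₁ u₃ (step σ A u₂ m₂) m₁ p₃
  obtain ⟨q₃', q₂', h3⟩ := CrossRel.exists (σ := σ) k₂₃ u₂ u₃ A m₂ m₃
  have hL : TriLeft σ k₁₂ k₁₃ k₂₃ u₁ u₂ u₃ A p₁ p₂ p₃ q₃' q₂' q₁' := ⟨_, _, _, h1, h2, h3⟩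
  obtain ⟨rfl, rfl, rfl⟩ := (H _ _ _ _ _ _ _ hL).unique h
  exact hL

/-- As for braids: multiplying the relation by the inverse of the crossing of strands 1 and 2, below
and above, gives the relation with these strands exchanged. -/
lemma TriangleRule.swap₁₂ {k₁₂ k₁₃ k₂₃ : CrossKind} {u₁ u₂ u₃ : Bool}
    (H : TriangleRule G σ k₁₂ k₁₃ k₂₃ u₁ u₂ u₃) :
    TriangleRule G σ k₁₂.swap k₂₃ k₁₃ u₂ u₁ u₃ := by
  rintro A p₁ p₂ p₃ q₃ q₂ q₁ ⟨m₁, m₂, m₃, h1, h2, h3⟩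
  rw [← crossRel_flip, CrossKind.swap_swap] at h1
  obtain ⟨t₂, t₁, h4⟩ := CrossRel.exists (σ := σ) k₁₂ u₁ u₂ (step σ A u₃ q₃) q₂ q₁
  obtain ⟨a₁, a₂, a₃, h5, h6, h7⟩ := (H.iff A m₂ m₁ p₃ q₃ t₂ t₁).2 ⟨_, _, _, h2, h3, h4⟩
  obtain ⟨rfl, rfl⟩ := h1.unique h5
  exact ⟨_, _, _, h6, h7, crossRel_flip.2 h4⟩

/-- The same argument, with the crossing of strands 2 and 3 carried to the other side. -/
lemma TriangleRule.swap₂₃ {k₁₂ k₁₃ k₂₃ : CrossKind} {u₁ u₂ u₃ : Bool}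
    (H : TriangleRule G σ k₁₂ k₁₃ k₂₃ u₁ u₂ u₃) :
    TriangleRule G σ k₁₃ k₁₂ k₂₃.swap u₁ u₃ u₂ := by
  rintro A p₁ p₂ p₃ q₃ q₂ q₁ ⟨m₁, m₂, m₃, h1, h2, h3⟩
  rw [← crossRel_flip, CrossKind.swap_swap] at h3
  obtain ⟨t₂, t₃, h4⟩ := CrossRel.exists_bot (σ := σ) k₂₃ u₂ u₃ (step σ A u₁ p₁) p₂ p₃
  obtain ⟨a₁, a₂, a₃, h5, h6, h7⟩ := (H.iff A p₁ t₂ t₃ m₂ m₃ q₁).2 ⟨_, _, _, h4, h1, h2⟩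
  obtain ⟨rfl, rfl⟩ := h3.unique_bot h7
  exact ⟨_, _, _, crossRel_flip.2 h4, h5, h6⟩

/-- Strand 1 is tipped over to the far right, where it is read in the opposite vertical direction.
Both of its crossings make a quarter turn, and the crossing of strands 2 and 3 is unaffected. -/
lemma TriangleRule.turn {k₁₂ k₁₃ k₂₃ : CrossKind} {u₁ u₂ u₃ : Bool}
    (H : TriangleRule G σ k₁₂ k₁₃ k₂₃ u₁ u₂ u₃) :
    TriangleRule G σ k₂₃ k₁₂.swap k₁₃.swap u₂ u₃ (!u₁) := by
  rintro A' b₁ b₂ b₃ t₃ t₂ t₁ ⟨m₁, m₂, m₃, h1, h2, h3⟩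
  -- The leftmost region of the untipped picture lies beyond strand 1.
  obtain ⟨A, rfl⟩ : ∃ A, step σ A u₁ t₃ = A' :=
    ⟨step σ A' (!u₁) t₃, by simpa using step_not σ A' (!u₁) t₃⟩
  rw [crossRel_turn] at h3
  have h4 := h3.region
  rw [h4, crossRel_turn] at h2
  obtain ⟨a₁, a₂, a₃, h5, h6, h7⟩ :=
    (H.iff A t₃ b₁ b₂ t₂ t₁ b₃).2 ⟨_, _, _, h1, h3, h2⟩
  refine ⟨a₂, a₃, a₁, ?_, crossRel_turn.2 h5, ?_⟩
  · rw [h5.region, crossRel_turn]; exact h6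
  · rw [step_not]; exact h7

/-- Tipping strand 1 to the right end and bringing it back with two transpositions restores the
order and all crossing kinds, and reverses only its direction. -/
lemma TriangleRule.not₁ {k₁₂ k₁₃ k₂₃ : CrossKind} {u₁ u₂ u₃ : Bool}
    (H : TriangleRule G σ k₁₂ k₁₃ k₂₃ u₁ u₂ u₃) :
    TriangleRule G σ k₁₂ k₁₃ k₂₃ (!u₁) u₂ u₃ := by
  simpa only [CrossKind.swap_swap] using H.turn.swap₂₃.swap₁₂

lemma TriangleRule.not₂ {k₁₂ k₁₃ k₂₃ : CrossKind} {u₁ u₂ u₃ : Bool}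
    (H : TriangleRule G σ k₁₂ k₁₃ k₂₃ u₁ u₂ u₃) :
    TriangleRule G σ k₁₂ k₁₃ k₂₃ u₁ (!u₂) u₃ := by
  simpa only [CrossKind.swap_swap] using H.swap₁₂.not₁.swap₁₂

lemma TriangleRule.not₃ {k₁₂ k₁₃ k₂₃ : CrossKind} {u₁ u₂ u₃ : Bool}
    (H : TriangleRule G σ k₁₂ k₁₃ k₂₃ u₁ u₂ u₃) :
    TriangleRule G σ k₁₂ k₁₃ k₂₃ u₁ u₂ (!u₃) := by
  simpa only [CrossKind.swap_swap] using H.swap₂₃.not₂.swap₂₃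

end Finite

/-! ### The three basic triangle moves -/

lemma posRel_iff {A : S} {p q r s : X × G} : PosRel σ A p q r s ↔
    r = (b.up q.1 p.1, ct σ A p.1 q.1 • q.2 + cs σ A p.1 q.1 • p.2) ∧
    s = (b.lo p.1 q.1, cr σ A p.1 q.1 • p.2) := by
  simp only [PosRel, VirtualBirack.up, VirtualBirack.lo, Prod.ext_iff]
  tauto

lemma virtRel_iff {A : S} {p q r s : X × G} : VirtRel σ A p q r s ↔
    r = (b.vup q.1 p.1, cv σ A p.1 q.1 • q.2) ∧
    s = (b.vlo p.1 q.1, cvi σ A p.1 q.1 • p.2) := by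
  simp only [VirtRel, VirtualBirack.vup, VirtualBirack.vlo, Prod.ext_iff]
  tauto

lemma crossRel_up {k : CrossKind} {A E : S} {x y : X} {a c : G} {r s : X × G}
    (h : A = σ.act x (σ.act y E)) :
    CrossRel σ k true true A (x, a) (y, c) r s ↔
      SignRel σ (k.sign true) E (x, a) (y, c) r s := by
  subst h
  simp [CrossRel, step]

/-- Both sides can be computed from the bottom. Colors agree by Yang-Baxter and regions by the
shadow axiom. Comparing the coefficients of the bottom beads yields III₄, III₅, III₆ at the left
end, III₂ and III₃ in the middle and III₁ at the right end. -/
lemma triangleRule_above : TriangleRule G σ .above .above .above true true true := by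
  rintro A ⟨x, a⟩ ⟨y, β⟩ ⟨z, γ⟩ q₃ q₂ q₁ ⟨m₁, m₂, m₃, h1, h2, h3⟩
  -- Coefficients are indexed by the region to the right of a crossing, so all regions are expressed
  -- through the rightmost one, `R`.
  obtain ⟨R, rfl⟩ : ∃ R, σ.act x (σ.act y (σ.act z R)) = A :=
    ⟨(σ.act z).symm ((σ.act y).symm ((σ.act x).symm A)), by simp⟩
  have yb := b.yang_baxter_B (x, y, z)
  rw [crossRel_up (E := σ.act z R) rfl] at h1
  obtain ⟨rfl, rfl⟩ := posRel_iff.1 h1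
  dsimp only at h2 h3
  have e1 : ∀ A x y, σ.act x (σ.act y A) = σ.act (b.up y x) (σ.act (b.lo x y) A) :=
    fun A x y => (σ.act_B A y x).symm
  have r1 : σ.act x (σ.act y (σ.act z R)) =
      σ.act (b.up y x) (σ.act (b.lo x y) (σ.act z R)) := e1 _ _ _
  rw [step_up r1, crossRel_up (E := R) rfl] at h2
  obtain ⟨rfl, rfl⟩ := posRel_iff.1 h2
  dsimp only at h3
  rw [e1 _ (b.lo x y) z] at r1
  rw [crossRel_up r1] at h3
  obtain ⟨rfl, rfl⟩ := posRel_iff.1 h3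
  have r2 : σ.act x (σ.act y (σ.act z R)) =
      σ.act x (σ.act (b.up z y) (σ.act (b.lo y z) R)) := congrArg (σ.act x) (e1 R y z)
  have r3 := r2.trans (e1 _ _ _)
  refine ⟨(b.lo x (b.up z y), cr σ (σ.act (b.lo y z) R) x (b.up z y) • a),
    (b.lo y z, cr σ R y z • β), (b.up z y, ct σ R y z • γ + cs σ R y z • β), ?h₁, ?h₂, ?h₃⟩
  case h₁ =>
    rw [step_up rfl, crossRel_up (E := R) rfl]
    exact posRel_iff.2 ⟨rfl, rfl⟩
  case h₂ =>
    rw [crossRel_up r2]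
    refine posRel_iff.2 ⟨?_, rfl⟩
    refine Prod.ext ?_ ?_
    · have y2 : (b.up (b.up z (b.lo x y)) (b.up y x) = b.up (b.up z y) x) :=
        congrArg (fun t => t.1) yb
      exact y2
    · have i4 := Alg.mk_rel (b := b) (σ := σ) (.III₄ R x y z)
      have i5 := Alg.mk_rel (b := b) (σ := σ) (.III₅ R x y z)
      have i6 := Alg.mk_rel (b := b) (σ := σ) (.III₆ R x y z)
      simp only [map_sub, map_mul, Alg.mk_X] at i4 i5 i6 ⊢
      linear_combination (norm := module) - (i4 • γ) - (i5 • β) - (i6 • a)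
  case h₃ =>
    have i1 := Alg.mk_rel (b := b) (σ := σ) (.III₁ R x y z)
    have i2 := Alg.mk_rel (b := b) (σ := σ) (.III₂ R x y z)
    have i3 := Alg.mk_rel (b := b) (σ := σ) (.III₃ R x y z)
    simp only [map_sub, map_mul, Alg.mk_X] at i1 i2 i3
    have y2 : (b.up (b.up z (b.lo x y)) (b.up y x) = b.up (b.up z y) x) :=
      congrArg (fun t => t.1) yb
    have y3 : b.lo (b.up y x) (b.up z (b.lo x y)) = b.up (b.lo y z) (b.lo x (b.up z y)) :=
      congrArg (fun t => t.2.1) yb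
    have y4 : b.lo (b.lo x y) z = b.lo (b.lo x (b.up z y)) (b.lo y z) :=
      congrArg (fun t => t.2.2) yb
    have e2 : σ.act x (σ.act y (σ.act z R)) = σ.act (b.up (b.up z (b.lo x y)) (b.up y x))
      (σ.act (b.lo x (b.up z y)) (σ.act (b.lo y z) R)) := by rw [r3, y2]
    rw [step_up e2, crossRel_up (E := R) rfl]
    refine posRel_iff.2 ⟨Prod.ext y3 ?_, Prod.ext y4 ?_⟩
    · simp only
      linear_combination (norm := module) - (i2 • β) - (i3 • a)
    · simp only
      linear_combination (norm := module) - (i1 • a)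

lemma mul_eq_mul_inv {R : Type*} [CommRing R] {p q r s p' q' r' s' : R} (h : p * q = r * s)
    (hp : p * p' = 1) (hq : q * q' = 1) (hr : r * r' = 1) (hs : s * s' = 1) :
    p' * q' = r' * s' := by
  linear_combination (-p' * q' * s' * r') * h + (s' * r' * q * q') * hp + (s' * r') * hq
    - (p' * q' * s * s') * hr - p' * q' * hs

/-- The middle strand of a virtual triangle meets `v` at one crossing and `v⁻¹` at the other, so the
product relation is needed in this half-inverted form. -/
lemma mul_eq_mul_inv_left {R : Type*} [CommRing R] {p q r s p' s' : R} (h : p * q = r * s)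
    (hp : p * p' = 1) (hs : s * s' = 1) : q * s' = p' * r := by
  linear_combination s' * p' * h - s' * q * hp + p' * r * hs

/-- Here each bead is only multiplied by a unit, so there is one condition per strand: vIII₁ for
strand 3, vIII₂ for strand 2, vIII₃ for strand 1. -/
lemma triangleRule_virt : TriangleRule G σ .virt .virt .virt true true true := by
  rintro A ⟨x, a⟩ ⟨y, β⟩ ⟨z, γ⟩ q₃ q₂ q₁ ⟨m₁, m₂, m₃, h1, h2, h3⟩
  obtain ⟨R, rfl⟩ : ∃ R, σ.act x (σ.act y (σ.act z R)) = A :=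
    ⟨(σ.act z).symm ((σ.act y).symm ((σ.act x).symm A)), by simp⟩
  have yb := b.yang_baxter_V (x, y, z)
  rw [crossRel_up (E := σ.act z R) rfl] at h1
  obtain ⟨rfl, rfl⟩ := virtRel_iff.1 h1
  dsimp only at h2 h3
  have e1 : ∀ A x y, σ.act x (σ.act y A) = σ.act (b.vup y x) (σ.act (b.vlo x y) A) :=
    fun A x y => (σ.act_V A y x).symm
  have r1 : σ.act x (σ.act y (σ.act z R)) =
      σ.act (b.vup y x) (σ.act (b.vlo x y) (σ.act z R)) := e1 _ _ _
  rw [step_up r1, crossRel_up (E := R) rfl] at h2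
  obtain ⟨rfl, rfl⟩ := virtRel_iff.1 h2
  dsimp only at h3
  rw [e1 _ (b.vlo x y) z] at r1
  rw [crossRel_up r1] at h3
  obtain ⟨rfl, rfl⟩ := virtRel_iff.1 h3
  have r2 : σ.act x (σ.act y (σ.act z R)) =
      σ.act x (σ.act (b.vup z y) (σ.act (b.vlo y z) R)) := congrArg (σ.act x) (e1 R y z)
  have r3 := r2.trans (e1 _ _ _)
  have i1 := Alg.mk_rel (b := b) (σ := σ) (.vIII₁ R x y z)
  have i2 := Alg.mk_rel (b := b) (σ := σ) (.vIII₂ R x y z)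
  have i3 := Alg.mk_rel (b := b) (σ := σ) (.vIII₃ R x y z)
  simp only [map_sub, map_mul, Alg.mk_X, sub_eq_zero] at i1 i2 i3
  refine ⟨(b.vlo x (b.vup z y), cvi σ (σ.act (b.vlo y z) R) x (b.vup z y) • a),
    (b.vlo y z, cvi σ R y z • β), (b.vup z y, cv σ R y z • γ), ?h₁, ?h₂, ?h₃⟩
  case h₁ =>
    rw [step_up rfl, crossRel_up (E := R) rfl]
    exact virtRel_iff.2 ⟨rfl, rfl⟩
  case h₂ =>
    rw [crossRel_up r2]
    refine virtRel_iff.2 ⟨Prod.ext (id (congrArg (fun t => t.1) yb :)) ?_, rfl⟩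
    simp only
    linear_combination (norm := module) - (i1 • γ)
  case h₃ =>
    have y2 : (b.vup (b.vup z (b.vlo x y)) (b.vup y x) = b.vup (b.vup z y) x) :=
      congrArg (fun t => t.1) yb
    have y3 : b.vlo (b.vup y x) (b.vup z (b.vlo x y)) = b.vup (b.vlo y z) (b.vlo x (b.vup z y)) :=
      congrArg (fun t => t.2.1) yb
    have y4 : b.vlo (b.vlo x y) z = b.vlo (b.vlo x (b.vup z y)) (b.vlo y z) :=
      congrArg (fun t => t.2.2) yb
    have e2 : σ.act x (σ.act y (σ.act z R)) = σ.act (b.vup (b.vup z (b.vlo x y)) (b.vup y x))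
      (σ.act (b.vlo x (b.vup z y)) (σ.act (b.vlo y z) R)) := by rw [r3, y2]
    rw [step_up e2, crossRel_up (E := R) rfl]
    refine virtRel_iff.2 ⟨Prod.ext y3 ?_, Prod.ext y4 ?_⟩
    · have := mul_eq_mul_inv_left i2 (cv_inv _ _ _) (cv_inv _ _ _)
      simp only
      linear_combination (norm := module) - (this • β)
    · have := mul_eq_mul_inv i3 (cv_inv _ _ _) (cv_inv _ _ _) (cv_inv _ _ _) (cv_inv _ _ _)
      simp only
      linear_combination (norm := module) (this • a)

/-- Strand 1 crosses the classical crossing virtually. The first mixed relation compares its own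
beads; the other three say that the coefficients `r`, `t`, `s` of the classical crossing commute
with its passage. -/
lemma triangleRule_mixed : TriangleRule G σ .virt .virt .above true true true := by
  rintro A ⟨x, a⟩ ⟨y, β⟩ ⟨z, γ⟩ q₃ q₂ q₁ ⟨m₁, m₂, m₃, h1, h2, h3⟩
  obtain ⟨R, rfl⟩ : ∃ R, σ.act x (σ.act y (σ.act z R)) = A :=
    ⟨(σ.act z).symm ((σ.act y).symm ((σ.act x).symm A)), by simp⟩
  have yb := b.yang_baxter_mixed (x, y, z)
  rw [crossRel_up (E := σ.act z R) rfl] at h1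
  obtain ⟨rfl, rfl⟩ := virtRel_iff.1 h1
  dsimp only at h2 h3
  have e1 : ∀ A x y, σ.act x (σ.act y A) = σ.act (b.vup y x) (σ.act (b.vlo x y) A) :=
    fun A x y => (σ.act_V A y x).symm
  have e1' : ∀ A x y, σ.act x (σ.act y A) = σ.act (b.up y x) (σ.act (b.lo x y) A) :=
    fun A x y => (σ.act_B A y x).symm
  have r1 : σ.act x (σ.act y (σ.act z R)) =
      σ.act (b.vup y x) (σ.act (b.vlo x y) (σ.act z R)) := e1 _ _ _
  rw [step_up r1, crossRel_up (E := R) rfl] at h2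
  obtain ⟨rfl, rfl⟩ := virtRel_iff.1 h2
  dsimp only at h3
  rw [e1 _ (b.vlo x y) z] at r1
  rw [crossRel_up r1] at h3
  obtain ⟨rfl, rfl⟩ := posRel_iff.1 h3
  have r2 : σ.act x (σ.act y (σ.act z R)) =
      σ.act x (σ.act (b.up z y) (σ.act (b.lo y z) R)) := congrArg (σ.act x) (e1' R y z)
  have r3 := r2.trans (e1 _ _ _)
  have i1 := Alg.mk_rel (b := b) (σ := σ) (.mixed₁ R x y z)
  have i2 := Alg.mk_rel (b := b) (σ := σ) (.mixed₂ R x y z)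
  have i3 := Alg.mk_rel (b := b) (σ := σ) (.mixed₃ R x y z)
  have i4 := Alg.mk_rel (b := b) (σ := σ) (.mixed₄ R x y z)
  simp only [map_sub, map_mul, Alg.mk_X, sub_eq_zero] at i1 i2 i3 i4
  refine ⟨(b.vlo x (b.up z y), cvi σ (σ.act (b.lo y z) R) x (b.up z y) • a),
    (b.lo y z, cr σ R y z • β), (b.up z y, ct σ R y z • γ + cs σ R y z • β), ?h₁, ?h₂, ?h₃⟩
  case h₁ =>
    rw [step_up rfl, crossRel_up (E := R) rfl]
    exact posRel_iff.2 ⟨rfl, rfl⟩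
  case h₂ =>
    rw [crossRel_up r2]
    refine virtRel_iff.2 ⟨Prod.ext (id (congrArg (fun t => t.1) yb :)) ?_, rfl⟩
    simp only
    linear_combination (norm := module) - (i3 • γ) - (i4 • β)
  case h₃ =>
    have y2 : (b.up (b.vup z (b.vlo x y)) (b.vup y x) = b.vup (b.up z y) x) :=
      congrArg (fun t => t.1) yb
    have y3 : b.lo (b.vup y x) (b.vup z (b.vlo x y)) = b.vup (b.lo y z) (b.vlo x (b.up z y)) :=
      congrArg (fun t => t.2.1) yb
    have y4 : b.vlo (b.vlo x y) z = b.vlo (b.vlo x (b.up z y)) (b.lo y z) :=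
      congrArg (fun t => t.2.2) yb
    have e2 : σ.act x (σ.act y (σ.act z R)) = σ.act (b.up (b.vup z (b.vlo x y)) (b.vup y x))
      (σ.act (b.vlo x (b.up z y)) (σ.act (b.lo y z) R)) := by rw [r3, y2]
    rw [step_up e2, crossRel_up (E := R) rfl]
    refine virtRel_iff.2 ⟨Prod.ext y3 ?_, Prod.ext y4 ?_⟩
    · simp only
      linear_combination (norm := module) - (i2 • β)
    · have := mul_eq_mul_inv i1 (cv_inv _ _ _) (cv_inv _ _ _) (cv_inv _ _ _) (cv_inv _ _ _)
      simp only
      linear_combination (norm := module) - (this • a)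

lemma triangleRule_of_up [Finite X] {k₁₂ k₁₃ k₂₃ : CrossKind}
    (H : TriangleRule G σ k₁₂ k₁₃ k₂₃ true true true) (u₁ u₂ u₃ : Bool) :
    TriangleRule G σ k₁₂ k₁₃ k₂₃ u₁ u₂ u₃ := by
  cases u₁ <;> cases u₂ <;> cases u₃
  · exact H.not₁.not₂.not₃
  · exact H.not₁.not₂
  · exact H.not₁.not₃
  · exact H.not₁
  · exact H.not₂.not₃
  · exact H.not₂
  · exact H.not₃
  · exact H

/-- The triangle moves, for all kinds of crossings and all orientations. -/
lemma triangleRule [Finite X] {k₁₂ k₁₃ k₂₃ : CrossKind} (h : Triangle k₁₂ k₁₃ k₂₃)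
    (u₁ u₂ u₃ : Bool) : TriangleRule G σ k₁₂ k₁₃ k₂₃ u₁ u₂ u₃ := by
  apply triangleRule_of_up
  have a := triangleRule_above (σ := σ) (G := G)
  have m := triangleRule_mixed (σ := σ) (G := G)
  -- Thirteen triples remain: six classical, six with a single classical crossing, one virtual.
  -- Transpositions of strands carry each of the three basic moves to all triples of its type.
  cases k₁₂ <;> cases k₁₃ <;> cases k₂₃ <;> simp only [Triangle, reduceCtorEq, or_self] at h
  · exact a
  · exact a.swap₂₃
  · exact a.swap₁₂.swap₂₃
  · exact m.swap₁₂.swap₂₃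
  · exact a.swap₁₂
  · exact a.swap₂₃.swap₁₂
  · exact a.swap₁₂.swap₂₃.swap₁₂
  · exact m.swap₂₃.swap₁₂.swap₂₃
  · exact m.swap₁₂
  · exact m.swap₂₃.swap₁₂
  · exact m
  · exact m.swap₂₃
  · exact triangleRule_virt

end Triangle

/-! ## Kinks -/

section Kink

variable {X S : Type*} {b : VirtualBirack X} (σ : Shadow b S)

/-- The factor a bead acquires at a positive kink with region `R` on the right of the strand. -/
def kinkFactor (R : S) (x : X) : Alg b σ := Alg.mk b σ (kinkCoeff b σ R x)

lemma kinkFactor_eq (R : S) (x : X) : kinkFactor σ R x =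
    ct σ ((σ.act (b.alpha x)).symm R) x (b.alpha x) *
      cr σ ((σ.act (b.alpha x)).symm R) x (b.alpha x) +
    cs σ ((σ.act (b.alpha x)).symm R) x (b.alpha x) := by
  simp only [kinkFactor, kinkCoeff, map_add, map_mul, Alg.mk_X]

lemma prod_kinkFactor (R : S) (x : X) :
    ∏ k ∈ Finset.range b.rank, kinkFactor σ R ((b.kink ^ k) x) = 1 := by
  have h := Alg.mk_rel (b := b) (σ := σ) (.phone R x)
  rw [map_sub, map_one, map_prod, sub_eq_zero] at h
  exact h.symm

/-! ### Iterated kinks -/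

section Beads

variable {G : Type*} [AddCommGroup G] [Module (Alg b σ) G]

/-- The effect of a positive kink with region `R` on the right. -/
def kinkFun (R : S) (l : X × G) : X × G := (b.kink l.1, kinkFactor σ R l.1 • l.2)

lemma kinkFun_iterate (R : S) (n : ℕ) (l : X × G) : (kinkFun σ R)^[n] l =
    ((b.kink ^ n) l.1, (∏ k ∈ Finset.range n, kinkFactor σ R ((b.kink ^ k) l.1)) • l.2) := by
  induction n with
  | zero => simp
  | succ n ih =>
    rw [Function.iterate_succ_apply', ih, kinkFun, Finset.prod_range_succ, smul_smul, pow_succ',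
      mul_comm]
    rfl

/-- The purpose of the phone cord relation: the color returns after `N` kinks by definition of the
rank, and the relation makes the accumulated factor of the bead equal to 1. -/
lemma kinkFun_iterate_rank (R : S) (l : X × G) : (kinkFun σ R)^[b.rank] l = l := by
  rw [kinkFun_iterate, prod_kinkFactor, one_smul, VirtualBirack.rank, pow_orderOf_eq_one]
  rfl

end Beads

/-! ### Kinks as permutations of labels -/

section Finite

variable [Finite X]

lemma rank_pos (b : VirtualBirack X) : 0 < b.rank := orderOf_pos b.kink

/-- The ends of a loop carry the same label `y` exactly when the sideways map sends `(z, x)` to the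
diagonal point `(y, y)`; this is what `alpha` and `kink` are made to solve. -/
lemma B_eq_iff (x y z : X) : b.B (x, y) = (z, y) ↔ y = b.alpha x ∧ z = b.kink x := by
  rw [B_iff, ← Equiv.eq_symm_apply, Prod.ext_iff]
  have h : y = b.alpha x ↔ x = (b.sideB.symm (y, y)).2 := by
    rw [VirtualBirack.alpha, Equiv.eq_symm_apply, eq_comm, Equiv.ofBijective_apply]
  rw [h]
  constructor
  · rintro ⟨h1, h2⟩
    refine ⟨h2, ?_⟩
    have : b.alpha x = y := (h.2 h2).symm
    simp only [VirtualBirack.kink, Equiv.trans_apply, this]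
    exact h1
  · rintro ⟨h1, h2⟩
    refine ⟨?_, h1⟩
    have : b.alpha x = y := (h.2 h1).symm
    simp only [VirtualBirack.kink, Equiv.trans_apply, this] at h2
    exact h2

lemma B_alpha (x : X) : b.B (x, b.alpha x) = (b.kink x, b.alpha x) :=
  (B_eq_iff x _ _).2 ⟨rfl, rfl⟩

/-- In the shadow axiom at the crossing of a kink, the loop acts first on both sides and, being
bijective, cancels. Hence kinks do not affect the regions beside the strand. -/
lemma act_kink (x : X) : σ.act (b.kink x) = σ.act x := by
  ext A
  have h := σ.act_B ((σ.act (b.alpha x)).symm A) (b.alpha x) x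
  simp only [VirtualBirack.up, VirtualBirack.lo, B_alpha, Equiv.apply_symm_apply] at h
  exact h

variable {G : Type*} [AddCommGroup G] [Module (Alg b σ) G]

/-- The effect of a positive kink with region `R` on the right, as a permutation. -/
def kinkPerm (R : S) : Equiv.Perm (X × G) where
  toFun := kinkFun σ R
  -- A kink is undone by `N - 1` further kinks, so the factor `t r + s` need not be inverted by
  -- hand.
  invFun := (kinkFun σ R)^[b.rank - 1]
  left_inv l := by
    rw [← Function.iterate_succ_apply, Nat.succ_eq_add_one, Nat.sub_add_cancel (rank_pos b),
      kinkFun_iterate_rank]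
  right_inv l := by
    rw [← Function.iterate_succ_apply' (kinkFun σ R), Nat.succ_eq_add_one, Nat.sub_add_cancel (rank_pos b),
      kinkFun_iterate_rank]

lemma kinkPerm_apply (R : S) (l : X × G) :
    kinkPerm σ R l = (b.kink l.1, kinkFactor σ R l.1 • l.2) := rfl

lemma kinkPerm_pow_rank (R : S) : (kinkPerm σ R : Equiv.Perm (X × G)) ^ b.rank = 1 := by
  ext1 l
  rw [Equiv.Perm.coe_pow]
  exact kinkFun_iterate_rank σ R l

lemma act_kinkPerm_zpow (R : S) (n : ℤ) (l : X × G) :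
    σ.act ((kinkPerm σ R ^ n) l).1 = σ.act l.1 := by
  have h (l : X × G) : σ.act (kinkPerm σ R l).1 = σ.act l.1 := act_kink σ l.1
  induction n generalizing l with
  | zero => rfl
  | succ n ih => rw [zpow_add_one, Equiv.Perm.mul_apply, ih, h]
  | pred n ih =>
    rw [zpow_sub_one, Equiv.Perm.mul_apply, ih, ← h ((kinkPerm σ R)⁻¹ l)]
    exact congrArg (fun l => σ.act l.1) ((kinkPerm σ R).apply_symm_apply l)

/-- The effect of `n` positive kinks on a strand with direction `u` and region `A` on its left,
read from bottom to top. -/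
def kinkTwist (A : S) (u : Bool) (n : ℤ) (l : X × G) : X × G :=
  match u with
  | true => (kinkPerm σ ((σ.act l.1).symm A) ^ n) l
  -- Going up means going against the strand, hence the inverse; the region on the strand's own
  -- right is the one drawn on its left.
  | false => (kinkPerm σ A ^ (-n)) l

lemma act_kinkTwist (A : S) (u : Bool) (n : ℤ) (l : X × G) :
    σ.act (kinkTwist σ A u n l).1 = σ.act l.1 := by
  cases u <;> exact act_kinkPerm_zpow σ _ _ _

@[simp] lemma step_kinkTwist (A A' : S) (u u' : Bool) (n : ℤ) (l : X × G) :
    step σ A u (kinkTwist σ A' u' n l) = step σ A u l := by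
  cases u <;> simp only [step, act_kinkTwist]

@[simp] lemma kinkTwist_zero (A : S) (u : Bool) (l : X × G) : kinkTwist σ A u 0 l = l := by
  cases u <;> rfl

lemma kinkTwist_add (A : S) (u : Bool) (m n : ℤ) (l : X × G) :
    kinkTwist σ A u (m + n) l = kinkTwist σ A u m (kinkTwist σ A u n l) := by
  cases u
  · simp only [kinkTwist]
    rw [neg_add, zpow_add, Equiv.Perm.mul_apply]
  · have := act_kinkTwist σ A true n l
    simp only [kinkTwist] at this ⊢
    rw [this, zpow_add, Equiv.Perm.mul_apply]

lemma kinkTwist_rank_mul (A : S) (u : Bool) (n : ℤ) (l : X × G) :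
    kinkTwist σ A u (b.rank * n) l = l := by
  have h (R : S) (n : ℤ) : ((kinkPerm σ R : Equiv.Perm (X × G)) ^ (b.rank * n)) = 1 := by
    rw [zpow_mul, zpow_natCast, kinkPerm_pow_rank, one_zpow]
  cases u
  · simp only [kinkTwist]
    rw [← mul_neg, h]; rfl
  · simp only [kinkTwist]
    rw [h]; rfl

lemma kinkTwist_congr (A : S) (u : Bool) {m n : ℤ} (h : (m : ZMod b.rank) = n) (l : X × G) :
    kinkTwist σ A u m l = kinkTwist σ A u n l := by
  obtain ⟨k, hk⟩ := (ZMod.intCast_eq_intCast_iff_dvd_sub n m b.rank).1 h.symm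
  rw [show m = n + b.rank * k by linarith, kinkTwist_add, kinkTwist_rank_mul]

@[simp] lemma kinkTwist_neg_cancel (A : S) (u : Bool) (n : ℤ) (l : X × G) :
    kinkTwist σ A u (-n) (kinkTwist σ A u n l) = l := by
  rw [← kinkTwist_add, neg_add_cancel, kinkTwist_zero]

@[simp] lemma kinkTwist_cancel_neg (A : S) (u : Bool) (n : ℤ) (l : X × G) :
    kinkTwist σ A u n (kinkTwist σ A u (-n) l) = l := by
  rw [← kinkTwist_add, add_neg_cancel, kinkTwist_zero]

/-- Turning the picture upside down exchanges the two ends of the strand and reverses its drawn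
direction, while the region on its own right stays the same because kinks do not change the action
of the color. -/
lemma kinkTwist_turn (A : S) (u : Bool) (n : ℤ) (p z : X × G) :
    p = kinkTwist σ (step σ A u p) (!u) n z ↔ z = kinkTwist σ A u n p := by
  have inv (R : S) (k : ℤ) (p z : X × G) :
      p = (kinkPerm σ R ^ (-k)) z ↔ z = (kinkPerm σ R ^ k) p := by
    rw [zpow_neg, Equiv.Perm.eq_inv_iff_eq, eq_comm]
  cases u
  · simp only [kinkTwist, step, Bool.not_false]
    constructor
    · intro h
      have : σ.act z.1 = σ.act p.1 := by
        conv_rhs => rw [h]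
        rw [act_kinkPerm_zpow]
      rw [this, Equiv.symm_apply_apply] at h
      rw [inv]
      simpa using h
    · intro h
      have : σ.act z.1 = σ.act p.1 := by rw [h, act_kinkPerm_zpow]
      rw [this, Equiv.symm_apply_apply]
      rw [inv] at h
      simpa using h
  · exact inv _ _ _ _

variable {σ}

/-- A positive kink with its loop to the right of an upward strand. -/
lemma posRel_kink_iff (R : S) (p m z : X × G) :
    PosRel σ ((σ.act m.1).symm R) p m z m ↔
      m = (b.alpha p.1, cr σ ((σ.act (b.alpha p.1)).symm R) p.1 (b.alpha p.1) • p.2) ∧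
      z = kinkPerm σ R p := by
  obtain ⟨x, a⟩ := p
  obtain ⟨y, c⟩ := m
  obtain ⟨w, d⟩ := z
  simp only [PosRel, B_eq_iff, kinkPerm_apply, kinkFactor_eq, Prod.mk.injEq]
  constructor
  · rintro ⟨⟨rfl, rfl⟩, h2, h3⟩
    refine ⟨⟨rfl, h3⟩, rfl, ?_⟩
    rw [h2, h3, smul_smul, ← add_smul]
  · rintro ⟨⟨rfl, h3⟩, rfl, h2⟩
    refine ⟨⟨rfl, rfl⟩, ?_, h3⟩
    rw [h2, h3, smul_smul, ← add_smul]

/-- The Whitney trick: successive kinks with opposite crossings and loops on opposite sides cancel.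
The strand is folded so that it meets itself in bigons, and one triangle move turns these crossings
into the two kinks. -/
lemma whitney {k : CrossKind} (hk : Triangle k.swap k.swap k) (u : Bool) (A : S) (p : X × G) :
    ∃ a m n, CrossRel σ k u u A p m a m ∧
      CrossRel σ k.swap u u (step σ A (!u) n) n a n p := by
  obtain ⟨n, p₁, h1⟩ := CrossRel.exists (σ := σ) k u (!u) A p p
  have eA : step σ (step σ A (!u) n) u n = A := by simpa using step_not σ A (!u) n
  have h1' : CrossRel σ k.swap u u (step σ A (!u) n) n p p₁ p := by
    rw [← crossRel_turn, CrossKind.swap_swap, eA]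
    exact h1
  obtain ⟨m, f, h2⟩ := CrossRel.exists_bot (σ := σ) k u (!u) (step σ A u p) p p
  have hW : step σ (step σ A (!u) n) u p₁ = A := by
    have e := h1'.region
    rw [eA] at e
    have e' := congrArg (fun R => step σ R (!u) p) e
    simpa using e'.symm
  have h2' : CrossRel σ k.swap u u (step σ (step σ A (!u) n) u p₁) p m p f := by
    rw [← crossRel_turn, CrossKind.swap_swap, hW]
    exact h2
  have h3 : CrossRel σ k u u (step σ A (!u) n) p₁ p n p := by
    rw [← crossRel_flip]
    exact h1'
  obtain ⟨d, c, a, g1, g2, g3⟩ :=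
    triangleRule hk u u u _ _ _ _ _ _ _ ⟨_, _, _, h1', h2', h3⟩
  rw [eA] at g1 g3
  rw [hW] at h2'
  -- The third crossing after the move has the same top labels as the crossing in `h2'`. Hence its
  -- bottom labels agree too, which closes both loops.
  obtain ⟨rfl, rfl⟩ := h2'.unique_bot g3
  exact ⟨a, m, n, g1, g2⟩

/-- Start the Whitney trick at `kinkPerm σ R a` with a negative kink whose loop is on the right: it
leads back to `a`, so the positive kink that follows, with loop on the left, leads from `a` to
`kinkPerm σ R a`. -/
lemma posRel_left_kink_exists (R : S) (a : X × G) : ∃ n, PosRel σ R n a n (kinkPerm σ R a) := by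
  have ha : σ.act (kinkPerm σ R a).1 = σ.act a.1 := act_kinkPerm_zpow σ R 1 a
  obtain ⟨a', m, n, h1, h2⟩ := whitney (σ := σ) (k := .below) (.inl rfl) true (σ.act a.1 R)
    (kinkPerm σ R a)
  have h1' : PosRel σ ((σ.act m.1).symm R) a' m (kinkPerm σ R a) m := by
    simpa [CrossRel, CrossKind.sign, SignRel, step, ha] using h1
  obtain rfl := (kinkPerm σ R).injective ((posRel_kink_iff R _ _ _).1 h1').2
  refine ⟨n, ?_⟩
  simpa [CrossRel, CrossKind.swap, CrossKind.sign, SignRel, step] using h2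

lemma posRel_left_kink_color {R : S} {n a d n' d' : X × G} (h : PosRel σ R n a n d)
    (h' : PosRel σ R n' a n' d') : n.1 = n'.1 ∧ d.1 = d'.1 := by
  have h1 := (B_iff _ _ _ _).1 h.1
  have h2 := (B_iff _ _ _ _).1 h'.1
  have h3 : n.1 = n'.1 := b.diag_snd.injective (a₁ := n.1) (a₂ := n'.1) (by simp only [h1, h2])
  refine ⟨h3, ?_⟩
  rw [h3, h2] at h1
  exact (Prod.ext_iff.1 h1).1.symm

/-- No defining relation states that `1 - s` is invertible here. It follows from the existence of a
loop bead in the algebra itself, as a module over itself, over the bead 1: that bead `N` satisfies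
`(1 - s) N = t`, and `t` is a unit. -/
lemma PosRel.isUnit_one_sub {R : S} {n a d : X × G} (h : PosRel σ R n a n d) :
    IsUnit (1 - cs σ R n.1 a.1) := by
  obtain ⟨N, hN⟩ := posRel_left_kink_exists (σ := σ) R (a.1, (1 : Alg b σ))
  have hc : N.1 = n.1 := by
    have h1 := (B_iff _ _ _ _).1 h.1
    have h2 := (B_iff _ _ _ _).1 hN.1
    exact b.diag_snd.injective (a₁ := N.1) (a₂ := n.1) (by simp only [h1, h2])
  have h2 := hN.2.1
  rw [hc, smul_eq_mul, smul_eq_mul] at h2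
  have ht := ct_inv (σ := σ) R n.1 a.1
  refine IsUnit.of_mul_eq_one (N.2 * cti σ R n.1 a.1) ?_
  linear_combination cti σ R n.1 a.1 * h2 + ht

/-- The bead on a left loop solves a linear equation with coefficient `1 - s`, just shown to be a
unit. -/
lemma posRel_left_kink_unique {R : S} {n a d n' d' : X × G} (h : PosRel σ R n a n d)
    (h' : PosRel σ R n' a n' d') : n = n' ∧ d = d' := by
  obtain ⟨h1, h2⟩ := posRel_left_kink_color h h'
  have e := h.2.1
  have e' := h'.2.1
  have h3 : n.2 = n'.2 := by
    rw [← sub_eq_zero, ← h.isUnit_one_sub.smul_eq_zero]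
    rw [← h1] at e'
    linear_combination (norm := module) e - e'
  have h4 : n = n' := Prod.ext h1 h3
  refine ⟨h4, Prod.ext h2 ?_⟩
  rw [h.2.2, h'.2.2, h4]

lemma posRel_left_kink {R : S} {n a d : X × G} (h : PosRel σ R n a n d) :
    d = kinkPerm σ R a := by
  obtain ⟨n', h'⟩ := posRel_left_kink_exists (σ := σ) R a
  exact (posRel_left_kink_unique h h').2

/-- A virtual kink with its loop to the right of an upward strand. -/
lemma V_eq_iff (x y z : X) : b.V (x, y) = (z, y) ↔ z = x ∧ y = (b.sideV (x, x)).1 := by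
  constructor
  · intro h
    -- Read in both directions, the kink shows that the sideways map sends `(z, x)` and `(x, z)` to
    -- the same point.
    have h' : b.V (z, y) = (x, y) := by rw [← h, b.V_V]
    rw [V_iff] at h h'
    have e := b.sideV.injective (h.trans h'.symm)
    simp only [Prod.mk.injEq] at e
    obtain ⟨rfl, -⟩ := e
    exact ⟨rfl, by rw [h]⟩
  · rintro ⟨rfl, rfl⟩
    rw [V_iff]
    exact Prod.ext rfl (b.V_diag _).symm

/-- A virtual kink with its loop to the left of an upward strand. -/
lemma V_eq_iff' (x y z : X) : b.V (y, x) = (y, z) ↔ z = x ∧ x = (b.sideV (y, y)).1 := by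
  rw [V_iff, Prod.ext_iff]
  have := b.V_diag y
  simp only
  constructor
  · rintro ⟨h1, h2⟩
    exact ⟨by rw [← h1, ← h2, this], by rw [← h2, this]⟩
  · rintro ⟨rfl, h⟩
    exact ⟨h.symm, by rw [← this, ← h]⟩

/-- Since both components of `b.sideV` agree on the diagonal, the first one already determines the
value, and `b.sideV` is injective. -/
lemma sideV_diag_bijective (b : VirtualBirack X) :
    Function.Bijective fun y => (b.sideV (y, y)).1 := by
  apply Function.Injective.bijective_of_finite
  intro y y' h
  have : b.sideV (y, y) = b.sideV (y', y') :=
    Prod.ext h (by rw [← b.V_diag y, ← b.V_diag y']; exact h)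
  exact (Prod.ext_iff.1 (b.sideV.injective this)).1

/-- The contribution of a crossing of a strand with itself to the writhe, if the kink is traversed
twice in the same vertical direction. -/
def CrossKind.kinkSign : CrossKind → ℤ
  | above => 1
  | below => -1
  | virt => 0

/-- The labels around a kink with its loop on the right. -/
lemma kink_right_existsUnique (k : CrossKind) (u : Bool) (A : S) (p : X × G) :
    ∃ m, CrossRel σ k u u A p m (kinkTwist σ A u k.kinkSign p) m ∧
      ∀ m' z, CrossRel σ k u u A p m' z m' → m' = m ∧ z = kinkTwist σ A u k.kinkSign p := by
  cases u <;> cases k <;>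
    simp only [CrossRel, CrossKind.sign, SignRel, step, CrossKind.kinkSign, kinkTwist_zero]
  -- For a strand pointing down the loop lies on its own left, so the classical cases rest on the
  -- Whitney trick.
  · obtain ⟨n, hn⟩ := posRel_left_kink_exists (σ := σ) A (kinkTwist σ A false 1 p)
    have e : kinkPerm σ A (kinkTwist σ A false 1 p) = p := (kinkPerm σ A).apply_symm_apply p
    rw [e] at hn
    refine ⟨n, hn, fun m' z h => ?_⟩
    have hz : z = kinkTwist σ A false 1 p := by
      rw [posRel_left_kink h]; exact ((kinkPerm σ A).symm_apply_apply z).symm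
    subst hz
    exact ⟨(posRel_left_kink_unique h hn).1, rfl⟩
  · obtain ⟨n, hn⟩ := posRel_left_kink_exists (σ := σ) A p
    refine ⟨n, hn, fun m' z h => ?_⟩
    exact posRel_left_kink_unique h hn
  · obtain ⟨y, hy⟩ := (sideV_diag_bijective b).2 p.1
    have hy' := (V_eq_iff' p.1 y p.1).2 ⟨rfl, hy.symm⟩
    have hv := cv_inv (σ := σ) A y p.1
    refine ⟨(y, cv σ A y p.1 • p.2), ⟨hy', rfl, ?_⟩, fun m' z h => ?_⟩
    · simp only [smul_smul]; rw [mul_comm, hv, one_smul]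
    · obtain ⟨h1, h2, h3⟩ := h
      obtain ⟨h4, h5⟩ := (V_eq_iff' _ _ _).1 h1
      have h6 : m'.1 = y := (sideV_diag_bijective b).1 (by simp only [hy, ← h5, h4])
      rw [← h4, h6] at h2 h3
      rw [← smul_inv_cancel hv] at h3
      exact ⟨Prod.ext h6 h3, Prod.ext h4.symm (by
        have := (smul_inv_cancel hv _ _).1 h2
        rw [this, h3, smul_smul, mul_comm, hv, one_smul])⟩
  · have e := posRel_kink_iff (σ := σ) (G := G) ((σ.act p.1).symm A)
    refine ⟨_, (e p _ _).2 ⟨rfl, rfl⟩, fun m' z h => ?_⟩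
    exact (e _ _ _).1 h
  · have e := posRel_kink_iff (σ := σ) (G := G) ((σ.act p.1).symm A)
    have e' : kinkPerm σ ((σ.act p.1).symm A) (kinkTwist σ A true (-1) p) = p :=
      (kinkPerm σ ((σ.act p.1).symm A)).apply_symm_apply p
    refine ⟨_, (e _ _ _).2 ⟨rfl, e'.symm⟩, fun m' z h => ?_⟩
    obtain ⟨h1, h2⟩ := (e _ _ _).1 h
    have : z = kinkTwist σ A true (-1) p :=
      (kinkPerm σ ((σ.act p.1).symm A)).injective (h2.symm.trans e'.symm)
    subst this
    exact ⟨h1, rfl⟩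
  · refine ⟨((b.sideV (p.1, p.1)).1, cvi σ ((σ.act (b.sideV (p.1, p.1)).1).symm
      ((σ.act p.1).symm A)) p.1 (b.sideV (p.1, p.1)).1 • p.2), ⟨(V_eq_iff p.1 _ p.1).2 ⟨rfl, rfl⟩, ?_, rfl⟩, fun m' z h => ?_⟩
    · simp only [smul_smul]; rw [cv_inv, one_smul]
    · obtain ⟨h1, h2, h3⟩ := h
      obtain ⟨h4, h5⟩ := (V_eq_iff _ _ _).1 h1
      refine ⟨Prod.ext h5 (by rw [h3, h5]), Prod.ext h4 ?_⟩
      rw [h2, h3, smul_smul, cv_inv, one_smul]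

/-- The labels around a kink with its loop on the left. -/
lemma kink_left_existsUnique (k : CrossKind) (u : Bool) (A : S) (p : X × G) :
    ∃ m, CrossRel σ k u u (step σ A (!u) m) m p m (kinkTwist σ A u k.kinkSign p) ∧
      ∀ m' z, CrossRel σ k u u (step σ A (!u) m') m' p m' z →
        m' = m ∧ z = kinkTwist σ A u k.kinkSign p := by
  -- A half turn, made of two quarter turns, carries a loop on the left to a loop on the right of
  -- the reversed strand.
  have half (m z : X × G) : CrossRel σ k u u (step σ A (!u) m) m p m z ↔
      CrossRel σ k (!u) (!u) (step σ A u p) z m p m := by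
    have e : step σ (step σ A (!u) m) u m = A := by simpa using step_not σ A (!u) m
    rw [← crossRel_turn, ← crossRel_turn, CrossKind.swap_swap, e]
  have hz (z) : p = kinkTwist σ (step σ A u p) (!u) k.kinkSign z ↔ _ :=
    kinkTwist_turn σ A u k.kinkSign p z
  obtain ⟨m, h1, h2⟩ := kink_right_existsUnique (σ := σ) k (!u) (step σ A u p)
    (kinkTwist σ A u k.kinkSign p)
  rw [← (hz _).2 rfl] at h1 h2
  refine ⟨m, (half _ _).2 h1, fun m' z h => ?_⟩
  rw [half] at h
  obtain ⟨m'', h3, h4⟩ := kink_right_existsUnique (σ := σ) k (!u) (step σ A u p) z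
  obtain ⟨rfl, h5⟩ := h4 _ _ h
  have h6 := (hz z).1 h5
  subst h6
  exact ⟨(h2 _ _ h).1, rfl⟩

/-- The other strand is first pushed under or over the loop by a bigon move; then a triangle move
takes it across the crossing of the kink. -/
lemma CrossRel.kink_pass {k κ : CrossKind} (hk : Triangle k κ κ) {u v : Bool} {A : S}
    {p m a q r s : X × G} (h1 : CrossRel σ k u u A p m a m) (h2 : CrossRel σ κ u v A a q r s) :
    ∃ n m', CrossRel σ κ u v A p q r n ∧ CrossRel σ k u u (step σ A v r) n m' s m' := by
  obtain ⟨q', m', h3⟩ := CrossRel.exists (σ := σ) κ (!u) v (step σ (step σ A u a) u m) m q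
  rw [← crossRel_flip, crossRel_turn] at h3
  obtain ⟨n, c, d, g1, g2, g3⟩ := triangleRule hk u u v _ _ _ _ _ _ _ ⟨_, _, _, h1, h3, h2⟩
  have e : step σ A u a = step σ A u p := by
    have e' := congrArg (fun R => step σ R (!u) m) h1.region
    simpa using e'.symm
  rw [e] at h3
  obtain ⟨rfl, rfl⟩ := h3.unique g1
  exact ⟨n, _, g2, g3⟩

/-- Twists move through a crossing along the strand running from bottom left to top right. -/
lemma CrossRel.twist_left {k : CrossKind} {u v : Bool} {A : S} {p q r s : X × G}
    (h : CrossRel σ k u v A p q r s) (n : ℤ) :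
    CrossRel σ k u v A (kinkTwist σ A u n p) q r (kinkTwist σ (step σ A v r) u n s) := by
  -- It suffices to move one twist, realized by an actual kink of kind `.above`, for which the
  -- triangle move is allowed with every kind `k`. Negative twists follow because labels at the
  -- bottom determine those at the top.
  have one {p q r s : X × G} (h : CrossRel σ k u v A p q r s) :
      CrossRel σ k u v A (kinkTwist σ A u 1 p) q r (kinkTwist σ (step σ A v r) u 1 s) := by
    obtain ⟨m, h1, -⟩ := kink_right_existsUnique (σ := σ) .above u A p
    obtain ⟨r', s', h2⟩ := CrossRel.exists (σ := σ) k u v A (kinkTwist σ A u 1 p) q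
    obtain ⟨n, m', h3, h4⟩ := h1.kink_pass (by cases k <;> simp [Triangle]) h2
    obtain ⟨rfl, rfl⟩ := h.unique h3
    obtain ⟨m'', h5, h6⟩ := kink_right_existsUnique (σ := σ) .above u (step σ A v r) s
    obtain ⟨-, rfl⟩ := h6 _ _ h4
    exact h2
  induction n generalizing p q r s with
  | zero => simpa using h
  | succ n ih =>
    have := one (ih h)
    rwa [← kinkTwist_add, ← kinkTwist_add, add_comm] at this
  | pred n ih =>
    obtain ⟨r', s', h2⟩ := CrossRel.exists (σ := σ) k u v A (kinkTwist σ A u (-1) p) q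
    have h3 := one h2
    rw [kinkTwist_cancel_neg] at h3
    obtain ⟨rfl, rfl⟩ := h.unique h3
    have h4 := ih h2
    rw [← kinkTwist_add, ← sub_eq_add_neg] at h4
    convert h4 using 1
    rw [← kinkTwist_add, sub_add_cancel]

/-- Twists move through a crossing along the strand running from bottom right to top left. -/
lemma CrossRel.twist_right {k : CrossKind} {u v : Bool} {A : S} {p q r s : X × G}
    (h : CrossRel σ k u v A p q r s) (n : ℤ) :
    CrossRel σ k u v A p (kinkTwist σ (step σ A u p) v n q) (kinkTwist σ A v n r) s :=
  crossRel_flip.1 ((crossRel_flip.2 h).twist_left n)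

end Finite

end Kink

/-! ## Paths of labeled levels -/

/-- An elementary piece without the component numbers. -/
inductive FlatPiece
  | cup (u : Bool)
  | cap (u : Bool)
  | cross (k : CrossKind) (u v : Bool)

/-- The directions of the strands at the bottom. -/
def FlatPiece.bot : FlatPiece → List Bool
  | cup _ => []
  | cap u => [u, !u]
  | cross _ u v => [u, v]

/-- The directions of the strands at the top. -/
def FlatPiece.top : FlatPiece → List Bool
  | cup u => [u, !u]
  | cap _ => []
  | cross _ u v => [v, u]

/-- The letters of the words that labels are propagated through: slices, and levels with strands of
given directions on which `f i` positive kinks are put on strand number `i`. -/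
inductive Op
  | slice (l : List Bool) (p : FlatPiece) (r : List Bool)
  | twist (t : List Bool) (f : ℕ → ℤ)

/-- A slice between further vertical strands. -/
def Op.widen (l r : List Bool) : Op → Op
  | slice l' p r' => slice (l ++ l') p (r' ++ r)
  | twist t f => twist (l ++ t ++ r) fun i =>
      if l.length ≤ i ∧ i < l.length + t.length then f (i - l.length) else 0

/-- Directions, colors and beads of the strands on a level. -/
abbrev State (X : Type*) (G : Type*) := List (Bool × X × G)

section Paths

variable {X : Type uX} {S : Type uS} {b : VirtualBirack X} (σ : Shadow b S)

section Single

variable {G : Type uG}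

/-- The label of the region on the far right of a level, given the one on the far left. -/
def walk (A : S) (a : State X G) : S := a.foldl (fun A e => step σ A e.1 e.2) A

@[simp] lemma walk_nil (A : S) : walk σ A ([] : State X G) = A := rfl

@[simp] lemma walk_cons (A : S) (e : Bool × X × G) (a : State X G) :
    walk σ A (e :: a) = walk σ (step σ A e.1 e.2) a := rfl

@[simp] lemma walk_append (A : S) (a a' : State X G) :
    walk σ A (a ++ a') = walk σ (walk σ A a) a' := List.foldl_append

variable [AddCommGroup G] [Module (Alg b σ) G]

/-- The labels below and above a piece with region `A` on its left. -/
def PieceRel (A : S) : FlatPiece → State X G → State X G → Prop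
  | .cup u, M, M' => M = [] ∧ ∃ l, M' = [(u, l), (!u, l)]
  | .cap u, M, M' => (∃ l, M = [(u, l), (!u, l)]) ∧ M' = []
  | .cross k u v, M, M' => ∃ p q r s, M = [(u, p), (v, q)] ∧ M' = [(v, r), (u, s)] ∧
      CrossRel σ k u v A p q r s

variable {σ}

lemma PieceRel.bot_eq {A : S} {p : FlatPiece} {M M' : State X G} (h : PieceRel σ A p M M') :
    M.map Prod.fst = p.bot := by
  cases p with
  | cup u => obtain ⟨rfl, l, rfl⟩ := h; rfl
  | cap u => obtain ⟨⟨l, rfl⟩, rfl⟩ := h; rfl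
  | cross k u v => obtain ⟨p, q, r, s, rfl, rfl, h⟩ := h; rfl

lemma PieceRel.top_eq {A : S} {p : FlatPiece} {M M' : State X G} (h : PieceRel σ A p M M') :
    M'.map Prod.fst = p.top := by
  cases p with
  | cup u => obtain ⟨rfl, l, rfl⟩ := h; rfl
  | cap u => obtain ⟨⟨l, rfl⟩, rfl⟩ := h; rfl
  | cross k u v => obtain ⟨p, q, r, s, rfl, rfl, h⟩ := h; rfl

lemma PieceRel.walk_eq {A : S} {p : FlatPiece} {M M' : State X G} (h : PieceRel σ A p M M') :
    walk σ A M = walk σ A M' := by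
  cases p with
  | cup u => obtain ⟨rfl, l, rfl⟩ := h; simp
  | cap u => obtain ⟨⟨l, rfl⟩, rfl⟩ := h; simp
  | cross k u v => obtain ⟨p, q, r, s, rfl, rfl, h⟩ := h; exact h.region

variable (σ) [Finite X]

/-- Put `f i` positive kinks on strand number `i`. -/
def twistState (A : S) : (ℕ → ℤ) → State X G → State X G
  | _, [] => []
  | f, e :: a => (e.1, kinkTwist σ A e.1 (f 0) e.2) ::
      twistState (step σ A e.1 e.2) (fun i => f (i + 1)) a

@[simp] lemma twistState_nil (A : S) (f : ℕ → ℤ) : twistState σ A f ([] : State X G) = [] := rfl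

@[simp] lemma twistState_cons (A : S) (f : ℕ → ℤ) (e : Bool × X × G) (a : State X G) :
    twistState σ A f (e :: a) = (e.1, kinkTwist σ A e.1 (f 0) e.2) ::
      twistState σ (step σ A e.1 e.2) (fun i => f (i + 1)) a := rfl

@[simp] lemma map_fst_twistState (A : S) (f : ℕ → ℤ) (a : State X G) :
    (twistState σ A f a).map Prod.fst = a.map Prod.fst := by
  induction a generalizing A f with
  | nil => rfl
  | cons e a ih => simp [ih]

@[simp] lemma walk_twistState (A : S) (f : ℕ → ℤ) (a : State X G) :
    walk σ A (twistState σ A f a) = walk σ A a := by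
  induction a generalizing A f with
  | nil => rfl
  | cons e a ih => simp [ih]

lemma twistState_append (A : S) (f : ℕ → ℤ) (a a' : State X G) :
    twistState σ A f (a ++ a') =
      twistState σ A f a ++ twistState σ (walk σ A a) (fun i => f (i + a.length)) a' := by
  induction a generalizing A f with
  | nil => rfl
  | cons e a ih => simp [ih, add_assoc]

lemma twistState_add (A : S) (f g : ℕ → ℤ) (a : State X G) :
    twistState σ A (f + g) a = twistState σ A f (twistState σ A g a) := by
  induction a generalizing A f g with
  | nil => rfl
  | cons e a ih =>
    simp only [twistState_cons, Pi.add_apply, kinkTwist_add, step_kinkTwist, ← ih]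
    rfl

lemma twistState_congr (A : S) {f g : ℕ → ℤ} {a : State X G}
    (h : ∀ i < a.length, (f i : ZMod b.rank) = g i) : twistState σ A f a = twistState σ A g a := by
  induction a generalizing A f g with
  | nil => rfl
  | cons e a ih =>
    simp only [twistState_cons]
    rw [kinkTwist_congr σ A e.1 (h 0 (by simp)) e.2,
      ih (g := fun i => g (i + 1)) _ fun i hi => h (i + 1) (by simpa using hi)]

@[simp] lemma twistState_zero (A : S) (a : State X G) : twistState σ A 0 a = a := by
  induction a generalizing A with
  | nil => rfl
  | cons e a ih =>
    simp only [twistState_cons, Pi.zero_apply, kinkTwist_zero]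
    exact congrArg _ (ih _)

lemma twistState_of_zero (A : S) {f : ℕ → ℤ} {a : State X G} (h : ∀ i < a.length, f i = 0) :
    twistState σ A f a = a := by
  rw [twistState_congr σ A (g := 0) fun i hi => by simp [h i hi], twistState_zero]

@[simp] lemma twistState_neg (A : S) (f : ℕ → ℤ) (a : State X G) :
    twistState σ A (-f) (twistState σ A f a) = a := by
  rw [← twistState_add, neg_add_cancel, twistState_zero]

lemma twistState_injective (A : S) (f : ℕ → ℤ) :
    Function.Injective (twistState σ A f : State X G → State X G) :=
  Function.LeftInverse.injective (twistState_neg σ A f)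

/-- The labels below and above a letter, with region `A` on the far left. -/
def Op.Rel (A : S) : Op → State X G → State X G → Prop
  | .slice l p r, a, a' => ∃ L M M' R, a = L ++ M ++ R ∧ a' = L ++ M' ++ R ∧
      L.map Prod.fst = l ∧ R.map Prod.fst = r ∧ PieceRel σ (walk σ A L) p M M'
  | .twist t f, a, a' => a.map Prod.fst = t ∧ a' = twistState σ A f a

/-- The ways to label the levels of a word between a bottom level `a` and a top level `a'`. -/
def Path (A : S) : List Op → State X G → State X G → Type (max uX uG)
  | [], a, a' => ULift.{max uX uG} (PLift (a = a'))
  | o :: w, a, a' => (m : State X G) × PLift (o.Rel σ A a m) × Path A w m a'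

/-- Some labeling of the levels of a word extends the labels of its bottom and top. -/
def Sat (A : S) : List Op → State X G → State X G → Prop
  | [], a, a' => a = a'
  | o :: w, a, a' => ∃ m, o.Rel σ A a m ∧ Sat A w m a'

lemma nonempty_path_iff {A : S} {w : List Op} {a a' : State X G} :
    Nonempty (Path σ A w a a') ↔ Sat σ A w a a' := by
  induction w generalizing a with
  | nil => exact ⟨fun ⟨⟨⟨h⟩⟩⟩ => h, fun h => ⟨⟨⟨h⟩⟩⟩⟩
  | cons o w ih =>
    exact ⟨fun ⟨⟨m, ⟨h⟩, p⟩⟩ => ⟨m, h, ih.1 ⟨p⟩⟩, fun ⟨m, h, p⟩ => ⟨⟨m, ⟨h⟩, (ih.2 p).some⟩⟩⟩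

/-- The paths through a concatenation. -/
def pathAppend (A : S) : (w w' : List Op) → (a a' : State X G) →
    Path σ A (w ++ w') a a' ≃ (m : State X G) × Path σ A w a m × Path σ A w' m a'
  | [], w', a, a' =>
    { toFun := fun p => ⟨a, ⟨⟨rfl⟩⟩, p⟩
      invFun := fun ⟨_, ⟨⟨h⟩⟩, p⟩ => h ▸ p
      left_inv := fun _ => rfl
      right_inv := by rintro ⟨m, ⟨⟨rfl⟩⟩, p⟩; rfl }
  | o :: w, w', a, a' =>
    { toFun := fun ⟨m, h, p⟩ =>
        let q := pathAppend A w w' m a' p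
        ⟨q.1, ⟨m, h, q.2.1⟩, q.2.2⟩
      invFun := fun ⟨n, ⟨m, h, p⟩, p'⟩ => ⟨m, h, (pathAppend A w w' m a').symm ⟨n, p, p'⟩⟩
      left_inv := by
        rintro ⟨m, h, p⟩
        exact congrArg (fun p => (⟨m, h, p⟩ : Path σ A (o :: (w ++ w')) a a'))
          ((pathAppend A w w' m a').symm_apply_apply p)
      right_inv := by
        rintro ⟨n, ⟨m, h, p⟩, p'⟩
        exact congrArg (fun q : (m : State X G) × Path σ A w _ m × Path σ A w' m a' =>
            (⟨q.1, ⟨m, h, q.2.1⟩, q.2.2⟩ :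
              (m : State X G) × Path σ A (o :: w) a m × Path σ A w' m a'))
          ((pathAppend A w w' m a').apply_symm_apply ⟨n, p, p'⟩) }

end Single

/-! ### Functoriality in the module -/

section Map

variable {G G' : Type uG} [AddCommGroup G] [Module (Alg b σ) G] [AddCommGroup G']
  [Module (Alg b σ) G'] (φ : G →ₗ[Alg b σ] G')

/-- Apply a linear map to the bead of a label. -/
def mapLabel (l : X × G) : X × G' := (l.1, φ l.2)

/-- Apply a linear map to all beads of a level. -/
def mapState (a : State X G) : State X G' := a.map fun e => (e.1, mapLabel σ φ e.2)

@[simp] lemma step_mapLabel (A : S) (u : Bool) (l : X × G) :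
    step σ A u (mapLabel σ φ l) = step σ A u l := by cases u <;> rfl

@[simp] lemma walk_mapState (A : S) (a : State X G) :
    walk σ A (mapState σ φ a) = walk σ A a := by
  induction a generalizing A with
  | nil => rfl
  | cons e a ih =>
    simp only [mapState, List.map_cons, walk_cons, step_mapLabel] at ih ⊢
    exact ih _

@[simp] lemma map_fst_mapState (a : State X G) :
    (mapState σ φ a).map Prod.fst = a.map Prod.fst := by
  simp [mapState]

variable {σ}

/-- Beads enter the rule linearly, with coefficients depending only on colors and regions, which a
linear map leaves alone. -/
lemma PosRel.map {A : S} {p q r s : X × G} (h : PosRel σ A p q r s) :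
    PosRel σ A (mapLabel σ φ p) (mapLabel σ φ q) (mapLabel σ φ r) (mapLabel σ φ s) := by
  obtain ⟨h1, h2, h3⟩ := h
  exact ⟨h1, by simp [mapLabel, h2], by simp [mapLabel, h3]⟩

lemma VirtRel.map {A : S} {p q r s : X × G} (h : VirtRel σ A p q r s) :
    VirtRel σ A (mapLabel σ φ p) (mapLabel σ φ q) (mapLabel σ φ r) (mapLabel σ φ s) := by
  obtain ⟨h1, h2, h3⟩ := h
  exact ⟨h1, by simp [mapLabel, h2], by simp [mapLabel, h3]⟩

lemma SignRel.map {g : CrossSign} {A : S} {p q r s : X × G} (h : SignRel σ g A p q r s) :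
    SignRel σ g A (mapLabel σ φ p) (mapLabel σ φ q) (mapLabel σ φ r) (mapLabel σ φ s) := by
  cases g
  · exact PosRel.map φ h
  · exact PosRel.map φ h
  · exact VirtRel.map φ h

lemma CrossRel.map {k : CrossKind} {u v : Bool} {A : S} {p q r s : X × G}
    (h : CrossRel σ k u v A p q r s) :
    CrossRel σ k u v A (mapLabel σ φ p) (mapLabel σ φ q) (mapLabel σ φ r) (mapLabel σ φ s) := by
  cases u <;> cases v <;> simp only [CrossRel, step_mapLabel] <;> exact SignRel.map φ h

lemma PieceRel.map {A : S} {p : FlatPiece} {M M' : State X G} (h : PieceRel σ A p M M') :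
    PieceRel σ A p (mapState σ φ M) (mapState σ φ M') := by
  cases p with
  | cup u => obtain ⟨rfl, l, rfl⟩ := h; exact ⟨rfl, _, rfl⟩
  | cap u => obtain ⟨⟨l, rfl⟩, rfl⟩ := h; exact ⟨⟨_, rfl⟩, rfl⟩
  | cross k u v =>
    obtain ⟨p, q, r, s, rfl, rfl, h⟩ := h
    exact ⟨_, _, _, _, rfl, rfl, h.map φ⟩

variable [Finite X]

lemma kinkPerm_map (R : S) (l : X × G) :
    kinkPerm σ R (mapLabel σ φ l) = mapLabel σ φ (kinkPerm σ R l) := by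
  simp [kinkPerm_apply, mapLabel]

lemma kinkPerm_zpow_map (R : S) (n : ℤ) (l : X × G) :
    (kinkPerm σ R ^ n) (mapLabel σ φ l) = mapLabel σ φ ((kinkPerm σ R ^ n) l) := by
  induction n generalizing l with
  | zero => rfl
  | succ n ih => rw [zpow_add_one, zpow_add_one, Equiv.Perm.mul_apply, kinkPerm_map, ih]; rfl
  | pred n ih =>
    rw [zpow_sub_one, zpow_sub_one, Equiv.Perm.mul_apply, Equiv.Perm.mul_apply, ← ih]
    congr 1
    rw [Equiv.Perm.inv_eq_iff_eq, kinkPerm_map]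
    exact congrArg _ ((kinkPerm σ R).apply_symm_apply l).symm

lemma kinkTwist_map (A : S) (u : Bool) (n : ℤ) (l : X × G) :
    kinkTwist σ A u n (mapLabel σ φ l) = mapLabel σ φ (kinkTwist σ A u n l) := by
  cases u <;> exact kinkPerm_zpow_map φ _ _ _

lemma twistState_map (A : S) (f : ℕ → ℤ) (a : State X G) :
    twistState σ A f (mapState σ φ a) = mapState σ φ (twistState σ A f a) := by
  induction a generalizing A f with
  | nil => rfl
  | cons e a ih =>
    simp only [mapState, List.map_cons, twistState_cons, step_mapLabel, kinkTwist_map] at ih ⊢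
    rw [ih]

lemma Op.Rel.map {A : S} {o : Op} {a a' : State X G} (h : o.Rel σ A a a') :
    o.Rel σ A (mapState σ φ a) (mapState σ φ a') := by
  cases o with
  | slice l p r =>
    obtain ⟨L, M, M', R, rfl, rfl, h1, h2, h3⟩ := h
    refine ⟨mapState σ φ L, mapState σ φ M, mapState σ φ M', mapState σ φ R, by simp [mapState],
      by simp [mapState], by simpa using h1, by simpa using h2, ?_⟩
    rw [walk_mapState]
    exact h3.map φ
  | twist t f =>
    obtain ⟨h, rfl⟩ := h
    exact ⟨by simpa using h, (twistState_map φ A f a).symm⟩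

/-- Apply a linear map to all beads of a path. -/
def Path.map {A : S} : {w : List Op} → {a a' : State X G} → Path σ A w a a' →
    Path σ A w (mapState σ φ a) (mapState σ φ a')
  | [], _, _, ⟨⟨h⟩⟩ => ⟨⟨congrArg _ h⟩⟩
  | _ :: _, _, _, ⟨m, ⟨h⟩, p⟩ => ⟨mapState σ φ m, ⟨h.map φ⟩, Path.map p⟩

lemma pathAppend_map (A : S) (w w' : List Op) (a a' : State X G) (p : Path σ A (w ++ w') a a') :
    pathAppend σ A w w' _ _ (p.map φ) =
      ⟨mapState σ φ (pathAppend σ A w w' a a' p).1, (pathAppend σ A w w' a a' p).2.1.map φ,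
        (pathAppend σ A w w' a a' p).2.2.map φ⟩ := by
  induction w generalizing a with
  | nil => rfl
  | cons o w ih =>
    obtain ⟨m, ⟨h⟩, p⟩ := p
    have := ih m p
    simp only [pathAppend, Path.map, Equiv.coe_fn_mk] at this ⊢
    rw [this]

end Map

/-! ### Natural bijections between sets of paths -/

variable [Finite X]

/-- Bijections between the paths of two words, for all modules and all labels at the bottom and the
top, natural with respect to linear maps. -/
structure PathEquiv (w w' : List Op) where
  equiv : ∀ (G : Type uG) [AddCommGroup G] [Module (Alg b σ) G] (A : S) (a a' : State X G),
    Path σ A w a a' ≃ Path σ A w' a a'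
  natural : ∀ {G G' : Type uG} [AddCommGroup G] [Module (Alg b σ) G] [AddCommGroup G']
    [Module (Alg b σ) G'] (φ : G →ₗ[Alg b σ] G') (A : S) (a a' : State X G)
    (p : Path σ A w a a'), equiv G' A _ _ (p.map φ) = (equiv G A a a' p).map φ

/-- Two words have naturally isomorphic sets of paths. -/
def PathIso (w w' : List Op) : Prop := Nonempty (PathEquiv.{uX, uS, uG} σ w w')

variable {σ}

namespace PathIso

lemma refl (w : List Op) : PathIso.{uX, uS, uG} σ w w :=
  ⟨⟨fun _ _ _ _ _ _ => Equiv.refl _, fun _ _ _ _ _ => rfl⟩⟩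

lemma symm {w w' : List Op} : PathIso.{uX, uS, uG} σ w w' → PathIso.{uX, uS, uG} σ w' w := by
  rintro ⟨e, he⟩
  refine ⟨⟨fun G _ _ A a a' => (e G A a a').symm, fun φ A a a' p => ?_⟩⟩
  rw [Equiv.symm_apply_eq, he, Equiv.apply_symm_apply]

lemma trans {w₁ w₂ w₃ : List Op} : PathIso.{uX, uS, uG} σ w₁ w₂ → PathIso.{uX, uS, uG} σ w₂ w₃ →
    PathIso.{uX, uS, uG} σ w₁ w₃ := by
  rintro ⟨e, he⟩ ⟨f, hf⟩
  refine ⟨⟨fun G _ _ A a a' => (e G A a a').trans (f G A a a'), fun φ A a a' p => ?_⟩⟩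
  simp only [Equiv.trans_apply, he, hf]

lemma append {w₁ w₁' w₂ w₂' : List Op} : PathIso.{uX, uS, uG} σ w₁ w₁' →
    PathIso.{uX, uS, uG} σ w₂ w₂' → PathIso.{uX, uS, uG} σ (w₁ ++ w₂) (w₁' ++ w₂') := by
  rintro ⟨e, he⟩ ⟨f, hf⟩
  refine ⟨⟨fun G _ _ A a a' => (pathAppend σ A w₁ w₂ a a').trans
    ((Equiv.sigmaCongrRight fun m => Equiv.prodCongr (e G A a m) (f G A m a')).trans
      (pathAppend σ A w₁' w₂' a a').symm), ?_⟩⟩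
  intro G G' _ _ _ _ φ A a a' p
  obtain ⟨⟨m, p, p'⟩, rfl⟩ := (pathAppend σ A w₁ w₂ a a').symm.surjective p
  have h1 := pathAppend_map φ A w₁ w₂ a a' ((pathAppend σ A w₁ w₂ a a').symm ⟨m, p, p'⟩)
  have h2 := pathAppend_map φ A w₁' w₂' a a'
    ((pathAppend σ A w₁' w₂' a a').symm ⟨m, e G A a m p, f G A m a' p'⟩)
  rw [Equiv.apply_symm_apply] at h1 h2
  simp only [Equiv.trans_apply, Equiv.apply_symm_apply, Equiv.symm_apply_eq]
  rw [h1]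
  refine Eq.trans ?_ h2.symm
  simp only [Equiv.sigmaCongrRight_apply, Equiv.prodCongr_apply, Prod.map, he, hf]

lemma append_left (w : List Op) {w₁ w₂ : List Op} (h : PathIso.{uX, uS, uG} σ w₁ w₂) :
    PathIso.{uX, uS, uG} σ (w ++ w₁) (w ++ w₂) := (refl w).append h

lemma append_right (w : List Op) {w₁ w₂ : List Op} (h : PathIso.{uX, uS, uG} σ w₁ w₂) :
    PathIso.{uX, uS, uG} σ (w₁ ++ w) (w₂ ++ w) := h.append (refl w)

lemma cons (o : Op) {w₁ w₂ : List Op} (h : PathIso.{uX, uS, uG} σ w₁ w₂) :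
    PathIso.{uX, uS, uG} σ (o :: w₁) (o :: w₂) := h.append_left [o]

end PathIso

variable (σ) in
/-- The labels between the bottom and the top of the word are determined by those at the bottom and
at the top. -/
def Rigid : List Op → Prop
  | [] => True
  | o :: w => Rigid w ∧ ∀ (G : Type uG) [AddCommGroup G] [Module (Alg b σ) G] (A : S)
      (a m m' a' : State X G), o.Rel σ A a m → Sat σ A w m a' → o.Rel σ A a m' → Sat σ A w m' a' →
        m = m'

lemma Rigid.subsingleton {w : List Op} (h : Rigid.{uX, uS, uG} σ w) (G : Type uG) [AddCommGroup G]
    [Module (Alg b σ) G] (A : S) (a a' : State X G) : Subsingleton (Path σ A w a a') := by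
  induction w generalizing a with
  | nil => exact ⟨fun ⟨⟨_⟩⟩ ⟨⟨_⟩⟩ => rfl⟩
  | cons o w ih =>
    refine ⟨?_⟩
    rintro ⟨m, ⟨h1⟩, p⟩ ⟨m', ⟨h1'⟩, p'⟩
    obtain rfl := h.2 G A a m m' a' h1 ((nonempty_path_iff σ).1 ⟨p⟩) h1'
      ((nonempty_path_iff σ).1 ⟨p'⟩)
    have := ih h.1 m
    obtain rfl := Subsingleton.elim p p'
    rfl

lemma Rigid.single (o : Op) : Rigid.{uX, uS, uG} σ [o] :=
  ⟨trivial, fun _ _ _ _ _ _ _ _ _ h _ h' => h.trans h'.symm⟩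

/-- Rigid words with the same boundary labels. -/
lemma PathIso.of_sat {w w' : List Op} (h : Rigid.{uX, uS, uG} σ w) (h' : Rigid.{uX, uS, uG} σ w')
    (H : ∀ (G : Type uG) [AddCommGroup G] [Module (Alg b σ) G] (A : S) (a a' : State X G),
      Sat σ A w a a' ↔ Sat σ A w' a a') : PathIso.{uX, uS, uG} σ w w' := by
  refine ⟨⟨fun G _ _ A a a' => ?_, ?_⟩⟩
  · have := h.subsingleton G A a a'
    have := h'.subsingleton G A a a'
    have hn := (nonempty_path_iff σ).trans ((H G A a a').trans (nonempty_path_iff σ).symm)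
    exact ⟨fun p => (hn.1 ⟨p⟩).some, fun p => (hn.2 ⟨p⟩).some, fun _ => Subsingleton.elim _ _,
      fun _ => Subsingleton.elim _ _⟩
  -- Naturality is free: both sides lie in a type with at most one element.
  · intro G G' _ _ _ _ φ A a a' p
    have := h'.subsingleton G' A (mapState σ φ a) (mapState σ φ a')
    exact Subsingleton.elim _ _

end Paths

/-! ## Words between vertical strands -/

section Widen

variable {X : Type uX} {S : Type uS} {b : VirtualBirack X} {σ : Shadow b S}

lemma append_append_inj {α β : Type*} {g : α → β} {L M R L' M' R' : List α}
    (h : L ++ M ++ R = L' ++ M' ++ R') (hL : L.map g = L'.map g) (hR : R.map g = R'.map g) :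
    L = L' ∧ M = M' ∧ R = R' := by
  have h1 : L.length = L'.length := by simpa using congrArg List.length hL
  have h2 : R.length = R'.length := by simpa using congrArg List.length hR
  obtain ⟨h3, h4⟩ := List.append_inj' h h2
  obtain ⟨h5, h6⟩ := List.append_inj h3 h1
  exact ⟨h5, h6, h4⟩

variable {G : Type uG} [AddCommGroup G] [Module (Alg b σ) G] [Finite X]

lemma Op.rel_widen {A : S} {l r : List Bool} {o : Op} {a a' : State X G} :
    (o.widen l r).Rel σ A a a' ↔ ∃ L M M' R, a = L ++ M ++ R ∧ a' = L ++ M' ++ R ∧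
      L.map Prod.fst = l ∧ R.map Prod.fst = r ∧ o.Rel σ (walk σ A L) M M' := by
  cases o with
  | slice l' p r' =>
    constructor
    · rintro ⟨L, M, M', R, rfl, rfl, h1, h2, h3⟩
      obtain ⟨L, L', rfl, rfl, rfl⟩ := List.map_eq_append_iff.1 h1
      obtain ⟨R', R, rfl, rfl, rfl⟩ := List.map_eq_append_iff.1 h2
      refine ⟨L, L' ++ M ++ R', L' ++ M' ++ R', R, by simp, by simp, rfl, rfl,
        L', M, M', R', rfl, rfl, rfl, rfl, ?_⟩
      rwa [← walk_append]
    · rintro ⟨L, _, _, R, rfl, rfl, rfl, rfl, L', M, M', R', rfl, rfl, rfl, rfl, h⟩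
      exact ⟨L ++ L', M, M', R' ++ R, by simp, by simp, by simp, by simp, by rwa [walk_append]⟩
  | twist t f =>
    have key (L M R : State X G) (hM : M.length = t.length) : twistState σ A
        (fun i => if L.length ≤ i ∧ i < L.length + t.length then f (i - L.length) else 0)
        (L ++ M ++ R) = L ++ twistState σ (walk σ A L) f M ++ R := by
      rw [twistState_append, twistState_append]
      congr 1
      · congr 1
        · exact twistState_of_zero σ A fun i hi => if_neg (by omega)
        · refine twistState_congr σ _ fun i hi => ?_
          rw [if_pos (by omega), Nat.add_sub_cancel]
      · refine twistState_of_zero σ _ fun i hi => if_neg ?_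
        rw [List.length_append]; omega
    constructor
    · rintro ⟨h, rfl⟩
      obtain ⟨_, R, rfl, h2, rfl⟩ := List.map_eq_append_iff.1 h
      obtain ⟨L, M, rfl, rfl, rfl⟩ := List.map_eq_append_iff.1 h2
      refine ⟨L, M, _, R, rfl, ?_, rfl, rfl, rfl, rfl⟩
      simpa using key L M R (by simp)
    · rintro ⟨L, M, _, R, rfl, rfl, rfl, rfl, rfl, rfl⟩
      refine ⟨by simp, ?_⟩
      simpa using (key L M R (by simp)).symm

/-- The word must be nonempty: an empty word stays empty when widened and no longer prescribes
directions for the strands at its sides. -/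
lemma sat_widen {A : S} {l r : List Bool} {w : List Op} (hw : w ≠ []) {a a' : State X G} :
    Sat σ A (w.map (Op.widen l r)) a a' ↔ ∃ L M M' R, a = L ++ M ++ R ∧ a' = L ++ M' ++ R ∧
      L.map Prod.fst = l ∧ R.map Prod.fst = r ∧ Sat σ (walk σ A L) w M M' := by
  induction w generalizing a with
  | nil => exact absurd rfl hw
  | cons o w ih =>
    constructor
    · rintro ⟨m, h, h'⟩
      obtain ⟨L, M, M', R, rfl, rfl, h1, h2, h3⟩ := Op.rel_widen.1 h
      rcases eq_or_ne w [] with rfl | hw'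
      · obtain rfl := h'
        exact ⟨L, M, M', R, rfl, rfl, h1, h2, M', h3, rfl⟩
      · obtain ⟨L₁, M₁, M₁', R₁, e, rfl, e1, e2, e3⟩ := (ih hw').1 h'
        obtain ⟨rfl, rfl, rfl⟩ := append_append_inj e (h1.trans e1.symm) (h2.trans e2.symm)
        exact ⟨L, M, M₁', R, rfl, rfl, h1, h2, M', h3, e3⟩
    · rintro ⟨L, M, M', R, rfl, rfl, h1, h2, N, h3, h4⟩
      refine ⟨L ++ N ++ R, Op.rel_widen.2 ⟨L, M, N, R, rfl, rfl, h1, h2, h3⟩, ?_⟩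
      rcases eq_or_ne w [] with rfl | hw'
      · obtain rfl := h4
        rfl
      · exact (ih hw').2 ⟨L, N, M', R, rfl, rfl, h1, h2, h4⟩

lemma Rigid.widen {w : List Op} (h : Rigid.{uX, uS, uG} σ w) (l r : List Bool) :
    Rigid.{uX, uS, uG} σ (w.map (Op.widen l r)) := by
  induction w with
  | nil => trivial
  | cons o w ih =>
    refine ⟨ih h.1, fun G _ _ A a m m' a' h1 h2 h3 h4 => ?_⟩
    rcases eq_or_ne w [] with rfl | hw
    · exact h2.trans h4.symm
    · obtain ⟨L, M, M', R, rfl, rfl, e1, e2, e3⟩ := Op.rel_widen.1 h1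
      obtain ⟨L₁, M₁, M₁', R₁, e, rfl, e1', e2', e3'⟩ := Op.rel_widen.1 h3
      obtain ⟨rfl, rfl, rfl⟩ := append_append_inj e (e1.trans e1'.symm) (e2.trans e2'.symm)
      obtain ⟨L₂, M₂, M₂', R₂, e, rfl, f1, f2, f3⟩ := (sat_widen hw).1 h2
      obtain ⟨rfl, rfl, rfl⟩ := append_append_inj e (e1.trans f1.symm) (e2.trans f2.symm)
      obtain ⟨L₃, M₃, M₃', R₃, e, e', f1', f2', f3'⟩ := (sat_widen hw).1 h4
      obtain ⟨rfl, rfl, rfl⟩ := append_append_inj e (e1.trans f1'.symm) (e2.trans f2'.symm)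
      obtain ⟨-, rfl, -⟩ := append_append_inj (g := Prod.fst) e' rfl rfl
      rw [h.2 G _ _ _ _ _ e3 f3 e3' f3']

lemma PathIso.widen_of_sat {w w' : List Op} (h : Rigid.{uX, uS, uG} σ w)
    (h' : Rigid.{uX, uS, uG} σ w') (hw : w ≠ []) (hw' : w' ≠ [])
    (H : ∀ (G : Type uG) [AddCommGroup G] [Module (Alg b σ) G] (A : S) (a a' : State X G),
      Sat σ A w a a' ↔ Sat σ A w' a a') (l r : List Bool) :
    PathIso.{uX, uS, uG} σ (w.map (Op.widen l r)) (w'.map (Op.widen l r)) := by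
  refine .of_sat (h.widen l r) (h'.widen l r) fun G _ _ A a a' => ?_
  simp only [sat_widen hw, sat_widen hw', H]

/-! ### Rigidity -/

/-- The label above the letter is determined by the label below. -/
def Op.Forward : Op → Prop
  | slice _ (.cup _) _ => False
  | _ => True

/-- The label below the letter is determined by the label above. -/
def Op.Backward : Op → Prop
  | slice _ (.cap _) _ => False
  | _ => True

lemma Op.Forward.unique {o : Op} (ho : o.Forward) {A : S} {a m m' : State X G}
    (h : o.Rel σ A a m) (h' : o.Rel σ A a m') : m = m' := by
  cases o with
  | twist t f => exact h.2.trans h'.2.symm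
  | slice l p r =>
    obtain ⟨L, M, M', R, rfl, rfl, e1, e2, e3⟩ := h
    obtain ⟨L₁, M₁, M₁', R₁, e, rfl, e1', e2', e3'⟩ := h'
    obtain ⟨rfl, rfl, rfl⟩ := append_append_inj e (e1.trans e1'.symm) (e2.trans e2'.symm)
    congr 2
    cases p with
    | cup u => exact ho.elim
    | cap u => exact e3.2.trans e3'.2.symm
    | cross k u v =>
      obtain ⟨p, q, r, s, rfl, rfl, h⟩ := e3
      obtain ⟨p, q, r, s, e, rfl, h'⟩ := e3'
      simp only [List.cons.injEq, Prod.mk.injEq, true_and, and_true] at e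
      obtain ⟨rfl, rfl⟩ := e
      obtain ⟨rfl, rfl⟩ := h.unique h'
      rfl

lemma Op.Backward.unique {o : Op} (ho : o.Backward) {A : S} {a a' m : State X G}
    (h : o.Rel σ A a m) (h' : o.Rel σ A a' m) : a = a' := by
  cases o with
  | twist t f =>
    obtain ⟨-, rfl⟩ := h
    exact twistState_injective σ A f h'.2
  | slice l p r =>
    obtain ⟨L, M, M', R, rfl, rfl, e1, e2, e3⟩ := h
    obtain ⟨L₁, M₁, M₁', R₁, rfl, e, e1', e2', e3'⟩ := h'
    obtain ⟨rfl, rfl, rfl⟩ := append_append_inj e (e1.trans e1'.symm) (e2.trans e2'.symm)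
    congr 2
    cases p with
    | cap u => exact ho.elim
    | cup u => exact e3.1.trans e3'.1.symm
    | cross k u v =>
      obtain ⟨p, q, r, s, rfl, rfl, h⟩ := e3
      obtain ⟨p, q, r, s, rfl, e, h'⟩ := e3'
      simp only [List.cons.injEq, Prod.mk.injEq, true_and, and_true] at e
      obtain ⟨rfl, rfl⟩ := e
      obtain ⟨rfl, rfl⟩ := h.unique_bot h'
      rfl

lemma Rigid.cons_forward {o : Op} {w : List Op} (ho : o.Forward) (hw : Rigid.{uX, uS, uG} σ w) :
    Rigid.{uX, uS, uG} σ (o :: w) :=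
  ⟨hw, fun _ _ _ _ _ _ _ _ h _ h' _ => ho.unique h h'⟩

/-- The middle level is recovered from the top, so the first letter may be a minimum. -/
lemma Rigid.pair_backward (o : Op) {o' : Op} (ho : o'.Backward) :
    Rigid.{uX, uS, uG} σ [o, o'] := by
  refine ⟨Rigid.single o', ?_⟩
  rintro G _ _ A a m m' a' - ⟨n, h1, rfl⟩ - ⟨n, h2, rfl⟩
  exact ho.unique h1 h2

/-! ### Twists -/

lemma sat_twist_cons {A : S} {t : List Bool} {f : ℕ → ℤ} {w : List Op} {a a' : State X G} :
    Sat σ A (.twist t f :: w) a a' ↔ a.map Prod.fst = t ∧ Sat σ A w (twistState σ A f a) a' :=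
  ⟨fun ⟨_, ⟨h, e⟩, h'⟩ => ⟨h, e ▸ h'⟩, fun ⟨h, h'⟩ => ⟨_, ⟨h, rfl⟩, h'⟩⟩

lemma PathIso.twist_congr (t : List Bool) {f g : ℕ → ℤ}
    (h : ∀ i < t.length, (f i : ZMod b.rank) = g i) :
    PathIso.{uX, uS, uG} σ [.twist t f] [.twist t g] := by
  refine .of_sat (.single _) (.single _) fun G _ _ A a a' => ?_
  rw [sat_twist_cons, sat_twist_cons]
  refine and_congr_right fun e => ?_
  rw [twistState_congr σ A (by rwa [← e, List.length_map] at h)]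

lemma PathIso.twist_add (t : List Bool) (f g : ℕ → ℤ) :
    PathIso.{uX, uS, uG} σ [.twist t f, .twist t g] [.twist t (f + g)] := by
  refine .of_sat (.cons_forward trivial (.single _)) (.single _) fun G _ _ A a a' => ?_
  simp only [sat_twist_cons, map_fst_twistState, add_comm f g, twistState_add]
  tauto

/-- A zero twist still prescribes the directions of its level; after a slice with matching top this
adds nothing. -/
lemma PathIso.slice_twist_zero (l r : List Bool) (p : FlatPiece) :
    PathIso.{uX, uS, uG} σ [.slice l p r, .twist (l ++ p.top ++ r) 0] [.slice l p r] := by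
  refine .of_sat (.pair_backward _ trivial) (.single _) fun G _ _ A a a' => ?_
  constructor
  · rintro ⟨m, h, _, ⟨h1, rfl⟩, rfl⟩
    exact ⟨m, h, (twistState_zero σ A m).symm⟩
  · rintro ⟨m, h, rfl⟩
    refine ⟨m, h, m, ⟨?_, (twistState_zero σ A m).symm⟩, rfl⟩
    obtain ⟨L, M, M', R, rfl, rfl, rfl, rfl, h3⟩ := h
    simp [h3.top_eq]

/-! ### Twists pass through slices -/

/-- The kinks `f` at the bottom of a slice amount to the kinks `f'` at its top. -/
def Passes (n : ℕ) (p : FlatPiece) (n' : ℕ) (f f' : ℕ → ℤ) : Prop :=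
  (∀ i < n, f i = f' i) ∧ (∀ i < n', f (n + p.bot.length + i) = f' (n + p.top.length + i)) ∧
  match p with
  | .cup _ => f' n + f' (n + 1) = 0
  | .cap _ => f n + f (n + 1) = 0
  | .cross _ _ _ => f n = f' (n + 1) ∧ f (n + 1) = f' n

/-- The two ends of an extremum are read in opposite directions along the same arc, so opposite
twists on them have the same effect and the ends keep equal labels. -/
lemma turn_twist (A : S) (u : Bool) (m n : ℤ) (l : X × G) (h : m + n = 0) :
    kinkTwist σ (step σ A u l) (!u) n l = kinkTwist σ A u m l := by
  have h' := (kinkTwist_turn σ A u m l _).2 rfl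
  rw [show n = -m by linarith]
  exact (congrArg (kinkTwist σ (step σ A u l) (!u) (-m)) h').trans (kinkTwist_neg_cancel σ _ _ _ _)

lemma PieceRel.twist {A : S} {p : FlatPiece} {M M' : State X G} (h : PieceRel σ A p M M')
    {f f' : ℕ → ℤ} (hf : Passes 0 p 0 f f') :
    PieceRel σ A p (twistState σ A f M) (twistState σ A f' M') := by
  obtain ⟨-, -, hf⟩ := hf
  cases p with
  | cup u =>
    obtain ⟨rfl, l, rfl⟩ := h
    refine ⟨rfl, kinkTwist σ A u (f' 0) l, ?_⟩
    simp only [twistState_cons, twistState_nil]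
    rw [turn_twist A u _ _ l hf]
  | cap u =>
    obtain ⟨⟨l, rfl⟩, rfl⟩ := h
    refine ⟨⟨kinkTwist σ A u (f 0) l, ?_⟩, rfl⟩
    simp only [twistState_cons, twistState_nil]
    rw [turn_twist A u _ _ l hf]
  | cross k u v =>
    obtain ⟨p, q, r, s, rfl, rfl, h⟩ := h
    refine ⟨_, _, _, _, rfl, rfl, ?_⟩
    have h1 := (h.twist_right (f 1)).twist_left (f 0)
    have e1 : f' 1 = f 0 := hf.1.symm
    have e2 : f' 0 = f 1 := hf.2.symm
    simpa [e1, e2] using h1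

lemma Op.Rel.twist {A : S} {l r : List Bool} {p : FlatPiece} {a a' : State X G}
    (h : (Op.slice l p r).Rel σ A a a') {f f' : ℕ → ℤ} (hf : Passes l.length p r.length f f') :
    (Op.slice l p r).Rel σ A (twistState σ A f a) (twistState σ A f' a') := by
  obtain ⟨L, M, M', R, rfl, rfl, rfl, rfl, h3⟩ := h
  obtain ⟨f1, f2, f3⟩ := hf
  have hM : M.length = p.bot.length := by rw [← h3.bot_eq, List.length_map]
  have hM' : M'.length = p.top.length := by rw [← h3.top_eq, List.length_map]
  rw [List.length_map] at f1 f2 f3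
  rw [List.length_map] at f2
  refine ⟨twistState σ A f L, twistState σ (walk σ A L) (fun i => f (i + L.length)) M,
    twistState σ (walk σ A L) (fun i => f' (i + L.length)) M',
    twistState σ (walk σ A (L ++ M)) (fun i => f (i + (L ++ M).length)) R, ?_, ?_, by simp, by simp,
    ?_⟩
  · rw [twistState_append, twistState_append]
  · rw [twistState_append, twistState_append]
    congr 1
    · congr 1
      exact (twistState_congr σ A fun i hi => by rw [f1 i hi]).symm
    · rw [walk_append, walk_append, h3.walk_eq]
      refine twistState_congr σ _ fun i hi => ?_
      rw [List.length_append, List.length_append, hM, hM', add_comm i, add_comm i, f2 i hi]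
  · rw [walk_twistState]
    refine h3.twist ⟨by simp, by simp, ?_⟩
    cases p with
    | cup u => simpa [add_comm] using f3
    | cap u => simpa [add_comm] using f3
    | cross k u v => simpa [add_comm] using f3

lemma Passes.neg {n n' : ℕ} {p : FlatPiece} {f f' : ℕ → ℤ} (h : Passes n p n' f f') :
    Passes n p n' (-f) (-f') := by
  obtain ⟨h1, h2, h3⟩ := h
  refine ⟨fun i hi => by simp [h1 i hi], fun i hi => by simp [h2 i hi], ?_⟩
  cases p <;> simp only [Pi.neg_apply] at h3 ⊢
  · linarith
  · linarith
  · simp [h3.1, h3.2]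

/-- Twisting both levels simultaneously preserves the relation of a slice. Untwisting the upper
level then exchanges a twist below for one above. -/
lemma PathIso.twist_slice {l r : List Bool} {p : FlatPiece} {f f' : ℕ → ℤ}
    (hf : Passes l.length p r.length f f') :
    PathIso.{uX, uS, uG} σ [.twist (l ++ p.bot ++ r) f, .slice l p r]
      [.slice l p r, .twist (l ++ p.top ++ r) f'] := by
  refine .of_sat (.cons_forward trivial (.single _)) (.pair_backward _ trivial)
    fun G _ _ A a a' => ?_
  rw [sat_twist_cons]
  constructor
  · rintro ⟨h, m, h1, rfl⟩
    refine ⟨twistState σ A (-f') m, ?_, m, ⟨?_, ?_⟩, rfl⟩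
    · simpa using h1.twist hf.neg
    · obtain ⟨L, M, M', R, h0, rfl, rfl, rfl, h3⟩ := h1
      simp [h3.top_eq]
    · rw [← twistState_add, add_neg_cancel, twistState_zero]
  · rintro ⟨m, h1, _, ⟨h2, rfl⟩, rfl⟩
    refine ⟨?_, _, h1.twist hf, rfl⟩
    obtain ⟨L, M, M', R, rfl, rfl, rfl, rfl, h3⟩ := h1
    simp [h3.bot_eq]

end Widen

/-! ## Diagrams as words -/

section Flat

variable {c : ℕ}

/-- The directions of the strands on a level. -/
abbrev ups (a : List (Strand c)) : List Bool := a.map Strand.up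

def Piece.flat : Piece c → FlatPiece
  | cup s => .cup s.up
  | cap s => .cap s.up
  | cross k sl sr => .cross k sl.up sr.up

def Slice.op (s : Slice c) : Op := .slice (ups s.left) s.piece.flat (ups s.right)

/-- The letters of a stack of slices. -/
abbrev flat (w : List (Slice c)) : List Op := w.map Slice.op

lemma Piece.bot_flat (p : Piece c) : p.flat.bot = ups p.bot := by
  cases p <;> rfl

lemma Piece.top_flat (p : Piece c) : p.flat.top = ups p.top := by
  cases p <;> rfl

lemma flat_widen (l r : List (Strand c)) (w : List (Slice c)) :
    flat (widen l r w) = (flat w).map (Op.widen (ups l) (ups r)) := by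
  simp [flat, widen, Slice.op, Op.widen]

end Flat

/-! ## Local moves -/

section LocalMoves

variable {X : Type uX} {S : Type uS} {b : VirtualBirack X} {σ : Shadow b S}
variable {G : Type uG} [AddCommGroup G] [Module (Alg b σ) G]

lemma map_fst_eq_singleton {α β : Type*} {L : List (α × β)} {u : α} :
    L.map Prod.fst = [u] ↔ ∃ x, L = [(u, x)] := by
  constructor
  · intro h
    match L, h with
    | [(u', x)], h => exact ⟨x, by simpa using h⟩
  · rintro ⟨x, rfl⟩; rfl

variable [Finite X]

/-! ### Slices with at most one strand beside the piece -/

section Rel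

variable {A : S} {k : CrossKind} {u v u' : Bool} {a a' : State X G}

lemma rel_cross_nil_nil : (Op.slice [] (.cross k u v) []).Rel σ A a a' ↔
    ∃ p q r s, a = [(u, p), (v, q)] ∧ a' = [(v, r), (u, s)] ∧ CrossRel σ k u v A p q r s := by
  constructor
  · rintro ⟨L, M, M', R, rfl, rfl, h1, h2, p, q, r, s, rfl, rfl, h⟩
    obtain rfl := List.map_eq_nil_iff.1 h1
    obtain rfl := List.map_eq_nil_iff.1 h2
    exact ⟨p, q, r, s, rfl, rfl, h⟩
  · rintro ⟨p, q, r, s, rfl, rfl, h⟩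
    exact ⟨[], _, _, [], rfl, rfl, rfl, rfl, p, q, r, s, rfl, rfl, h⟩

lemma rel_cross_single_nil : (Op.slice [u'] (.cross k u v) []).Rel σ A a a' ↔
    ∃ x p q r s, a = [(u', x), (u, p), (v, q)] ∧ a' = [(u', x), (v, r), (u, s)] ∧
      CrossRel σ k u v (step σ A u' x) p q r s := by
  constructor
  · rintro ⟨L, M, M', R, rfl, rfl, h1, h2, p, q, r, s, rfl, rfl, h⟩
    obtain ⟨x, rfl⟩ := map_fst_eq_singleton.1 h1
    obtain rfl := List.map_eq_nil_iff.1 h2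
    exact ⟨x, p, q, r, s, rfl, rfl, h⟩
  · rintro ⟨x, p, q, r, s, rfl, rfl, h⟩
    exact ⟨[(u', x)], [(u, p), (v, q)], [(v, r), (u, s)], [], rfl, rfl, rfl, rfl,
      p, q, r, s, rfl, rfl, h⟩

lemma rel_cross_nil_single : (Op.slice [] (.cross k u v) [u']).Rel σ A a a' ↔
    ∃ x p q r s, a = [(u, p), (v, q), (u', x)] ∧ a' = [(v, r), (u, s), (u', x)] ∧
      CrossRel σ k u v A p q r s := by
  constructor
  · rintro ⟨L, M, M', R, rfl, rfl, h1, h2, p, q, r, s, rfl, rfl, h⟩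
    obtain rfl := List.map_eq_nil_iff.1 h1
    obtain ⟨x, rfl⟩ := map_fst_eq_singleton.1 h2
    exact ⟨x, p, q, r, s, rfl, rfl, h⟩
  · rintro ⟨x, p, q, r, s, rfl, rfl, h⟩
    exact ⟨[], [(u, p), (v, q)], [(v, r), (u, s)], [(u', x)], rfl, rfl, rfl, rfl,
      p, q, r, s, rfl, rfl, h⟩

lemma rel_cup_single_nil : (Op.slice [u'] (.cup u) []).Rel σ A a a' ↔
    ∃ x l, a = [(u', x)] ∧ a' = [(u', x), (u, l), (!u, l)] := by
  constructor
  · rintro ⟨L, M, M', R, rfl, rfl, h1, h2, rfl, l, rfl⟩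
    obtain ⟨x, rfl⟩ := map_fst_eq_singleton.1 h1
    obtain rfl := List.map_eq_nil_iff.1 h2
    exact ⟨x, l, rfl, rfl⟩
  · rintro ⟨x, l, rfl, rfl⟩
    exact ⟨[(u', x)], [], [(u, l), (!u, l)], [], rfl, rfl, rfl, rfl, rfl, l, rfl⟩

lemma rel_cup_nil_single : (Op.slice [] (.cup u) [u']).Rel σ A a a' ↔
    ∃ x l, a = [(u', x)] ∧ a' = [(u, l), (!u, l), (u', x)] := by
  constructor
  · rintro ⟨L, M, M', R, rfl, rfl, h1, h2, rfl, l, rfl⟩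
    obtain rfl := List.map_eq_nil_iff.1 h1
    obtain ⟨x, rfl⟩ := map_fst_eq_singleton.1 h2
    exact ⟨x, l, rfl, rfl⟩
  · rintro ⟨x, l, rfl, rfl⟩
    exact ⟨[], [], [(u, l), (!u, l)], [(u', x)], rfl, rfl, rfl, rfl, rfl, l, rfl⟩

lemma rel_cap_single_nil : (Op.slice [u'] (.cap u) []).Rel σ A a a' ↔
    ∃ x l, a = [(u', x), (u, l), (!u, l)] ∧ a' = [(u', x)] := by
  constructor
  · rintro ⟨L, M, M', R, rfl, rfl, h1, h2, ⟨l, rfl⟩, rfl⟩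
    obtain ⟨x, rfl⟩ := map_fst_eq_singleton.1 h1
    obtain rfl := List.map_eq_nil_iff.1 h2
    exact ⟨x, l, rfl, rfl⟩
  · rintro ⟨x, l, rfl, rfl⟩
    exact ⟨[(u', x)], [(u, l), (!u, l)], [], [], rfl, rfl, rfl, rfl, ⟨l, rfl⟩, rfl⟩

lemma rel_cap_nil_single : (Op.slice [] (.cap u) [u']).Rel σ A a a' ↔
    ∃ x l, a = [(u, l), (!u, l), (u', x)] ∧ a' = [(u', x)] := by
  constructor
  · rintro ⟨L, M, M', R, rfl, rfl, h1, h2, ⟨l, rfl⟩, rfl⟩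
    obtain rfl := List.map_eq_nil_iff.1 h1
    obtain ⟨x, rfl⟩ := map_fst_eq_singleton.1 h2
    exact ⟨x, l, rfl, rfl⟩
  · rintro ⟨x, l, rfl, rfl⟩
    exact ⟨[], [(u, l), (!u, l)], [], [(u', x)], rfl, rfl, rfl, rfl, ⟨l, rfl⟩, rfl⟩

end Rel

variable (σ) in
/-- The words `w` and `w'`, with strands of directions `t` at the bottom, have the same labelings
if `f i` kinks are put on strand number `i` of the second one. -/
def Replaces (t : List Bool) (w : List Op) (f : ℕ → ℤ) (w' : List Op) : Prop :=
  Rigid.{uX, uS, uG} σ (.twist t 0 :: w) ∧ Rigid.{uX, uS, uG} σ (.twist t f :: w') ∧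
    ∀ (G : Type uG) [AddCommGroup G] [Module (Alg b σ) G] (A : S) (a a' : State X G),
      Sat σ A (.twist t 0 :: w) a a' ↔ Sat σ A (.twist t f :: w') a a'

lemma replaces_of_sat {t : List Bool} {w w' : List Op} (h : Rigid.{uX, uS, uG} σ w)
    (h' : Rigid.{uX, uS, uG} σ w')
    (H : ∀ (G : Type uG) [AddCommGroup G] [Module (Alg b σ) G] (A : S) (a a' : State X G),
      a.map Prod.fst = t → (Sat σ A w a a' ↔ Sat σ A w' a a')) :
    Replaces.{uX, uS, uG} σ t w 0 w' := by
  refine ⟨.cons_forward trivial h, .cons_forward trivial h', fun G _ _ A a a' => ?_⟩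
  simp only [sat_twist_cons, twistState_zero]
  exact and_congr_right (H G A a a')

/-- Both orders are described by the same independent data for `p` and for `q`, and differ only in
the intermediate level. -/
lemma replaces_exchange (p q : FlatPiece) (m : List Bool) :
    Replaces.{uX, uS, uG} σ (p.bot ++ m ++ q.bot)
      [.slice [] p (m ++ q.bot), .slice (p.top ++ m) q []] 0
      [.slice (p.bot ++ m) q [], .slice [] p (m ++ q.top)] := by
  have h1 (G : Type uG) [AddCommGroup G] [Module (Alg b σ) G] (A : S) (a m₁ a' : State X G) :
      (Op.slice [] p (m ++ q.bot)).Rel σ A a m₁ ∧ (Op.slice (p.top ++ m) q []).Rel σ A m₁ a' ↔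
      ∃ P L Q P' Q', a = P ++ L ++ Q ∧ m₁ = P' ++ L ++ Q ∧ a' = P' ++ L ++ Q' ∧
        L.map Prod.fst = m ∧ PieceRel σ A p P P' ∧ PieceRel σ (walk σ A (P ++ L)) q Q Q' := by
    constructor
    · rintro ⟨⟨L₁, M₁, M₁', R₁, rfl, rfl, e1, e2, e3⟩, L₂, M₂, M₂', R₂, e, rfl, e4, e5, e6⟩
      obtain rfl := List.map_eq_nil_iff.1 e1
      obtain rfl := List.map_eq_nil_iff.1 e5
      obtain ⟨L, Q, rfl, rfl, hQ⟩ := List.map_eq_append_iff.1 e2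
      obtain ⟨P', L', rfl, hP, hL⟩ := List.map_eq_append_iff.1 e4
      have e' : M₁' ++ L ++ Q = P' ++ L' ++ M₂ := by simpa using e
      obtain ⟨rfl, rfl, rfl⟩ := append_append_inj (g := Prod.fst) e' (e3.top_eq.trans hP.symm)
        (hQ.trans e6.bot_eq.symm)
      refine ⟨M₁, L, Q, M₁', M₂', by simp, by simp, by simp, rfl, e3, ?_⟩
      rw [walk_append] at e6 ⊢
      -- The piece `p` does not alter the region on its right, so `q` sees the same region whether
      -- it lies above or below `p`.
      rwa [show walk σ A M₁ = _ from e3.walk_eq]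
    · rintro ⟨P, L, Q, P', Q', rfl, rfl, rfl, rfl, h1, h2⟩
      refine ⟨⟨[], P, P', L ++ Q, by simp, by simp, rfl, by simp [h2.bot_eq], h1⟩,
        P' ++ L, Q, Q', [], by simp, by simp, by simp [h1.top_eq], rfl, ?_⟩
      rw [walk_append] at h2 ⊢
      rwa [← h1.walk_eq]
  have h2 (G : Type uG) [AddCommGroup G] [Module (Alg b σ) G] (A : S) (a m₁ a' : State X G) :
      (Op.slice (p.bot ++ m) q []).Rel σ A a m₁ ∧ (Op.slice [] p (m ++ q.top)).Rel σ A m₁ a' ↔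
      ∃ P L Q P' Q', a = P ++ L ++ Q ∧ m₁ = P ++ L ++ Q' ∧ a' = P' ++ L ++ Q' ∧
        L.map Prod.fst = m ∧ PieceRel σ A p P P' ∧ PieceRel σ (walk σ A (P ++ L)) q Q Q' := by
    constructor
    · rintro ⟨⟨L₂, M₂, M₂', R₂, rfl, rfl, e4, e5, e6⟩, L₁, M₁, M₁', R₁, e, rfl, e1, e2, e3⟩
      obtain rfl := List.map_eq_nil_iff.1 e1
      obtain rfl := List.map_eq_nil_iff.1 e5
      obtain ⟨L, Q, rfl, rfl, hQ⟩ := List.map_eq_append_iff.1 e2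
      obtain ⟨P', L', rfl, hP, hL⟩ := List.map_eq_append_iff.1 e4
      have e' : P' ++ L' ++ M₂' = M₁ ++ L ++ Q := by simpa using e
      obtain ⟨rfl, rfl, rfl⟩ := append_append_inj (g := Prod.fst) e' (hP.trans e3.bot_eq.symm)
        (e6.top_eq.trans hQ.symm)
      exact ⟨P', L', M₂, M₁', M₂', by simp, by simp, by simp, rfl, e3, e6⟩
    · rintro ⟨P, L, Q, P', Q', rfl, rfl, rfl, rfl, h1, h2⟩
      exact ⟨⟨P ++ L, Q, Q', [], by simp, by simp, by simp [h1.bot_eq], rfl, h2⟩,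
        [], P, P', L ++ Q', by simp, by simp, rfl, by simp [h2.top_eq], h1⟩
  refine replaces_of_sat ⟨.single _, ?_⟩ ⟨.single _, ?_⟩ fun G _ _ A a a' _ => ?_
  -- Since either piece may be an extremum, neither letter alone need determine the middle level:
  -- its left part is read from the top and its right part from the bottom.
  · rintro G _ _ A a m₁ m₂ a' g1 ⟨_, g2, rfl⟩ g3 ⟨_, g4, rfl⟩
    obtain ⟨P, L, Q, P', Q', rfl, rfl, rfl, e4, e5, e6⟩ := (h1 G A _ _ _).1 ⟨g1, g2⟩
    obtain ⟨P₁, L₁, Q₁, P₁', Q₁', e1, rfl, e3, e4', e5', e6'⟩ := (h1 G A _ _ _).1 ⟨g3, g4⟩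
    obtain ⟨rfl, rfl, rfl⟩ := append_append_inj (g := Prod.fst) e1
      (e5.bot_eq.trans e5'.bot_eq.symm) (e6.bot_eq.trans e6'.bot_eq.symm)
    obtain ⟨rfl, -, rfl⟩ := append_append_inj (g := Prod.fst) e3
      (e5.top_eq.trans e5'.top_eq.symm) (e6.top_eq.trans e6'.top_eq.symm)
    rfl
  · rintro G _ _ A a m₁ m₂ a' g1 ⟨_, g2, rfl⟩ g3 ⟨_, g4, rfl⟩
    obtain ⟨P, L, Q, P', Q', rfl, rfl, rfl, e4, e5, e6⟩ := (h2 G A _ _ _).1 ⟨g1, g2⟩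
    obtain ⟨P₁, L₁, Q₁, P₁', Q₁', e1, rfl, e3, e4', e5', e6'⟩ := (h2 G A _ _ _).1 ⟨g3, g4⟩
    obtain ⟨rfl, rfl, rfl⟩ := append_append_inj (g := Prod.fst) e1
      (e5.bot_eq.trans e5'.bot_eq.symm) (e6.bot_eq.trans e6'.bot_eq.symm)
    obtain ⟨rfl, -, rfl⟩ := append_append_inj (g := Prod.fst) e3
      (e5.top_eq.trans e5'.top_eq.symm) (e6.top_eq.trans e6'.top_eq.symm)
    rfl
  · constructor
    · rintro ⟨m₁, g1, _, g2, rfl⟩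
      obtain ⟨P, L, Q, P', Q', rfl, rfl, rfl, e⟩ := (h1 G A _ _ _).1 ⟨g1, g2⟩
      obtain ⟨f1, f2⟩ := (h2 G A _ _ _).2 ⟨P, L, Q, P', Q', rfl, rfl, rfl, e⟩
      exact ⟨_, f1, _, f2, rfl⟩
    · rintro ⟨m₁, g1, _, g2, rfl⟩
      obtain ⟨P, L, Q, P', Q', rfl, rfl, rfl, e⟩ := (h2 G A _ _ _).1 ⟨g1, g2⟩
      obtain ⟨f1, f2⟩ := (h1 G A _ _ _).2 ⟨P, L, Q, P', Q', rfl, rfl, rfl, e⟩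
      exact ⟨_, f1, _, f2, rfl⟩

/-- The maximum equates the free label of the minimum with that of the incoming strand, which also
makes the middle level unique. -/
lemma replaces_zigzag (u : Bool) : Replaces.{uX, uS, uG} σ [u]
    [.slice [] (.cup u) [u], .slice [u] (.cap (!u)) []] 0 [] := by
  refine replaces_of_sat ⟨.single _, ?_⟩ trivial fun G _ _ A a a' ha => ?_
  · rintro G _ _ A a m₁ m₂ a' g1 ⟨_, g2, rfl⟩ g3 ⟨_, g4, rfl⟩
    obtain ⟨x, l, rfl, rfl⟩ := rel_cup_nil_single.1 g1
    obtain ⟨y, l', e, rfl⟩ := rel_cup_nil_single.1 g3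
    obtain ⟨x', z, e1, -⟩ := rel_cap_single_nil.1 g2
    obtain ⟨y', z', e2, -⟩ := rel_cap_single_nil.1 g4
    simp only [List.cons.injEq, Prod.mk.injEq, true_and, and_true] at e e1 e2
    obtain ⟨rfl, rfl, -, rfl⟩ := e1
    obtain ⟨rfl, rfl, -, rfl⟩ := e2
    subst e
    rfl
  · obtain ⟨x, rfl⟩ := map_fst_eq_singleton.1 ha
    constructor
    · rintro ⟨m₁, g1, _, g2, rfl⟩
      obtain ⟨x, l, e, rfl⟩ := rel_cup_nil_single.1 g1
      obtain ⟨x', z, e1, rfl⟩ := rel_cap_single_nil.1 g2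
      simp only [List.cons.injEq, Prod.mk.injEq, true_and, and_true] at e e1
      obtain ⟨rfl, rfl, -, rfl⟩ := e1
      subst e
      rfl
    · rintro rfl
      exact ⟨_, rel_cup_nil_single.2 ⟨x, x, rfl, rfl⟩, _,
        rel_cap_single_nil.2 ⟨x, x, by simp, rfl⟩, rfl⟩

lemma replaces_zagzig (u : Bool) : Replaces.{uX, uS, uG} σ [u]
    [.slice [u] (.cup (!u)) [], .slice [] (.cap u) [u]] 0 [] := by
  refine replaces_of_sat ⟨.single _, ?_⟩ trivial fun G _ _ A a a' ha => ?_
  · rintro G _ _ A a m₁ m₂ a' g1 ⟨_, g2, rfl⟩ g3 ⟨_, g4, rfl⟩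
    obtain ⟨x, l, rfl, rfl⟩ := rel_cup_single_nil.1 g1
    obtain ⟨y, l', e, rfl⟩ := rel_cup_single_nil.1 g3
    obtain ⟨x', z, e1, -⟩ := rel_cap_nil_single.1 g2
    obtain ⟨y', z', e2, -⟩ := rel_cap_nil_single.1 g4
    simp only [List.cons.injEq, Prod.mk.injEq, true_and, and_true] at e e1 e2
    obtain ⟨rfl, rfl, -, rfl⟩ := e1
    obtain ⟨rfl, rfl, -, rfl⟩ := e2
    subst e
    rfl
  · obtain ⟨x, rfl⟩ := map_fst_eq_singleton.1 ha
    constructor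
    · rintro ⟨m₁, g1, _, g2, rfl⟩
      obtain ⟨x, l, e, rfl⟩ := rel_cup_single_nil.1 g1
      obtain ⟨x', z, e1, rfl⟩ := rel_cap_nil_single.1 g2
      simp only [List.cons.injEq, Prod.mk.injEq, true_and, and_true] at e e1
      obtain ⟨rfl, rfl, -, rfl⟩ := e1
      subst e
      rfl
    · rintro rfl
      exact ⟨_, rel_cup_single_nil.2 ⟨x, x, rfl, rfl⟩, _,
        rel_cap_nil_single.2 ⟨x, x, by simp, rfl⟩, rfl⟩

/-- Sliding a crossing over a maximum is a quarter turn of it, and the rule is invariant under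
quarter turns. -/
lemma replaces_slide_cap (k : CrossKind) (u v : Bool) : Replaces.{uX, uS, uG} σ [v, u, !v]
    [.slice [v] (.cross k u (!v)) [], .slice [] (.cap v) [u]] 0
    [.slice [] (.cross k.swap v u) [!v], .slice [u] (.cap v) []] := by
  refine replaces_of_sat (.cons_forward trivial (.single _)) (.cons_forward trivial (.single _))
    fun G _ _ A a a' ha => ?_
  constructor
  · rintro ⟨m₁, g1, _, g2, rfl⟩
    obtain ⟨x, p, q, r, s, rfl, rfl, h⟩ := rel_cross_single_nil.1 g1
    obtain ⟨y, l, e, rfl⟩ := rel_cap_nil_single.1 g2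
    simp only [List.cons.injEq, Prod.mk.injEq, true_and, and_true] at e
    obtain ⟨rfl, rfl, rfl⟩ := e
    rw [← crossRel_turn', Bool.not_not, step_not] at h
    exact ⟨_, rel_cross_nil_single.2 ⟨_, _, _, _, _, rfl, rfl, h⟩, _,
      rel_cap_single_nil.2 ⟨_, _, rfl, rfl⟩, rfl⟩
  · rintro ⟨m₁, g1, _, g2, rfl⟩
    obtain ⟨x, p, q, r, s, rfl, rfl, h⟩ := rel_cross_nil_single.1 g1
    obtain ⟨y, l, e, rfl⟩ := rel_cap_single_nil.1 g2
    simp only [List.cons.injEq, Prod.mk.injEq, true_and, and_true] at e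
    obtain ⟨rfl, rfl, rfl⟩ := e
    rw [← crossRel_turn, CrossKind.swap_swap] at h
    exact ⟨_, rel_cross_single_nil.2 ⟨_, _, _, _, _, rfl, rfl, h⟩, _,
      rel_cap_nil_single.2 ⟨_, _, rfl, rfl⟩, rfl⟩

lemma replaces_slide_cup (k : CrossKind) (u v : Bool) : Replaces.{uX, uS, uG} σ [u]
    [.slice [] (.cup v) [u], .slice [v] (.cross k (!v) u) []] 0
    [.slice [u] (.cup v) [], .slice [] (.cross k.swap u v) [!v]] := by
  refine replaces_of_sat (.pair_backward _ trivial) (.pair_backward _ trivial)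
    fun G _ _ A a a' ha => ?_
  constructor
  · rintro ⟨m₁, g1, _, g2, rfl⟩
    obtain ⟨y, l, rfl, rfl⟩ := rel_cup_nil_single.1 g1
    obtain ⟨x, p, q, r, s, e, rfl, h⟩ := rel_cross_single_nil.1 g2
    simp only [List.cons.injEq, Prod.mk.injEq, true_and, and_true] at e
    obtain ⟨rfl, rfl, rfl⟩ := e
    rw [← crossRel_turn, Bool.not_not, step_not] at h
    exact ⟨_, rel_cup_single_nil.2 ⟨_, _, rfl, rfl⟩, _,
      rel_cross_nil_single.2 ⟨_, _, _, _, _, rfl, rfl, h⟩, rfl⟩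
  · rintro ⟨m₁, g1, _, g2, rfl⟩
    obtain ⟨y, l, rfl, rfl⟩ := rel_cup_single_nil.1 g1
    obtain ⟨x, p, q, r, s, e, rfl, h⟩ := rel_cross_nil_single.1 g2
    simp only [List.cons.injEq, Prod.mk.injEq, true_and, and_true] at e
    obtain ⟨rfl, rfl, rfl⟩ := e
    rw [← crossRel_turn', CrossKind.swap_swap] at h
    exact ⟨_, rel_cup_nil_single.2 ⟨_, _, rfl, rfl⟩, _,
      rel_cross_single_nil.2 ⟨_, _, _, _, _, rfl, rfl, h⟩, rfl⟩

lemma replaces_bigon (k : CrossKind) (u v : Bool) : Replaces.{uX, uS, uG} σ [u, v]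
    [.slice [] (.cross k u v) [], .slice [] (.cross k.swap v u) []] 0 [] := by
  refine replaces_of_sat (.cons_forward trivial (.single _)) trivial fun G _ _ A a a' ha => ?_
  constructor
  · rintro ⟨m₁, g1, _, g2, rfl⟩
    obtain ⟨p, q, r, s, rfl, rfl, h⟩ := rel_cross_nil_nil.1 g1
    obtain ⟨p', q', r', s', e, rfl, h'⟩ := rel_cross_nil_nil.1 g2
    simp only [List.cons.injEq, Prod.mk.injEq, true_and, and_true] at e
    obtain ⟨rfl, rfl⟩ := e
    rw [crossRel_flip] at h'
    obtain ⟨rfl, rfl⟩ := h.unique_bot h'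
    rfl
  · rintro rfl
    obtain ⟨⟨u, p⟩, a₁, rfl, rfl, hv⟩ := List.map_eq_cons_iff.1 ha
    obtain ⟨q, rfl⟩ := map_fst_eq_singleton.1 hv
    obtain ⟨r, s, h⟩ := CrossRel.exists (σ := σ) k u v A p q
    exact ⟨_, rel_cross_nil_nil.2 ⟨_, _, _, _, rfl, rfl, h⟩, _,
      rel_cross_nil_nil.2 ⟨_, _, _, _, rfl, rfl, crossRel_flip.2 h⟩, rfl⟩

lemma replaces_triangle {k₁₂ k₁₃ k₂₃ : CrossKind} (h : Triangle k₁₂ k₁₃ k₂₃) (u₁ u₂ u₃ : Bool) :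
    Replaces.{uX, uS, uG} σ [u₁, u₂, u₃]
      [.slice [] (.cross k₁₂ u₁ u₂) [u₃], .slice [u₂] (.cross k₁₃ u₁ u₃) [],
        .slice [] (.cross k₂₃ u₂ u₃) [u₁]] 0
      [.slice [u₁] (.cross k₂₃ u₂ u₃) [], .slice [] (.cross k₁₃ u₁ u₃) [u₂],
        .slice [u₃] (.cross k₁₂ u₁ u₂) []] := by
  refine replaces_of_sat (.cons_forward trivial (.cons_forward trivial (.single _)))
    (.cons_forward trivial (.cons_forward trivial (.single _))) fun G _ _ A a a' ha => ?_
  have key := (triangleRule (G := G) (σ := σ) h u₁ u₂ u₃).iff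
  constructor
  · rintro ⟨m₁, g1, m₂, g2, _, g3, rfl⟩
    obtain ⟨p₃, p₁, p₂, r₂, r₁, rfl, rfl, h1⟩ := rel_cross_nil_single.1 g1
    obtain ⟨x, y, z, r₃, q₁, e, rfl, h2⟩ := rel_cross_single_nil.1 g2
    simp only [List.cons.injEq, Prod.mk.injEq, true_and, and_true] at e
    obtain ⟨rfl, rfl, rfl⟩ := e
    obtain ⟨x, y, z, q₃, q₂, e, rfl, h3⟩ := rel_cross_nil_single.1 g3
    simp only [List.cons.injEq, Prod.mk.injEq, true_and, and_true] at e
    obtain ⟨rfl, rfl, rfl⟩ := e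
    obtain ⟨n₁, n₂, n₃, h1', h2', h3'⟩ := (key _ _ _ _ _ _ _).1 ⟨_, _, _, h1, h2, h3⟩
    exact ⟨_, rel_cross_single_nil.2 ⟨_, _, _, _, _, rfl, rfl, h1'⟩,
      _, rel_cross_nil_single.2 ⟨_, _, _, _, _, rfl, rfl, h2'⟩,
      _, rel_cross_single_nil.2 ⟨_, _, _, _, _, rfl, rfl, h3'⟩, rfl⟩
  · rintro ⟨m₁, g1, m₂, g2, _, g3, rfl⟩
    obtain ⟨p₁, p₂, p₃, n₃, n₂, rfl, rfl, h1⟩ := rel_cross_single_nil.1 g1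
    obtain ⟨x, y, z, q₃, n₁, e, rfl, h2⟩ := rel_cross_nil_single.1 g2
    simp only [List.cons.injEq, Prod.mk.injEq, true_and, and_true] at e
    obtain ⟨rfl, rfl, rfl⟩ := e
    obtain ⟨x, y, z, q₂, q₁, e, rfl, h3⟩ := rel_cross_single_nil.1 g3
    simp only [List.cons.injEq, Prod.mk.injEq, true_and, and_true] at e
    obtain ⟨rfl, rfl, rfl⟩ := e
    obtain ⟨n₁, n₂, n₃, h1', h2', h3'⟩ := (key _ _ _ _ _ _ _).2 ⟨_, _, _, h1, h2, h3⟩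
    exact ⟨_, rel_cross_nil_single.2 ⟨_, _, _, _, _, rfl, rfl, h1'⟩,
      _, rel_cross_single_nil.2 ⟨_, _, _, _, _, rfl, rfl, h2'⟩,
      _, rel_cross_nil_single.2 ⟨_, _, _, _, _, rfl, rfl, h3'⟩, rfl⟩

/-- A removed kink leaves behind the twist by its own sign. Kink removal, with the loop on either
side, is the only move with a nonzero compensation, and a virtual kink needs none. -/
lemma replaces_kink_right (k : CrossKind) (u : Bool) : Replaces.{uX, uS, uG} σ [u]
    [.slice [u] (.cup u) [], .slice [] (.cross k u u) [!u], .slice [u] (.cap u) []]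
    (Pi.single 0 k.kinkSign) [] := by
  have key (G : Type uG) [AddCommGroup G] [Module (Alg b σ) G] (A : S) (a m m₂ a' : State X G)
      (g1 : (Op.slice [u] (.cup u) []).Rel σ A a m)
      (g2 : (Op.slice [] (.cross k u u) [!u]).Rel σ A m m₂)
      (g3 : (Op.slice [u] (.cap u) []).Rel σ A m₂ a') :
      ∃ p l, a = [(u, p)] ∧ m = [(u, p), (u, l), (!u, l)] ∧
        a' = [(u, kinkTwist σ A u k.kinkSign p)] ∧
        CrossRel σ k u u A p l (kinkTwist σ A u k.kinkSign p) l := by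
    obtain ⟨p, l, rfl, rfl⟩ := rel_cup_single_nil.1 g1
    obtain ⟨x, y, z, r, s, e, rfl, h⟩ := rel_cross_nil_single.1 g2
    simp only [List.cons.injEq, Prod.mk.injEq, true_and, and_true] at e
    obtain ⟨rfl, rfl, rfl⟩ := e
    obtain ⟨x, y, e, rfl⟩ := rel_cap_single_nil.1 g3
    simp only [List.cons.injEq, Prod.mk.injEq, true_and, and_true] at e
    obtain ⟨rfl, rfl, rfl⟩ := e
    obtain ⟨m, h1, h2⟩ := kink_right_existsUnique (σ := σ) k u A p
    obtain ⟨rfl, rfl⟩ := h2 _ _ h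
    exact ⟨_, _, rfl, rfl, rfl, h⟩
  refine ⟨.cons_forward trivial ⟨.cons_forward trivial (.single _), ?_⟩,
    .cons_forward trivial trivial, fun G _ _ A a a' => ?_⟩
  -- The minimum creates an arbitrary label; it is pinned down by uniqueness of the label on a loop.
  · rintro G _ _ A a m m' a' g1 ⟨_, g2, _, g3, rfl⟩ g1' ⟨_, g2', _, g3', rfl⟩
    obtain ⟨p, l, rfl, rfl, rfl, h⟩ := key G A _ _ _ _ g1 g2 g3
    obtain ⟨p', l', e, rfl, -, h'⟩ := key G A _ _ _ _ g1' g2' g3'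
    simp only [List.cons.injEq, Prod.mk.injEq, true_and, and_true] at e
    obtain rfl := e
    obtain ⟨m, -, h2⟩ := kink_right_existsUnique (σ := σ) k u A p
    rw [(h2 _ _ h).1, (h2 _ _ h').1]
  · rw [sat_twist_cons, sat_twist_cons, twistState_zero]
    refine and_congr_right fun ha => ?_
    constructor
    · rintro ⟨m, g1, _, g2, _, g3, rfl⟩
      obtain ⟨p, l, rfl, rfl, rfl, h⟩ := key G A _ _ _ _ g1 g2 g3
      simp [Sat]
    · rintro rfl
      obtain ⟨p, rfl⟩ := map_fst_eq_singleton.1 ha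
      obtain ⟨l, h, -⟩ := kink_right_existsUnique (σ := σ) k u A p
      exact ⟨_, rel_cup_single_nil.2 ⟨_, l, rfl, rfl⟩,
        _, rel_cross_nil_single.2 ⟨_, _, _, _, _, rfl, rfl, h⟩,
        _, rel_cap_single_nil.2 ⟨_, _, rfl, rfl⟩, by simp [Sat]⟩

lemma replaces_kink_left (k : CrossKind) (u : Bool) : Replaces.{uX, uS, uG} σ [u]
    [.slice [] (.cup (!u)) [u], .slice [!u] (.cross k u u) [], .slice [] (.cap (!u)) [u]]
    (Pi.single 0 k.kinkSign) [] := by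
  have key (G : Type uG) [AddCommGroup G] [Module (Alg b σ) G] (A : S) (a m m₂ a' : State X G)
      (g1 : (Op.slice [] (.cup (!u)) [u]).Rel σ A a m)
      (g2 : (Op.slice [!u] (.cross k u u) []).Rel σ A m m₂)
      (g3 : (Op.slice [] (.cap (!u)) [u]).Rel σ A m₂ a') :
      ∃ p l, a = [(u, p)] ∧ m = [(!u, l), (!!u, l), (u, p)] ∧
        a' = [(u, kinkTwist σ A u k.kinkSign p)] ∧
        CrossRel σ k u u (step σ A (!u) l) l p l (kinkTwist σ A u k.kinkSign p) := by
    obtain ⟨p, l, rfl, rfl⟩ := rel_cup_nil_single.1 g1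
    obtain ⟨x, y, z, r, s, e, rfl, h⟩ := rel_cross_single_nil.1 g2
    simp only [List.cons.injEq, Prod.mk.injEq, true_and, and_true] at e
    obtain ⟨rfl, ⟨-, rfl⟩, rfl⟩ := e
    obtain ⟨x, y, e, rfl⟩ := rel_cap_nil_single.1 g3
    simp only [List.cons.injEq, Prod.mk.injEq, true_and, and_true] at e
    obtain ⟨rfl, ⟨-, rfl⟩, rfl⟩ := e
    obtain ⟨m, h1, h2⟩ := kink_left_existsUnique (σ := σ) k u A p
    obtain ⟨rfl, rfl⟩ := h2 _ _ h
    exact ⟨_, _, rfl, rfl, rfl, h⟩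
  refine ⟨.cons_forward trivial ⟨.cons_forward trivial (.single _), ?_⟩,
    .cons_forward trivial trivial, fun G _ _ A a a' => ?_⟩
  · rintro G _ _ A a m m' a' g1 ⟨_, g2, _, g3, rfl⟩ g1' ⟨_, g2', _, g3', rfl⟩
    obtain ⟨p, l, rfl, rfl, rfl, h⟩ := key G A _ _ _ _ g1 g2 g3
    obtain ⟨p', l', e, rfl, -, h'⟩ := key G A _ _ _ _ g1' g2' g3'
    simp only [List.cons.injEq, Prod.mk.injEq, true_and, and_true] at e
    obtain rfl := e
    obtain ⟨m, -, h2⟩ := kink_left_existsUnique (σ := σ) k u A p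
    rw [(h2 _ _ h).1, (h2 _ _ h').1]
  · rw [sat_twist_cons, sat_twist_cons, twistState_zero]
    refine and_congr_right fun ha => ?_
    constructor
    · rintro ⟨m, g1, _, g2, _, g3, rfl⟩
      obtain ⟨p, l, rfl, rfl, rfl, h⟩ := key G A _ _ _ _ g1 g2 g3
      simp [Sat]
    · rintro rfl
      obtain ⟨p, rfl⟩ := map_fst_eq_singleton.1 ha
      obtain ⟨l, h, -⟩ := kink_left_existsUnique (σ := σ) k u A p
      exact ⟨_, rel_cup_nil_single.2 ⟨_, l, rfl, rfl⟩,
        _, rel_cross_single_nil.2 ⟨_, l, _, _, _, by simp, rfl, h⟩,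
        _, rel_cap_nil_single.2 ⟨kinkTwist σ A u k.kinkSign p, l, by simp, rfl⟩, by simp [Sat]⟩

/-- Put zeros to the left of `f`, at places `< n`, and cut it off after `m` values. -/
def shiftTwist (n m : ℕ) (f : ℕ → ℤ) : ℕ → ℤ :=
  fun i => if n ≤ i ∧ i < n + m then f (i - n) else 0

lemma shiftTwist_zero (n m : ℕ) : shiftTwist n m 0 = 0 := by
  funext i; simp [shiftTwist]

/-- Locally equivalent words between vertical strands. -/
lemma Replaces.pathIso {t : List Bool} {w w' : List Op} {f : ℕ → ℤ}
    (h : Replaces.{uX, uS, uG} σ t w f w') (l r : List Bool) :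
    PathIso.{uX, uS, uG} σ (.twist (l ++ t ++ r) 0 :: w.map (Op.widen l r))
      (.twist (l ++ t ++ r) (shiftTwist l.length t.length f) :: w'.map (Op.widen l r)) := by
  have := PathIso.widen_of_sat h.1 h.2.1 (by simp) (by simp) h.2.2 l r
  rw [List.map_cons, List.map_cons] at this
  rw [← shiftTwist_zero l.length t.length]
  exact this

end LocalMoves

/-! ### Writhe and compensating kinks of a local move -/

section Diagrams

variable {X : Type uX} {S : Type uS} {b : VirtualBirack X} (σ : Shadow b S) [Finite X] {c : ℕ}

/-- The part of the kinks `f` on a level that lies on component `i`. -/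
def levelTotal (i : Fin c) : List (Strand c) → (ℕ → ℤ) → ℤ
  | [], _ => 0
  | e :: a, f => (if e.comp = i then f 0 else 0) + levelTotal i a fun j => f (j + 1)

/-- The writhe of component `i` in a stack of slices. -/
def wordWrithe (i : Fin c) (w : List (Slice c)) : ℤ := (w.map fun s => s.piece.writhe i).sum

lemma levelTotal_zero (i : Fin c) (a : List (Strand c)) : levelTotal i a 0 = 0 := by
  induction a with
  | nil => rfl
  | cons e a ih => exact (add_eq_right.2 (ite_self 0)).trans ih

lemma piece_writhe_kink (k : CrossKind) (s : Strand c) (i : Fin c) :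
    (Piece.cross k s s).writhe i = if s.comp = i then k.kinkSign else 0 := by
  simp only [Piece.writhe, and_self, crossSign_eq, beq_self_eq_true]
  cases k <;> rfl

/-- This makes the writhes of the two crossings of a bigon cancel. -/
lemma piece_writhe_swap (k : CrossKind) (s t : Strand c) (i : Fin c) :
    (Piece.cross k.swap t s).writhe i = -(Piece.cross k s t).writhe i := by
  simp only [Piece.writhe, crossSign_eq, CrossKind.sign_swap, and_comm (a := t.comp = i),
    Bool.beq_comm (a := t.up)]
  split_ifs
  · cases k.sign (s.up == t.up) <;> rfl
  · rfl

/-- A quarter turn exchanges the drawn strands and reverses the drawn direction of one of them; the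
two effects on the sign cancel. -/
lemma piece_writhe_turn (k : CrossKind) (s t : Strand c) (i : Fin c) :
    (Piece.cross k.swap t s).writhe i = (Piece.cross k s t.rev).writhe i := by
  have : (t.up == s.up) = !(s.up == !t.up) := by cases s.up <;> cases t.up <;> rfl
  simp only [Piece.writhe, crossSign_eq, and_comm (a := t.comp = i), Strand.rev, this,
    CrossKind.sign_not]

lemma piece_writhe_turn' (k : CrossKind) (s t : Strand c) (i : Fin c) :
    (Piece.cross k.swap s t).writhe i = (Piece.cross k t.rev s).writhe i := by
  have : (s.up == t.up) = !((!t.up) == s.up) := by cases s.up <;> cases t.up <;> rfl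
  simp only [Piece.writhe, crossSign_eq, and_comm (a := s.comp = i), Strand.rev, this,
    CrossKind.sign_not]

/-- The data of a local move: the levels below and above, and the compensating kinks. -/
lemma LocalMove.replaces {m m' : List (Slice c)} (h : LocalMove m m') :
    ∃ (a a' : List (Strand c)) (f : ℕ → ℤ), m ≠ [] ∧ Runs a m a' ∧ Runs a m' a' ∧
      Replaces.{uX, uS, uG} σ (ups a) (flat m) f (flat m') ∧
      ∀ i, levelTotal i a f = wordWrithe i m - wordWrithe i m' := by
  have base (l : List (Strand c)) (p : Piece c) (r : List (Strand c)) :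
    Runs (l ++ p.bot ++ r) [⟨l, p, r⟩] (l ++ p.top ++ r) := ⟨rfl, rfl⟩
  cases h with
  | exchange p q m =>
    refine ⟨p.bot ++ m ++ q.bot, p.top ++ m ++ q.top, 0, by simp, ?_, ?_, ?_, fun i => ?_⟩
    · simp [Runs, Slice.bot, Slice.top]
    · simp [Runs, Slice.bot, Slice.top]
    · simpa [Slice.op, Piece.bot_flat, Piece.top_flat] using
        replaces_exchange.{uX, uS, uG} (σ := σ) p.flat q.flat (ups m)
    · rw [levelTotal_zero]; simp [wordWrithe, add_comm]
  | zigzag s =>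
    refine ⟨[s], [s], 0, by simp, ?_, rfl, replaces_zigzag _, fun i => ?_⟩
    · simp [Runs, Slice.bot, Slice.top, Piece.bot, Piece.top, Strand.rev]
    · rw [levelTotal_zero]; simp [wordWrithe, Piece.writhe]
  | zagzig s =>
    refine ⟨[s], [s], 0, by simp, ?_, rfl, replaces_zagzig _, fun i => ?_⟩
    · simp [Runs, Slice.bot, Slice.top, Piece.bot, Piece.top, Strand.rev]
    · rw [levelTotal_zero]; simp [wordWrithe, Piece.writhe]
  | slide_cap k s t =>
    refine ⟨[t, s, t.rev], [s], 0, by simp, ?_, ?_, replaces_slide_cap _ _ _, fun i => ?_⟩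
    · simp [Runs, Slice.bot, Slice.top, Piece.bot, Piece.top, Strand.rev]
    · simp [Runs, Slice.bot, Slice.top, Piece.bot, Piece.top, Strand.rev]
    · rw [levelTotal_zero]
      simp only [wordWrithe, List.map_cons, List.map_nil, List.sum_cons, List.sum_nil]
      rw [piece_writhe_turn]; simp [Piece.writhe]
  | slide_cup k s t =>
    refine ⟨[s], [t, s, t.rev], 0, by simp, ?_, ?_, replaces_slide_cup _ _ _, fun i => ?_⟩
    · simp [Runs, Slice.bot, Slice.top, Piece.bot, Piece.top, Strand.rev]
    · simp [Runs, Slice.bot, Slice.top, Piece.bot, Piece.top, Strand.rev]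
    · rw [levelTotal_zero]
      simp only [wordWrithe, List.map_cons, List.map_nil, List.sum_cons, List.sum_nil]
      rw [piece_writhe_turn']; simp [Piece.writhe]
  | kink_right k s =>
    -- The writhe lost with the kink reappears as a twist on the only strand of the level.
    refine ⟨[s], [s], Pi.single 0 k.kinkSign, by simp, ?_, rfl, replaces_kink_right _ _,
      fun i => ?_⟩
    · simp [Runs, Slice.bot, Slice.top, Piece.bot, Piece.top, Strand.rev]
    · simp only [wordWrithe, List.map_cons, List.map_nil, List.sum_cons, List.sum_nil,
        piece_writhe_kink]
      simp [levelTotal, Piece.writhe]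
  | kink_left k s =>
    refine ⟨[s], [s], Pi.single 0 k.kinkSign, by simp, ?_, rfl, replaces_kink_left _ _,
      fun i => ?_⟩
    · simp [Runs, Slice.bot, Slice.top, Piece.bot, Piece.top, Strand.rev]
    · simp only [wordWrithe, List.map_cons, List.map_nil, List.sum_cons, List.sum_nil,
        piece_writhe_kink]
      simp [levelTotal, Piece.writhe]
  | bigon k s t =>
    refine ⟨[s, t], [s, t], 0, by simp, ?_, rfl, replaces_bigon _ _ _, fun i => ?_⟩
    · simp [Runs, Slice.bot, Slice.top, Piece.bot, Piece.top]
    · rw [levelTotal_zero]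
      simp only [wordWrithe, List.map_cons, List.map_nil, List.sum_cons, List.sum_nil]
      rw [piece_writhe_swap]; simp
  | triangle k₁₂ k₁₃ k₂₃ h s₁ s₂ s₃ =>
    refine ⟨[s₁, s₂, s₃], [s₃, s₂, s₁], 0, by simp, ?_, ?_, replaces_triangle h _ _ _, fun i => ?_⟩
    · simp [Runs, Slice.bot, Slice.top, Piece.bot, Piece.top]
    · simp [Runs, Slice.bot, Slice.top, Piece.bot, Piece.top]
    · rw [levelTotal_zero]
      simp only [wordWrithe, List.map_cons, List.map_nil, List.sum_cons, List.sum_nil]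
      ring

end Diagrams

/-! ## Runs -/

section Runs

variable {c : ℕ}

lemma runs_append {a a' : List (Strand c)} {w w' : List (Slice c)} :
    Runs a (w ++ w') a' ↔ ∃ t, Runs a w t ∧ Runs t w' a' := by
  induction w generalizing a with
  | nil => simp [Runs]
  | cons s w ih => simp [Runs, ih, and_assoc]

lemma Runs.bot_unique {a a' t t' : List (Strand c)} {w : List (Slice c)} (hw : w ≠ [])
    (h : Runs a w t) (h' : Runs a' w t') : a = a' := by
  cases w with
  | nil => exact absurd rfl hw
  | cons s w => exact h.1.symm.trans h'.1

lemma Runs.top_unique {a t t' : List (Strand c)} {w : List (Slice c)}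
    (h : Runs a w t) (h' : Runs a w t') : t = t' := by
  induction w generalizing a with
  | nil => exact h.symm.trans h'
  | cons s w ih => exact ih h.2 h'.2

lemma Runs.widen {a a' : List (Strand c)} {w : List (Slice c)} (h : Runs a w a')
    (l r : List (Strand c)) : Runs (l ++ a ++ r) (widen l r w) (l ++ a' ++ r) := by
  induction w generalizing a with
  | nil => obtain rfl := h; rfl
  | cons s w ih =>
    obtain ⟨rfl, h⟩ := h
    refine ⟨by simp [Slice.bot], ?_⟩
    have := ih h
    simpa [Slice.top, VirtualShadow.widen] using this

/-- Component `i` meets one of the levels of a stack of slices. -/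
def Occurs (i : Fin c) (a : List (Strand c)) (w : List (Slice c)) : Prop :=
  (∃ e ∈ a, e.comp = i) ∨ ∃ s ∈ w, ∃ e ∈ s.top, e.comp = i

lemma Occurs.cons {i : Fin c} {a : List (Strand c)} {s : Slice c} {w : List (Slice c)}
    (h : Occurs i s.top w) : Occurs i a (s :: w) := by
  rcases h with ⟨e, he, h⟩ | ⟨s', hs, h⟩
  · exact .inr ⟨s, by simp, e, he, h⟩
  · exact .inr ⟨s', by simp [hs], h⟩

lemma Runs.occurs_of_mem_top {i : Fin c} {a a' : List (Strand c)} {w : List (Slice c)}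
    (h : Runs a w a') {e : Strand c} (he : e ∈ a') (hi : e.comp = i) : Occurs i a w := by
  induction w generalizing a with
  | nil => obtain rfl := h; exact .inl ⟨e, he, hi⟩
  | cons s w ih => exact (ih h.2).cons

lemma Runs.occurs_of_mem_bot {i : Fin c} {a a' : List (Strand c)} {w : List (Slice c)}
    (h : Runs a w a') {s : Slice c} (hs : s ∈ w) {e : Strand c} (he : e ∈ s.bot)
    (hi : e.comp = i) : Occurs i a w := by
  induction w generalizing a with
  | nil => simp at hs
  | cons s' w ih =>
    obtain ⟨rfl, h⟩ := h
    rcases List.mem_cons.1 hs with rfl | hs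
    · exact .inl ⟨e, he, hi⟩
    · exact (ih h hs).cons

/-- No component is hidden inside the disk of a move; each one met there reaches the bottom or the
top. This lets all kinks be placed outside the disk. -/
lemma LocalMove.occurs {m m' : List (Slice c)} (h : LocalMove m m') {a a' : List (Strand c)}
    (hr : Runs a m a') {s : Slice c} (hs : s ∈ m) {e : Strand c} (he : e ∈ s.top) :
    (∃ e' ∈ a, e'.comp = e.comp) ∨ ∃ e' ∈ a', e'.comp = e.comp := by
  cases h <;>
    simp only [Runs, Slice.bot, Slice.top, Piece.bot, Piece.top, List.nil_append, List.append_nil,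
      List.cons_append, List.append_assoc, List.mem_cons, List.not_mem_nil, or_false] at hr hs he
  case exchange p q m =>
    obtain ⟨rfl, -, rfl⟩ := hr
    rcases hs with rfl | rfl
    · simp only [List.nil_append, List.mem_append] at he
      rcases he with he | he | he
      · exact .inr ⟨e, by simp [he], rfl⟩
      · exact .inr ⟨e, by simp [he], rfl⟩
      · exact .inl ⟨e, by simp [he], rfl⟩
    · exact .inr ⟨e, by simpa using he, rfl⟩
  all_goals
    obtain ⟨rfl, hr⟩ := hr
    have hr := hr.2
    try have hr := hr.2
    subst hr
    rcases hs with rfl | rfl | rfl <;>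
    · simp only [List.nil_append, List.append_nil, List.cons_append, List.mem_cons,
        List.not_mem_nil, or_false] at he
      rcases he with rfl | rfl | rfl <;> simp [Strand.rev]

end Runs

/-! ## Words decorated with kinks -/

section Deco

variable {c : ℕ}

/-- The letters of a stack of slices starting at the level `a`, with `τ k j` kinks on strand number
`j` of level number `k`. -/
def deco : List (Strand c) → List (Slice c) → (ℕ → ℕ → ℤ) → List Op
  | a, [], τ => [.twist (ups a) (τ 0)]
  | a, s :: w, τ => .twist (ups a) (τ 0) :: s.op :: deco s.top w fun k => τ (k + 1)

/-- The number of kinks on component `i`. -/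
def total (i : Fin c) : List (Strand c) → List (Slice c) → (ℕ → ℕ → ℤ) → ℤ
  | a, [], τ => levelTotal i a (τ 0)
  | a, s :: w, τ => levelTotal i a (τ 0) + total i s.top w fun k => τ (k + 1)

/-- Kinks on level number `k` only. -/
def atLevel (k : ℕ) (f : ℕ → ℤ) : ℕ → ℕ → ℤ := fun j => if j = k then f else 0

@[simp] lemma atLevel_self (k : ℕ) (f : ℕ → ℤ) : atLevel k f k = f := if_pos rfl

lemma atLevel_zero_succ (f : ℕ → ℤ) (k : ℕ) : atLevel 0 f (k + 1) = 0 := rfl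

lemma atLevel_succ_zero (f : ℕ → ℤ) (k : ℕ) : atLevel (k + 1) f 0 = 0 := rfl

lemma atLevel_succ_succ (f : ℕ → ℤ) (k j : ℕ) : atLevel (k + 1) f (j + 1) = atLevel k f j := by
  simp [atLevel]

lemma atLevel_add (k : ℕ) (f g : ℕ → ℤ) : atLevel k (f + g) = atLevel k f + atLevel k g := by
  funext j; simp only [atLevel, Pi.add_apply]; split_ifs <;> simp

lemma atLevel_zero (k : ℕ) : atLevel k 0 = 0 := by
  funext j; simp [atLevel]

/-- Kinks `f` on the lowest level and kinks `τ` on the levels above it. -/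
def consLevel (f : ℕ → ℤ) (τ : ℕ → ℕ → ℤ) : ℕ → ℕ → ℤ
  | 0 => f
  | k + 1 => τ k

/-- `x` kinks at strand number `p.2` of level number `p.1`. -/
def atPoint (p : ℕ × ℕ) (x : ℤ) : ℕ → ℕ → ℤ := atLevel p.1 (Pi.single p.2 x)

lemma atPoint_apply (p : ℕ × ℕ) (x : ℤ) (k j : ℕ) :
    atPoint p x k j = if (k, j) = p then x else 0 := by
  obtain ⟨k', j'⟩ := p
  by_cases h : k = k' <;> by_cases h' : j = j' <;> simp [atPoint, atLevel, h, h']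

lemma atPoint_add (p : ℕ × ℕ) (x y : ℤ) : atPoint p (x + y) = atPoint p x + atPoint p y := by
  rw [atPoint, Pi.single_add, atLevel_add]; rfl

lemma levelTotal_add (i : Fin c) (a : List (Strand c)) (f g : ℕ → ℤ) :
    levelTotal i a (f + g) = levelTotal i a f + levelTotal i a g := by
  induction a generalizing f g with
  | nil => rfl
  | cons e a ih =>
    have := ih (fun j => f (j + 1)) (fun j => g (j + 1))
    simp only [levelTotal]
    rw [show (fun j => (f + g) (j + 1)) = (fun j => f (j + 1)) + fun j => g (j + 1) from rfl, this]
    split_ifs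
    · simp only [Pi.add_apply]; ring
    · ring

lemma levelTotal_congr (i : Fin c) {a : List (Strand c)} {f g : ℕ → ℤ}
    (h : ∀ j < a.length, f j = g j) : levelTotal i a f = levelTotal i a g := by
  induction a generalizing f g with
  | nil => rfl
  | cons e a ih =>
    simp only [levelTotal]
    rw [h 0 (by simp), ih fun j hj => h (j + 1) (by simpa using hj)]

lemma levelTotal_append (i : Fin c) (a a' : List (Strand c)) (f : ℕ → ℤ) :
    levelTotal i (a ++ a') f =
      levelTotal i a f + levelTotal i a' fun j => f (j + a.length) := by
  induction a generalizing f with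
  | nil => simp [levelTotal]
  | cons e a ih => simp [levelTotal, ih, add_assoc]

lemma levelTotal_shiftTwist (i : Fin c) (l a r : List (Strand c)) (f : ℕ → ℤ) :
    levelTotal i (l ++ a ++ r) (shiftTwist l.length a.length f) = levelTotal i a f := by
  have h1 : levelTotal i l (shiftTwist l.length a.length f) = levelTotal i l 0 :=
    levelTotal_congr i fun j hj => if_neg (by omega)
  have h2 : (levelTotal i r fun j => shiftTwist l.length a.length f (j + (l ++ a).length)) =
      levelTotal i r 0 :=
    levelTotal_congr i fun j hj => if_neg (by rw [List.length_append]; omega)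
  have h3 : (levelTotal i a fun j => shiftTwist l.length a.length f (j + l.length)) =
      levelTotal i a f :=
    levelTotal_congr i fun j hj => by
      rw [shiftTwist, if_pos (by omega), Nat.add_sub_cancel]
  rw [levelTotal_append, levelTotal_append, h1, h2, h3, levelTotal_zero, levelTotal_zero, zero_add,
    add_zero]

lemma levelTotal_single (i : Fin c) {a : List (Strand c)} {j : ℕ} {e : Strand c}
    (h : a[j]? = some e) (x : ℤ) :
    levelTotal i a (Pi.single j x) = if e.comp = i then x else 0 := by
  induction a generalizing j with
  | nil => simp at h
  | cons e' a ih =>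
    cases j with
    | zero =>
      obtain rfl : e' = e := by simpa using h
      have := levelTotal_congr i (a := a) (f := fun j => Pi.single (M := fun _ => ℤ) 0 x (j + 1))
        (g := 0) fun j _ => by simp
      simp only [levelTotal, this, levelTotal_zero, Pi.single_eq_same, add_zero]
    | succ j =>
      have h' := ih (j := j) (by simpa using h)
      have := levelTotal_congr i (a := a)
        (f := fun k => Pi.single (M := fun _ => ℤ) (j + 1) x (k + 1))
        (g := Pi.single j x) fun k _ => by simp [Pi.single_apply]
      simp [levelTotal, this, h']

lemma total_add (i : Fin c) (a : List (Strand c)) (w : List (Slice c)) (τ τ' : ℕ → ℕ → ℤ) :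
    total i a w (τ + τ') = total i a w τ + total i a w τ' := by
  induction w generalizing a τ τ' with
  | nil => exact levelTotal_add i a _ _
  | cons s w ih =>
    have := ih s.top (fun k => τ (k + 1)) (fun k => τ' (k + 1))
    simp only [total]
    rw [show (fun k => (τ + τ') (k + 1)) = (fun k => τ (k + 1)) + fun k => τ' (k + 1) from rfl,
      this, Pi.add_apply, levelTotal_add]
    ring

/-- The number of kinks on component `i`, as a homomorphism. -/
def totalHom (i : Fin c) (a : List (Strand c)) (w : List (Slice c)) : (ℕ → ℕ → ℤ) →+ ℤ :=
  AddMonoidHom.mk' (total i a w) (total_add i a w)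

lemma totalHom_apply (i : Fin c) (a : List (Strand c)) (w : List (Slice c)) (τ : ℕ → ℕ → ℤ) :
    totalHom i a w τ = total i a w τ := rfl

lemma total_zero (i : Fin c) (a : List (Strand c)) (w : List (Slice c)) : total i a w 0 = 0 :=
  map_zero (totalHom i a w)

lemma total_congr (i : Fin c) {a a' : List (Strand c)} {w : List (Slice c)} (hw : Runs a w a')
    {τ τ' : ℕ → ℕ → ℤ}
    (h : ∀ k s, w[k]? = some s → ∀ j < s.bot.length, τ k j = τ' k j)
    (h' : ∀ j < a'.length, τ w.length j = τ' w.length j) :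
    total i a w τ = total i a w τ' := by
  induction w generalizing a τ τ' with
  | nil => obtain rfl := hw; exact levelTotal_congr i h'
  | cons s w ih =>
    obtain ⟨rfl, hw⟩ := hw
    simp only [total]
    rw [levelTotal_congr i (h 0 s rfl), ih hw (fun k s' hs => h (k + 1) s' hs) h']

lemma total_atLevel_zero (i : Fin c) (a : List (Strand c)) (w : List (Slice c)) (f : ℕ → ℤ) :
    total i a w (atLevel 0 f) = levelTotal i a f := by
  cases w with
  | nil => rfl
  | cons s w =>
    simp only [total, atLevel_self]
    exact add_eq_left.2 (total_zero i s.top w)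

lemma total_shift (i : Fin c) (a : List (Strand c)) (s : Slice c) (w : List (Slice c))
    (f : ℕ → ℤ) (τ : ℕ → ℕ → ℤ) :
    total i a (s :: w) (consLevel f τ) = levelTotal i a f + total i s.top w τ := rfl

lemma total_atPoint (i : Fin c) {a a' : List (Strand c)} {w : List (Slice c)} (hw : Runs a w a')
    {k j : ℕ} {s : Slice c} (hs : w[k]? = some s) {e : Strand c} (he : s.bot[j]? = some e) (x : ℤ) :
    total i a w (atPoint (k, j) x) = if e.comp = i then x else 0 := by
  induction w generalizing a k with
  | nil => simp at hs
  | cons s' w ih =>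
    obtain ⟨rfl, hw⟩ := hw
    cases k with
    | zero =>
      obtain rfl : s' = s := by simpa using hs
      rw [atPoint, total_atLevel_zero, levelTotal_single i he]
    | succ k =>
      have := ih hw (k := k) (by simpa using hs)
      simp only [total, atPoint, atLevel_succ_zero, levelTotal_zero, zero_add,
        atLevel_succ_succ] at this ⊢
      exact this

lemma Occurs.exists_total {i : Fin c} {a : List (Strand c)} {w : List (Slice c)}
    (h : Occurs i a w) : ∃ τ, ∀ i', total i' a w τ = if i' = i then 1 else 0 := by
  have base {a : List (Strand c)} (w : List (Slice c)) (h : ∃ e ∈ a, e.comp = i) :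
      ∃ τ, ∀ i', total i' a w τ = if i' = i then 1 else 0 := by
    obtain ⟨e, he, rfl⟩ := h
    obtain ⟨j, hj⟩ := List.mem_iff_getElem?.1 he
    refine ⟨atLevel 0 (Pi.single j 1), fun i' => ?_⟩
    rw [total_atLevel_zero, levelTotal_single i' hj]
    simp only [eq_comm]
  induction w generalizing a with
  | nil =>
    rcases h with h | ⟨s, hs, -⟩
    · exact base _ h
    · simp at hs
  | cons s w ih =>
    rcases h with h | ⟨s', hs, h⟩
    · exact base _ h
    · have : Occurs i s.top w := by
        rcases List.mem_cons.1 hs with rfl | hs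
        · exact .inl h
        · exact .inr ⟨s', hs, h⟩
      obtain ⟨τ, hτ⟩ := ih this
      refine ⟨consLevel 0 τ, fun i' => ?_⟩
      rw [total_shift, levelTotal_zero, zero_add, hτ]

end Deco

/-! ### Moving kinks along a decorated diagram -/

section DecoPaths

variable {X : Type uX} {S : Type uS} {b : VirtualBirack X} {σ : Shadow b S} [Finite X] {c : ℕ}

lemma Slice.bot_ups (s : Slice c) :
    ups s.bot = ups s.left ++ s.piece.flat.bot ++ ups s.right := by
  simp [Slice.bot, Piece.bot_flat]

lemma Slice.top_ups (s : Slice c) :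
    ups s.top = ups s.left ++ s.piece.flat.top ++ ups s.right := by
  simp [Slice.top, Piece.top_flat]

lemma deco_congr {a a' : List (Strand c)} {w : List (Slice c)} (hw : Runs a w a')
    {τ τ' : ℕ → ℕ → ℤ}
    (h : ∀ k s, w[k]? = some s → ∀ j < s.bot.length, (τ k j : ZMod b.rank) = τ' k j)
    (h' : ∀ j < a'.length, (τ w.length j : ZMod b.rank) = τ' w.length j) :
    PathIso.{uX, uS, uG} σ (deco a w τ) (deco a w τ') := by
  induction w generalizing a τ τ' with
  | nil =>
    obtain rfl := hw
    exact .twist_congr _ (by simpa using h')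
  | cons s w ih =>
    obtain ⟨rfl, hw⟩ := hw
    exact (PathIso.twist_congr _ (by simpa using h 0 s rfl)).append
      ((ih hw (fun k s' hs => h (k + 1) s' hs) h').cons s.op)

lemma deco_add_atLevel_zero (a : List (Strand c)) (w : List (Slice c)) (τ : ℕ → ℕ → ℤ)
    (f : ℕ → ℤ) :
    PathIso.{uX, uS, uG} σ (deco a w (τ + atLevel 0 f)) (.twist (ups a) f :: deco a w τ) := by
  have key := (PathIso.twist_add (σ := σ) (ups a) f (τ 0)).symm
  rw [add_comm] at key
  cases w with
  | nil => exact key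
  | cons s w =>
    have : (fun k => (τ + atLevel 0 f) (k + 1)) = fun k => τ (k + 1) := by
      funext k; simp [atLevel_zero_succ]
    simp only [deco, this]
    exact key.append_right _

/-- Above every slice the zero twist is redundant. The one at the bottom has no slice below it and
is kept. -/
lemma deco_zero_cons (a : List (Strand c)) (w : List (Slice c)) (f : ℕ → ℤ) :
    PathIso.{uX, uS, uG} σ (deco a w (atLevel 0 f)) (.twist (ups a) f :: flat w) := by
  have step (s : Slice c) (w : List Op) :
      PathIso.{uX, uS, uG} σ (s.op :: .twist (ups s.top) 0 :: w) (s.op :: w) := by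
    rw [Slice.top_ups]
    exact (PathIso.slice_twist_zero _ _ _).append_right w
  induction w generalizing a f with
  | nil => exact .refl _
  | cons s w ih =>
    refine PathIso.cons _ (.trans ?_ (step s _))
    refine PathIso.cons _ ?_
    have := ih s.top 0
    rwa [atLevel_zero] at this

/-- Twists on a level add up, so the extra kinks `f` can be split off, moved through the slice and
merged with the twist already above it. -/
lemma deco_pass {a a' : List (Strand c)} {w : List (Slice c)} (hw : Runs a w a') {k : ℕ}
    {s : Slice c} (hk : w[k]? = some s) {f f' : ℕ → ℤ}
    (hf : Passes s.left.length s.piece.flat s.right.length f f') (τ : ℕ → ℕ → ℤ) :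
    PathIso.{uX, uS, uG} σ (deco a w (τ + atLevel k f)) (deco a w (τ + atLevel (k + 1) f')) := by
  induction w generalizing a k τ with
  | nil => simp at hk
  | cons s' w ih =>
    obtain ⟨rfl, hw⟩ := hw
    cases k with
    | zero =>
      obtain rfl : s' = s := by simpa using hk
      refine (deco_add_atLevel_zero _ _ _ _).trans ?_
      have h1 : PathIso.{uX, uS, uG} σ [.twist (ups s'.bot) f, s'.op]
          [s'.op, .twist (ups s'.top) f'] := by
        rw [Slice.bot_ups, Slice.top_ups]
        exact .twist_slice (by simpa [ups] using hf)
      have h2 : PathIso.{uX, uS, uG} σ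
          (.twist (ups s'.bot) f :: .twist (ups s'.bot) (τ 0) :: s'.op ::
            deco s'.top w fun k => τ (k + 1))
          (.twist (ups s'.bot) (τ 0) :: .twist (ups s'.bot) f :: s'.op ::
            deco s'.top w fun k => τ (k + 1)) := by
        have h3 := PathIso.twist_add.{uX, uS, uG} (σ := σ) (ups s'.bot) f (τ 0)
        rw [add_comm] at h3
        exact (h3.trans (PathIso.twist_add _ _ _).symm).append_right _
      refine h2.trans ?_
      have h4 := deco_add_atLevel_zero.{uX, uS, uG} (σ := σ) s'.top w (fun k => τ (k + 1)) f'
      have h5 : (fun k => τ (k + 1)) + atLevel 0 f' =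
          fun k => (τ + atLevel (0 + 1) f') (k + 1) := by
        funext k; simp [atLevel_succ_succ]
      rw [h5] at h4
      simp only [deco, Pi.add_apply, atLevel_succ_zero, add_zero] at h4 ⊢
      exact ((h1.append_right _).trans (h4.symm.cons _)).cons _
    | succ k =>
      have h1 := ih hw (k := k) (by simpa using hk) (fun k => τ (k + 1))
      have h2 (k : ℕ) (f : ℕ → ℤ) : (fun j => (τ + atLevel (k + 1) f) (j + 1)) =
          (fun k => τ (k + 1)) + atLevel k f := by
        funext j; simp [atLevel_succ_succ]
      simp only [deco, Pi.add_apply, atLevel_succ_zero, add_zero]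
      have h3 := h2 k f
      have h4 := h2 (k + 1) f'
      simp only [Pi.add_apply] at h3 h4
      rw [h3, h4]
      exact (h1.cons _).cons _

/-- The common level of the two words carries two twists, which merge into one; therefore the totals
add. -/
lemma deco_append {a a' : List (Strand c)} {w : List (Slice c)} (hw : Runs a w a')
    (w' : List (Slice c)) (τ₁ τ₂ : ℕ → ℕ → ℤ) :
    ∃ τ, PathIso.{uX, uS, uG} σ (deco a w τ₁ ++ deco a' w' τ₂) (deco a (w ++ w') τ) ∧
      ∀ i, total i a (w ++ w') τ = total i a w τ₁ + total i a' w' τ₂ := by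
  induction w generalizing a τ₁ with
  | nil =>
    obtain rfl := hw
    refine ⟨τ₂ + atLevel 0 (τ₁ 0), (deco_add_atLevel_zero _ _ _ _).symm, fun i => ?_⟩
    rw [List.nil_append, total_add, total_atLevel_zero, add_comm]
    rfl
  | cons s w ih =>
    obtain ⟨τ, h1, h2⟩ := ih hw.2 fun k => τ₁ (k + 1)
    refine ⟨consLevel (τ₁ 0) τ,
      (h1.cons s.op).cons (.twist (ups a) (τ₁ 0)), fun i => ?_⟩
    rw [List.cons_append, total_shift, h2, total, add_assoc]

/-- Kinks travel along a component: straight past other pieces, diagonally through crossings, and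
round extrema. -/
lemma deco_compGlue {a a' : List (Strand c)} {w : List (Slice c)} (hw : Runs a w a')
    {p q : ℕ × ℕ} (h : CompGlue w p q) (x : ℤ) (τ : ℕ → ℕ → ℤ) :
    PathIso.{uX, uS, uG} σ (deco a w (τ + atPoint p x)) (deco a w (τ + atPoint q x)) := by
  have hs₁ (k i j : ℕ) (x : ℤ) (τ : ℕ → ℕ → ℤ) :
      τ + atPoint (k, j) x + atLevel k (Pi.single i x - Pi.single j x) = τ + atPoint (k, i) x := by
    rw [add_assoc, atPoint, ← atLevel_add, add_sub_cancel, atPoint]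
  cases h with
  | arc p q h =>
    cases h with
    | left k i s hs hi =>
      refine deco_pass hw hs ⟨fun _ _ => rfl, fun j hj => ?_, ?_⟩ τ
      · rw [Pi.single_eq_of_ne (by simp; omega), Pi.single_eq_of_ne (by simp; omega)]
      · rcases s with ⟨l, p | p | p, r⟩ <;> simp only at hi <;>
          simp [Piece.flat, show l.length ≠ i by omega, show l.length + 1 ≠ i by omega]
    | right k i s hs hi =>
      refine deco_pass hw hs ⟨fun j hj => ?_, fun j hj => ?_, ?_⟩ τ
      · simp only [Pi.single_apply]
        split_ifs <;> omega
      · rw [Piece.bot_flat, Piece.top_flat, List.length_map, List.length_map]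
        simp only [Pi.single_apply]
        split_ifs <;> omega
      · rcases s with ⟨l, p | p | p, r⟩ <;>
          simp only [Piece.flat, Pi.single_apply, Piece.bot, Piece.top, List.length_cons,
            List.length_nil] <;> split_ifs <;> omega
    | cup k l r s hs =>
      -- Kinks `x` and `-x` on the two ends of a minimum amount to no kinks below it; added to `x`
      -- kinks on one end, they move these to the other.
      have h1 := deco_pass.{uX, uS, uG} (σ := σ) hw hs (f := 0)
        (f' := Pi.single l.length x - Pi.single (l.length + 1) x)
        ⟨fun j hj => ?_, fun j hj => ?_, ?_⟩ (τ + atPoint (k + 1, l.length + 1) x)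
      · rw [atLevel_zero, add_zero, hs₁] at h1
        exact h1.symm
      · dsimp only at hj
        simp only [Pi.single_apply, Pi.sub_apply, Pi.zero_apply]
        split_ifs <;> omega
      · simp only [Piece.flat, Pi.single_apply, FlatPiece.top, List.length_cons,
          List.length_nil, Pi.sub_apply, Pi.zero_apply]
        split_ifs <;> omega
      · simp [Piece.flat]
    | cap k l r s hs =>
      -- The same at a maximum, where opposite kinks on the two ends disappear above.
      have h1 := deco_pass.{uX, uS, uG} (σ := σ) hw hs (f' := 0)
        (f := Pi.single l.length x - Pi.single (l.length + 1) x)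
        ⟨fun j hj => ?_, fun j hj => ?_, ?_⟩ (τ + atPoint (k, l.length + 1) x)
      · rw [atLevel_zero, add_zero, hs₁] at h1
        exact h1
      · dsimp only at hj
        simp only [Pi.single_apply, Pi.sub_apply, Pi.zero_apply]
        split_ifs <;> omega
      · simp only [Piece.flat, Pi.single_apply, FlatPiece.bot, List.length_cons,
          List.length_nil, Pi.sub_apply, Pi.zero_apply]
        split_ifs <;> omega
      · simp [Piece.flat]
  | cross_left k l r κ sl sr hs =>
    refine deco_pass hw hs ⟨fun j hj => ?_, fun j hj => ?_, ?_⟩ τ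
    · dsimp only at hj
      simp only [Pi.single_apply]
      split_ifs <;> omega
    · simp only [Piece.flat, Pi.single_apply, FlatPiece.bot, FlatPiece.top, List.length_cons,
        List.length_nil]
      split_ifs <;> omega
    · simp [Piece.flat]
  | cross_right k l r κ sl sr hs =>
    refine deco_pass hw hs ⟨fun j hj => ?_, fun j hj => ?_, ?_⟩ τ
    · dsimp only at hj
      simp only [Pi.single_apply]
      split_ifs <;> omega
    · simp only [Piece.flat, Pi.single_apply, FlatPiece.bot, FlatPiece.top, List.length_cons,
        List.length_nil]
      split_ifs <;> omega
    · simp [Piece.flat]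

/-! ### Kinks on the same component -/

lemma Point.exists_slice {w : List (Slice c)} (p : Point w) :
    ∃ s, w[p.1.1]? = some s ∧ s.bot[p.1.2]? = some p.strand := by
  obtain ⟨⟨k, j⟩, h⟩ := p
  have hs : ∃ s, w[k]? = some s := by
    by_contra h'
    have h' : w[k]? = none := Option.eq_none_iff_forall_not_mem.2 fun s hs => h' ⟨s, hs⟩
    simp [level, h'] at h
  obtain ⟨s, hs⟩ := hs
  have hl : level w k = s.bot := by simp [level, hs]
  refine ⟨s, hs, ?_⟩
  rw [← hl]
  exact List.getElem?_eq_getElem h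

/-- Differences of decorations without influence on labelings. -/
def negligible (σ : Shadow b S) (w : List (Slice c)) : AddSubgroup (ℕ → ℕ → ℤ) where
  carrier := {ρ | (∀ τ, PathIso.{uX, uS, uG} σ (deco [] w (τ + ρ)) (deco [] w τ)) ∧
    ∀ i, total i [] w ρ = 0}
  zero_mem' := ⟨fun τ => by rw [add_zero]; exact .refl _, fun i => total_zero i _ _⟩
  add_mem' := fun {ρ ρ'} h h' => ⟨fun τ => by
      rw [← add_assoc]; exact (h'.1 _).trans (h.1 τ), fun i => by
      rw [total_add, h.2, h'.2, add_zero]⟩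
  neg_mem' := fun {ρ} h => ⟨fun τ => by
      simpa using (h.1 (τ + -ρ)).symm, fun i => by
      have := map_neg (totalHom i [] w) ρ
      rw [totalHom_apply, totalHom_apply, h.2, neg_zero] at this
      exact this⟩

/-- Equality of components is a chain of gluings, and kinks can be carried along each link of the
chain. -/
lemma negligible_of_glued {w : List (Slice c)} (hw : Runs [] w []) {p q : Point w}
    (h : p.component = q.component) (hi : p.strand.comp = q.strand.comp) (x : ℤ) :
    atPoint p.1 x - atPoint q.1 x ∈ negligible.{uX, uS, uG} σ w := by
  constructor
  · have key : ∀ p q : Point w, Relation.EqvGen (fun p q : Point w => CompGlue w p.1 q.1) p q →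
        ∀ τ, PathIso.{uX, uS, uG} σ (deco [] w (τ + atPoint p.1 x)) (deco [] w (τ + atPoint q.1 x)) := by
      intro p q h
      induction h with
      | rel p q h => exact deco_compGlue hw h x
      | refl p => exact fun τ => .refl _
      | symm p q _ ih => exact fun τ => (ih τ).symm
      | trans p q r _ _ ih ih' => exact fun τ => (ih τ).trans (ih' τ)
    intro τ
    have := key p q (Quot.eqvGen_exact h) (τ - atPoint q.1 x)
    rwa [sub_add_cancel, sub_add_eq_add_sub, add_sub_assoc] at this
  · intro i
    obtain ⟨s, hs, he⟩ := p.exists_slice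
    obtain ⟨s', hs', he'⟩ := q.exists_slice
    have := map_sub (totalHom i [] w) (atPoint p.1 x) (atPoint q.1 x)
    simp only [totalHom_apply] at this
    rw [this, total_atPoint i hw hs he, total_atPoint i hw hs' he', hi, sub_self]

lemma LinkDiagram.exists_point (D : LinkDiagram c) (i : Fin c) :
    ∃ p : Point D.slices, p.strand.comp = i := by
  obtain ⟨_, ⟨p, -, hp⟩, -⟩ := D.numbered i
  exact ⟨p, hp⟩

lemma LinkDiagram.component_eq (D : LinkDiagram c) {p q : Point D.slices}
    (h : p.strand.comp = q.strand.comp) : p.component = q.component := by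
  obtain ⟨C, -, hC⟩ := D.numbered q.strand.comp
  rw [hC _ ⟨p, rfl, h⟩, hC _ ⟨q, rfl, rfl⟩]

/-- A point on the component with number `i`. -/
def LinkDiagram.base (D : LinkDiagram c) (i : Fin c) : Point D.slices := (D.exists_point i).choose

lemma LinkDiagram.base_comp (D : LinkDiagram c) (i : Fin c) : (D.base i).strand.comp = i :=
  (D.exists_point i).choose_spec

/-- Put `x i` kinks on component `i`. -/
def LinkDiagram.spread (D : LinkDiagram c) (x : Fin c → ℤ) : ℕ → ℕ → ℤ :=
  ∑ i, atPoint (D.base i).1 (x i)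

lemma LinkDiagram.total_spread (D : LinkDiagram c) (x : Fin c → ℤ) (i : Fin c) :
    total i [] D.slices (D.spread x) = x i := by
  rw [← totalHom_apply, spread, map_sum]
  have h (j : Fin c) : totalHom i [] D.slices (atPoint (D.base j).1 (x j)) =
      if j = i then x j else 0 := by
    obtain ⟨s, hs, he⟩ := (D.base j).exists_slice
    rw [totalHom_apply, total_atPoint i D.closed hs he, D.base_comp]
  simp [h]

/-- Up to values at places where there is no strand, a decoration is a finite sum of kinks at
points, and the kinks at each point can be carried to the base point of its component. -/
lemma LinkDiagram.exists_spread (D : LinkDiagram c) (τ : ℕ → ℕ → ℤ) :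
    ∃ x, τ - D.spread x ∈ negligible.{uX, uS, uG} σ D.slices := by
  have hadd {τ τ' : ℕ → ℕ → ℤ}
      (h : ∃ x, τ - D.spread x ∈ negligible.{uX, uS, uG} σ D.slices)
      (h' : ∃ x, τ' - D.spread x ∈ negligible.{uX, uS, uG} σ D.slices) :
      ∃ x, τ + τ' - D.spread x ∈ negligible.{uX, uS, uG} σ D.slices := by
    obtain ⟨x, h⟩ := h
    obtain ⟨x', h'⟩ := h'
    refine ⟨x + x', ?_⟩
    have e : D.spread (x + x') = D.spread x + D.spread x' := by
      simp only [spread, Pi.add_apply, atPoint_add, Finset.sum_add_distrib]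
    rw [e, add_sub_add_comm]
    exact add_mem h h'
  have hzero : ∃ x, (0 : ℕ → ℕ → ℤ) - D.spread x ∈ negligible.{uX, uS, uG} σ D.slices := by
    refine ⟨0, ?_⟩
    have e : D.spread 0 = 0 := by
      refine Finset.sum_eq_zero fun i _ => ?_
      rw [atPoint, Pi.zero_apply, Pi.single_zero, atLevel_zero]
    rw [e, sub_zero]
    exact zero_mem _
  have hpoint (p : Point D.slices) (y : ℤ) :
      ∃ x, atPoint p.1 y - D.spread x ∈ negligible.{uX, uS, uG} σ D.slices := by
    refine ⟨Pi.single p.strand.comp y, ?_⟩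
    have e : D.spread (Pi.single p.strand.comp y) = atPoint (D.base p.strand.comp).1 y := by
      refine (Finset.sum_eq_single p.strand.comp (fun i _ hi => ?_) (by simp)).trans (by simp)
      rw [Pi.single_eq_of_ne hi, atPoint, Pi.single_zero, atLevel_zero]
    rw [e]
    exact negligible_of_glued D.closed (D.component_eq (D.base_comp _).symm) (D.base_comp _).symm y
  have hsum : ∃ x, (∑ k ∈ Finset.range D.slices.length,
      ∑ j ∈ Finset.range (level D.slices k).length, atPoint (k, j) (τ k j)) - D.spread x ∈
        negligible.{uX, uS, uG} σ D.slices := by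
    refine Finset.sum_induction _
      (fun τ => ∃ x, τ - D.spread x ∈ negligible.{uX, uS, uG} σ D.slices)
      (fun _ _ => hadd) hzero fun k _ => Finset.sum_induction _
        (fun τ => ∃ x, τ - D.spread x ∈ negligible.{uX, uS, uG} σ D.slices)
        (fun _ _ => hadd) hzero fun j hj => ?_
    exact hpoint ⟨(k, j), Finset.mem_range.1 hj⟩ _
  set τ' := ∑ k ∈ Finset.range D.slices.length,
      ∑ j ∈ Finset.range (level D.slices k).length, atPoint (k, j) (τ k j) with hτ'
  have hval (k : ℕ) (s : Slice c) (hs : D.slices[k]? = some s) (j : ℕ) (hj : j < s.bot.length) :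
      (τ - τ') k j = 0 := by
    have hk : k < D.slices.length := by
      by_contra h
      rw [List.getElem?_eq_none (by omega)] at hs
      simp at hs
    have hl : level D.slices k = s.bot := by simp [level, hs]
    rw [Pi.sub_apply, Pi.sub_apply, sub_eq_zero, hτ']
    simp only [Finset.sum_apply, atPoint_apply, Prod.mk.injEq]
    rw [Finset.sum_eq_single_of_mem k (by simpa using hk), Finset.sum_eq_single_of_mem j]
    · simp
    · simpa [hl] using hj
    · intro j' _ hj'; simp [hj'.symm]
    · intro k' _ hk'; simp [hk'.symm]
  -- `τ - τ'` vanishes at every actual point, so it influences neither labelings nor totals.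
  have hdiff : ∃ x, (τ - τ') - D.spread x ∈ negligible.{uX, uS, uG} σ D.slices := by
    obtain ⟨x, hx⟩ := hzero
    refine ⟨x, ?_⟩
    rw [← zero_add (τ - τ'), add_sub_right_comm]
    refine add_mem hx ⟨fun ρ => deco_congr D.closed (fun k s hs j hj => ?_) (by simp), fun i => ?_⟩
    · rw [Pi.add_apply, Pi.add_apply, hval k s hs j hj, add_zero]
    · rw [total_congr i D.closed (τ' := 0) (fun k s hs j hj => hval k s hs j hj) (by simp),
        total_zero]
  have := hadd hdiff hsum
  rwa [sub_add_cancel] at this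

/-- Only the number of kinks on each component matters. -/
lemma LinkDiagram.deco_iso_of_total_eq (D : LinkDiagram c) {τ τ' : ℕ → ℕ → ℤ}
    (h : ∀ i, total i [] D.slices τ = total i [] D.slices τ') :
    PathIso.{uX, uS, uG} σ (deco [] D.slices τ) (deco [] D.slices τ') := by
  obtain ⟨x, hx⟩ := D.exists_spread (σ := σ) (τ - τ')
  have hsub (τ τ' : ℕ → ℕ → ℤ) (i : Fin c) : total i [] D.slices (τ - τ') =
      total i [] D.slices τ - total i [] D.slices τ' := map_sub (totalHom i [] D.slices) τ τ'
  have e : D.spread x = 0 := by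
    have : x = 0 := by
      funext i
      have := hx.2 i
      rw [hsub, hsub, h i, sub_self, D.total_spread, zero_sub, neg_eq_zero] at this
      exact this
    subst this
    refine Finset.sum_eq_zero fun i _ => ?_
    rw [atPoint, Pi.zero_apply, Pi.single_zero, atLevel_zero]
  rw [e, sub_zero] at hx
  have := hx.1 τ'
  rwa [add_sub_cancel] at this

end DecoPaths

/-! ## Isotopic diagrams -/

section Writhe

variable {c : ℕ}

lemma wordWrithe_append (i : Fin c) (w w' : List (Slice c)) :
    wordWrithe i (w ++ w') = wordWrithe i w + wordWrithe i w' := by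
  simp [wordWrithe]

lemma wordWrithe_widen (i : Fin c) (l r : List (Strand c)) (w : List (Slice c)) :
    wordWrithe i (widen l r w) = wordWrithe i w := by
  simp [wordWrithe, widen, Function.comp_def]

lemma LinkDiagram.writhe_eq_wordWrithe (D : LinkDiagram c) (i : Fin c) :
    D.writhe i = wordWrithe i D.slices := rfl

end Writhe

/-! ### Matching decorated diagrams with equal framings -/

section Linked

variable {X : Type uX} {S : Type uS} {b : VirtualBirack X} (σ : Shadow b S) [Finite X] {c : ℕ}

/-- Decorations of `D` and `E` with the same framings correspond to each other, component `i` of `D`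
becoming component `π i` of `E`. -/
def Linked (π : Equiv.Perm (Fin c)) (D E : LinkDiagram c) : Prop :=
  ∀ τ τ', (∀ i, total (π i) [] E.slices τ' + E.writhe (π i) = total i [] D.slices τ + D.writhe i) →
    PathIso.{uX, uS, uG} σ (deco [] D.slices τ) (deco [] E.slices τ')

variable {σ}

/-- On each diagram only the totals of a decoration matter, so one matching pair of decorations for
every vector of totals suffices. -/
lemma Linked.of_exists {π : Equiv.Perm (Fin c)} {D E : LinkDiagram c}
    (h : ∀ x : Fin c → ℤ, ∃ τ τ', (∀ i, total i [] D.slices τ = x i) ∧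
      (∀ i, total (π i) [] E.slices τ' = x i + D.writhe i - E.writhe (π i)) ∧
      PathIso.{uX, uS, uG} σ (deco [] D.slices τ) (deco [] E.slices τ')) :
    Linked.{uX, uS, uG} σ π D E := by
  intro τ τ' hτ
  obtain ⟨ρ, ρ', h1, h2, h3⟩ := h fun i => total i [] D.slices τ
  refine (D.deco_iso_of_total_eq fun i => (h1 i).symm).trans
    (h3.trans (E.deco_iso_of_total_eq fun i => ?_))
  obtain ⟨i, rfl⟩ := π.surjective i
  rw [h2, ← hτ i, add_sub_cancel_right]

lemma Linked.refl (D : LinkDiagram c) : Linked.{uX, uS, uG} σ 1 D D := fun _ _ h =>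
  D.deco_iso_of_total_eq fun i => by simpa using (h i).symm

lemma Linked.symm {π : Equiv.Perm (Fin c)} {D E : LinkDiagram c}
    (h : Linked.{uX, uS, uG} σ π D E) : Linked.{uX, uS, uG} σ π⁻¹ E D := fun τ τ' hτ =>
  (h τ' τ fun i => by simpa using (hτ (π i)).symm).symm

lemma Linked.trans {π π' : Equiv.Perm (Fin c)} {D E F : LinkDiagram c}
    (h : Linked.{uX, uS, uG} σ π D E) (h' : Linked.{uX, uS, uG} σ π' E F) :
    Linked.{uX, uS, uG} σ (π' * π) D F := by
  intro τ τ' hτ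
  -- The intermediate decoration must give `E` the common framing; any vector of totals can be
  -- realized.
  let ρ := E.spread fun i => total (π' i) [] F.slices τ' + F.writhe (π' i) - E.writhe i
  have hρ (i : Fin c) : total i [] E.slices ρ =
      total (π' i) [] F.slices τ' + F.writhe (π' i) - E.writhe i := E.total_spread _ i
  refine (h τ ρ fun i => ?_).trans (h' ρ τ' fun i => ?_)
  · rw [hρ, sub_add_cancel, ← hτ i, Equiv.Perm.mul_apply]
  · rw [hρ, sub_add_cancel]

/-- Every component meets the part of the diagram below or above the moved stack, including the
levels that bound it. So any prescribed numbers of kinks can be placed there, where the move does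
not see them. -/
lemma MoveStep.exists_total {u m v : List (Slice c)} {l r : List (Strand c)} {m' : List (Slice c)}
    {D : LinkDiagram c} (hm : LocalMove m m') (hD : D.slices = u ++ widen l r m ++ v)
    {a a' : List (Strand c)} (hu : Runs [] u (l ++ a ++ r)) (hr : Runs a m a')
    (x : Fin c → ℤ) :
    ∃ τ τ', ∀ i, total i [] u τ + total i (l ++ a' ++ r) v τ' = x i := by
  have key (i : Fin c) : ∃ τ τ', ∀ i', total i' [] u τ + total i' (l ++ a' ++ r) v τ' =
      if i' = i then 1 else 0 := by
    suffices h : Occurs i [] u ∨ Occurs i (l ++ a' ++ r) v by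
      rcases h with h | h
      · obtain ⟨τ, hτ⟩ := h.exists_total
        exact ⟨τ, 0, fun i' => by rw [hτ, total_zero, add_zero]⟩
      · obtain ⟨τ, hτ⟩ := h.exists_total
        exact ⟨0, τ, fun i' => by rw [hτ, total_zero, zero_add]⟩
    obtain ⟨p, hp⟩ := D.exists_point i
    obtain ⟨s, hs, he⟩ := p.exists_slice
    have h := D.closed.occurs_of_mem_bot (List.mem_of_getElem? hs) (List.mem_of_getElem? he) hp
    rw [hD] at h
    rcases h with ⟨e, he, -⟩ | ⟨s, hs, e, he, rfl⟩
    · simp at he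
    · simp only [List.append_assoc, List.mem_append] at hs
      rcases hs with hs | hs | hs
      · exact .inl (.inr ⟨s, hs, e, he, rfl⟩)
      · obtain ⟨s, hsm, rfl⟩ := List.mem_map.1 hs
        simp only [Slice.top, List.append_assoc, List.mem_append] at he
        have he' : e ∈ l ∨ e ∈ s.top ∨ e ∈ r := by
          simp only [Slice.top, List.append_assoc, List.mem_append]; tauto
        rcases he' with he | he | he
        · exact .inr (.inl ⟨e, by simp [he], rfl⟩)
        · rcases hm.occurs hr hsm he with ⟨e', h, h'⟩ | ⟨e', h, h'⟩
          · exact .inl (hu.occurs_of_mem_top (by simp [h]) h')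
          · exact .inr (.inl ⟨e', by simp [h], h'⟩)
        · exact .inr (.inl ⟨e, by simp [he], rfl⟩)
      · exact .inr (.inr ⟨s, hs, e, he, rfl⟩)
  choose τ τ' h using key
  refine ⟨∑ i, x i • τ i, ∑ i, x i • τ' i, fun i => ?_⟩
  rw [← totalHom_apply, ← totalHom_apply, map_sum, map_sum, ← Finset.sum_add_distrib]
  simp_rw [map_zsmul, ← smul_add, totalHom_apply, h]
  simp

/-- With all other kinks outside, the move exchanges the stacks at the cost of the compensating
twist. That twist makes up exactly for the change of writhe, so the framings agree. -/
lemma MoveStep.linked {D E : LinkDiagram c} (h : MoveStep D E) : Linked.{uX, uS, uG} σ 1 D E := by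
  obtain ⟨u, v, l, r, m, m', hm, hD, hE⟩ := h
  obtain ⟨a, a', f, hne, hr, hr', hrep, hf⟩ := hm.replaces.{uX, uS, uG} σ
  have hcl := D.closed
  rw [hD, runs_append] at hcl
  obtain ⟨t', h1, hv⟩ := hcl
  obtain ⟨t, hu, hm'⟩ := runs_append.1 h1
  obtain rfl := hm'.bot_unique (by simpa [widen] using hne) (hr.widen l r)
  obtain rfl := hm'.top_unique (hr.widen l r)
  refine .of_exists fun x => ?_
  obtain ⟨τu, τv, hx⟩ := MoveStep.exists_total hm hD hu hr x
  have split (n : List (Slice c)) (hn : Runs (l ++ a ++ r) (widen l r n) (l ++ a' ++ r))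
      (g : ℕ → ℤ) : ∃ τ, PathIso.{uX, uS, uG} σ (deco [] u τu ++
        (.twist (ups (l ++ a ++ r)) g :: flat (widen l r n)) ++ deco (l ++ a' ++ r) v τv)
        (deco [] (u ++ widen l r n ++ v) τ) ∧
        ∀ i, total i [] (u ++ widen l r n ++ v) τ = x i + levelTotal i (l ++ a ++ r) g := by
    obtain ⟨τ₁, e1, e2⟩ := deco_append.{uX, uS, uG} (σ := σ) hu (widen l r n) τu (atLevel 0 g)
    obtain ⟨τ, e3, e4⟩ := deco_append.{uX, uS, uG} (σ := σ) (runs_append.2 ⟨_, hu, hn⟩) v τ₁ τv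
    refine ⟨τ, ?_, fun i => ?_⟩
    · exact (PathIso.append_right _ ((PathIso.append_left _
        (deco_zero_cons _ _ _).symm).trans e1)).trans e3
    · rw [e4, e2, total_atLevel_zero, ← hx i]; ring
  -- The same outer kinks are used before and after the move; only the twist at the bottom of the
  -- moved stack differs.
  obtain ⟨τ, e1, e2⟩ := split m (hr.widen l r) 0
  obtain ⟨τ', e3, e4⟩ := split m' (hr'.widen l r) (shiftTwist l.length a.length f)
  rw [hD, hE]
  refine ⟨τ, τ', fun i => ?_, fun i => ?_, e1.symm.trans (.trans ?_ e3)⟩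
  · rw [e2, levelTotal_zero, add_zero]
  · rw [Equiv.Perm.one_apply, e4, levelTotal_shiftTwist, hf, D.writhe_eq_wordWrithe,
      E.writhe_eq_wordWrithe, hD, hE]
    simp only [wordWrithe_append, wordWrithe_widen]
    ring
  · refine PathIso.append_right _ (PathIso.append_left _ ?_)
    have := hrep.pathIso (ups l) (ups r)
    simpa [flat_widen] using this

lemma levelTotal_renumber (π : Equiv.Perm (Fin c)) (i : Fin c) (a : List (Strand c)) (f : ℕ → ℤ) :
    levelTotal (π i) (a.map (Strand.renumber π)) f = levelTotal i a f := by
  induction a generalizing f with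
  | nil => rfl
  | cons e a ih => simp [levelTotal, ih, Strand.renumber]

lemma ups_renumber (π : Equiv.Perm (Fin c)) (a : List (Strand c)) :
    ups (a.map (Strand.renumber π)) = ups a := by
  simp [Strand.renumber, Function.comp_def]

lemma Piece.renumber_top (π : Equiv.Perm (Fin c)) (p : Piece c) :
    (p.renumber π).top = p.top.map (Strand.renumber π) := by cases p <;> rfl

lemma Slice.renumber_top (π : Equiv.Perm (Fin c)) (s : Slice c) :
    (s.renumber π).top = s.top.map (Strand.renumber π) := by
  simp [Slice.top, Slice.renumber, Piece.renumber_top]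

lemma Slice.renumber_op (π : Equiv.Perm (Fin c)) (s : Slice c) : (s.renumber π).op = s.op := by
  have : (s.piece.renumber π).flat = s.piece.flat := by cases s.piece <;> rfl
  simp [Slice.op, Slice.renumber, this, Strand.renumber, Function.comp_def]

lemma deco_renumber (π : Equiv.Perm (Fin c)) (a : List (Strand c)) (w : List (Slice c))
    (τ : ℕ → ℕ → ℤ) :
    deco (a.map (Strand.renumber π)) (w.map (Slice.renumber π)) τ = deco a w τ := by
  induction w generalizing a τ with
  | nil => simp only [List.map_nil, deco, ups_renumber]
  | cons s w ih =>
    simp only [List.map_cons, deco, ups_renumber, Slice.renumber_op, Slice.renumber_top, ih]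

lemma total_renumber (π : Equiv.Perm (Fin c)) (i : Fin c) (a : List (Strand c))
    (w : List (Slice c)) (τ : ℕ → ℕ → ℤ) :
    total (π i) (a.map (Strand.renumber π)) (w.map (Slice.renumber π)) τ = total i a w τ := by
  induction w generalizing a τ with
  | nil => simp only [List.map_nil, total, levelTotal_renumber]
  | cons s w ih =>
    simp only [List.map_cons, total, levelTotal_renumber, Slice.renumber_top, ih]

lemma Piece.writhe_renumber (π : Equiv.Perm (Fin c)) (i : Fin c) (p : Piece c) :
    (p.renumber π).writhe (π i) = p.writhe i := by
  cases p <;> simp [Piece.renumber, Piece.writhe, Strand.renumber, crossSign_eq]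

lemma linked_renumber {D E : LinkDiagram c} (π : Equiv.Perm (Fin c))
    (h : E.slices = D.slices.map (Slice.renumber π)) : Linked.{uX, uS, uG} σ π D E := by
  have hw (i : Fin c) : E.writhe (π i) = D.writhe i := by
    simp [LinkDiagram.writhe, h, Function.comp_def, Slice.renumber, Piece.writhe_renumber]
  have ht (i : Fin c) (τ : ℕ → ℕ → ℤ) : total (π i) [] E.slices τ = total i [] D.slices τ := by
    rw [h]; exact total_renumber π i [] D.slices τ
  have hd (τ : ℕ → ℕ → ℤ) : deco [] E.slices τ = deco [] D.slices τ := by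
    rw [h]; exact deco_renumber π [] D.slices τ
  refine .of_exists fun x => ⟨D.spread x, D.spread x, D.total_spread x, fun i => ?_, ?_⟩
  · rw [ht, D.total_spread, hw, add_sub_cancel_right]
  · rw [hd]; exact .refl _

lemma NumberedIsotopic.linked {D E : LinkDiagram c} (h : NumberedIsotopic D E) :
    Linked.{uX, uS, uG} σ 1 D E := by
  induction h with
  | rel D E h => exact h.linked
  | refl D => exact .refl D
  | symm D E _ h => simpa using h.symm
  | trans D E F _ _ h h' => simpa using h.trans h'

variable (σ) in
lemma VirtuallyIsotopic.exists_linked {D E : LinkDiagram c} (h : VirtuallyIsotopic D E) :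
    ∃ π, Linked.{uX, uS, uG} σ π D E := by
  induction h with
  | rel D E h =>
    rcases h with h | ⟨π, h⟩
    · exact ⟨1, h.linked⟩
    · exact ⟨π, linked_renumber π h⟩
  | refl D => exact ⟨1, .refl D⟩
  | symm D E _ h => obtain ⟨π, h⟩ := h; exact ⟨_, h.symm⟩
  | trans D E F _ _ h h' =>
    obtain ⟨π, h⟩ := h
    obtain ⟨π', h'⟩ := h'
    exact ⟨_, h.trans h'⟩

/-- Diagrams with the same framings modulo the rank have the same labelings. -/
lemma Linked.pathIso {π : Equiv.Perm (Fin c)} {D E : LinkDiagram c}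
    (h : Linked.{uX, uS, uG} σ π D E)
    (hw : ∀ i, (E.writhe (π i) : ZMod b.rank) = D.writhe i) :
    PathIso.{uX, uS, uG} σ (deco [] D.slices 0) (deco [] E.slices 0) := by
  have hdvd (i : Fin c) : ∃ y, D.writhe (π⁻¹ i) = E.writhe i + b.rank * y := by
    have := hw (π⁻¹ i)
    rw [show π (π⁻¹ i) = i from π.apply_symm_apply i] at this
    obtain ⟨y, hy⟩ := (ZMod.intCast_eq_intCast_iff_dvd_sub _ _ _).1 this
    exact ⟨y, by linarith⟩
  choose y hy using hdvd
  have e (i : Fin c) : total i [] E.slices ((b.rank : ℤ) • E.spread y) = b.rank * y i := by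
    have := map_zsmul (totalHom i [] E.slices) (b.rank : ℤ) (E.spread y)
    rw [totalHom_apply, totalHom_apply, E.total_spread] at this
    simpa using this
  -- The missing framing of `E` is a multiple of the rank on each component. It is supplied by kinks
  -- in multiples of the rank at the base points, which act trivially.
  refine (h 0 ((b.rank : ℤ) • E.spread y) fun i => ?_).trans
    (deco_congr E.closed (fun k s _ j _ => by simp) (by simp))
  have e2 := hy (π i)
  rw [show π⁻¹ (π i) = i from π.symm_apply_apply i] at e2
  rw [e, total_zero, e2]
  ring

end Linked

/-! ## Diagrams with prescribed writhe -/

section Points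

variable {c : ℕ} {w : List (Slice c)}

lemma level_of_getElem? {k : ℕ} {s : Slice c} (h : w[k]? = some s) : level w k = s.bot := by
  simp [level, h]

lemma level_succ {a : List (Strand c)} (hw : Runs a w []) {k : ℕ} {s : Slice c}
    (h : w[k]? = some s) : level w (k + 1) = s.top := by
  induction w generalizing a k with
  | nil => simp at h
  | cons s' w ih =>
    cases k with
    | zero =>
      obtain rfl : s' = s := by simpa using h
      cases w with
      | nil => exact hw.2.symm
      | cons s w => exact hw.2.1
    | succ k => exact ih hw.2 (by simpa using h)

variable (w) in
/-- Two points on the same component. -/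
def SameComp (p q : ℕ × ℕ) : Prop :=
  ∃ (hp : p.2 < (level w p.1).length) (hq : q.2 < (level w q.1).length),
    Point.component (w := w) ⟨p, hp⟩ = Point.component (w := w) ⟨q, hq⟩

lemma SameComp.symm {p q : ℕ × ℕ} (h : SameComp w p q) : SameComp w q p := by
  obtain ⟨hp, hq, h⟩ := h; exact ⟨hq, hp, h.symm⟩

lemma SameComp.trans {p q r : ℕ × ℕ} (h : SameComp w p q) (h' : SameComp w q r) :
    SameComp w p r := by
  obtain ⟨hp, hq, h⟩ := h
  obtain ⟨hq', hr, h'⟩ := h'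
  exact ⟨hp, hr, h.trans h'⟩

lemma CompGlue.sameComp {a : List (Strand c)} (hw : Runs a w []) {p q : ℕ × ℕ}
    (h : CompGlue w p q) : SameComp w p q := by
  suffices hpq : p.2 < (level w p.1).length ∧ q.2 < (level w q.1).length from
    ⟨hpq.1, hpq.2, Quot.sound h⟩
  cases h with
  | arc p q h =>
    cases h with
    | left k i s hs hi =>
      simp only [level_of_getElem? hs, level_succ hw hs, Slice.bot, Slice.top, List.length_append]
      omega
    | right k i s hs hi =>
      simp only [level_of_getElem? hs, level_succ hw hs, Slice.bot, Slice.top, List.length_append]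
      omega
    | cup k l r s hs => simp [level_succ hw hs, Slice.top, Piece.top]
    | cap k l r s hs => simp [level_of_getElem? hs, Slice.bot, Piece.bot]
  | cross_left k l r κ sl sr hs =>
    simp [level_of_getElem? hs, level_succ hw hs, Slice.bot, Slice.top, Piece.bot, Piece.top]
  | cross_right k l r κ sl sr hs =>
    simp [level_of_getElem? hs, level_succ hw hs, Slice.bot, Slice.top, Piece.bot, Piece.top]

/-- Points are glued along a slice, whatever its position. -/
lemma CompGlue.exists_slice {p q : ℕ × ℕ} (h : CompGlue w p q) :
    ∃ k s d d', w[k]? = some s ∧ d ≤ 1 ∧ d' ≤ 1 ∧ p.1 = k + d ∧ q.1 = k + d' ∧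
      ∀ (w' : List (Slice c)) (k' : ℕ), w'[k']? = some s →
        CompGlue w' (k' + d, p.2) (k' + d', q.2) := by
  cases h with
  | arc p q h =>
    cases h with
    | left k i s hs hi =>
      exact ⟨k, s, 0, 1, hs, by simp, le_rfl, rfl, rfl, fun w' k' h => .arc _ _ (.left k' i s h hi)⟩
    | right k i s hs hi =>
      exact ⟨k, s, 0, 1, hs, by simp, le_rfl, rfl, rfl,
        fun w' k' h => .arc _ _ (.right k' i s h hi)⟩
    | cup k l r s hs =>
      exact ⟨k, _, 1, 1, hs, le_rfl, le_rfl, rfl, rfl, fun w' k' h => .arc _ _ (.cup k' l r s h)⟩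
    | cap k l r s hs =>
      exact ⟨k, _, 0, 0, hs, by simp, by simp, rfl, rfl,
        fun w' k' h => .arc _ _ (.cap k' l r s h)⟩
  | cross_left k l r κ sl sr hs =>
    exact ⟨k, _, 0, 1, hs, by simp, le_rfl, rfl, rfl, fun w' k' h => .cross_left k' l r κ sl sr h⟩
  | cross_right k l r κ sl sr hs =>
    exact ⟨k, _, 0, 1, hs, by simp, le_rfl, rfl, rfl, fun w' k' h => .cross_right k' l r κ sl sr h⟩

end Points

/-! ### Inserting kinks without changing the components -/

section Kink

variable {c : ℕ}

/-- A positive kink on a strand. -/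
def kinkSlices (e : Strand c) : List (Slice c) :=
  [⟨[e], .cup e, []⟩, ⟨[], .cross .above e e, [e.rev]⟩, ⟨[e], .cap e, []⟩]

lemma runs_kinkSlices (e : Strand c) : Runs [e] (kinkSlices e) [e] := by
  simp [kinkSlices, Runs, Slice.bot, Slice.top, Piece.bot, Piece.top]

variable {u v : List (Slice c)} {l r : List (Strand c)} {e : Strand c}

lemma getElem?_kink_low {k : ℕ} (hk : k < u.length) :
    (u ++ widen l r (kinkSlices e) ++ v)[k]? = (u ++ v)[k]? := by
  rw [List.append_assoc, List.getElem?_append_left hk, List.getElem?_append_left hk]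

lemma getElem?_kink_high {k : ℕ} (hk : u.length ≤ k) :
    (u ++ widen l r (kinkSlices e) ++ v)[k + 3]? = (u ++ v)[k]? := by
  have : (widen l r (kinkSlices e)).length = 3 := rfl
  rw [List.getElem?_append_right (by rw [List.length_append]; omega),
    List.getElem?_append_right hk, List.length_append]
  congr 1
  omega

lemma getElem?_kink_mid (k : ℕ) :
    (u ++ widen l r (kinkSlices e) ++ v)[u.length + k]? =
      (widen l r (kinkSlices e) ++ v)[k]? := by
  rw [List.append_assoc, List.getElem?_append_right (by omega), Nat.add_sub_cancel_left]

/-- The position of a point after the insertion of a kink above level number `n`. -/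
def liftPoint (n : ℕ) (p : ℕ × ℕ) : ℕ × ℕ := if p.1 < n then p else (p.1 + 3, p.2)

lemma level_kink_lift (p : ℕ × ℕ) :
    level (u ++ widen l r (kinkSlices e) ++ v) (liftPoint u.length p).1 = level (u ++ v) p.1 := by
  unfold liftPoint level
  split_ifs with h
  · rw [getElem?_kink_low h]
  · simp only
    rw [getElem?_kink_high (by omega)]

lemma liftPoint_snd (n : ℕ) (p : ℕ × ℕ) : (liftPoint n p).2 = p.2 := by
  unfold liftPoint; split_ifs <;> rfl

lemma widen_kinkSlices : widen l r (kinkSlices e) = [⟨l ++ [e], .cup e, r⟩,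
    ⟨l, .cross .above e e, e.rev :: r⟩, ⟨l ++ [e], .cap e, r⟩] := by
  simp [widen, kinkSlices]

/-- The strand below an inserted kink that continues to strand `j` of a level inside the kink. -/
def kinkStrand (n j : ℕ) : ℕ := if j < n then j else if j ≤ n + 2 then n else j - 2

/-- Inside the kink three strands belong to the kinked component and all others run straight past.
Below, the families A, B, C pass the minimum, the crossing and the maximum; D goes round the extrema
and X across the crossing. -/
lemma sameComp_kink {a : List (Strand c)}
    (hw : Runs a (u ++ widen l r (kinkSlices e) ++ v) []) :
    (∀ j < l.length + 1 + r.length, SameComp (u ++ widen l r (kinkSlices e) ++ v) (u.length, j)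
      (u.length + 3, j)) ∧
    ∀ j < l.length + 3 + r.length,
      SameComp (u ++ widen l r (kinkSlices e) ++ v) (u.length + 1, j)
        (u.length, kinkStrand l.length j) ∧
      SameComp (u ++ widen l r (kinkSlices e) ++ v) (u.length + 2, j)
        (u.length, kinkStrand l.length j) := by
  set E := u ++ widen l r (kinkSlices e) ++ v with hE
  set n := u.length with hn
  have h0 : E[n]? = some ⟨l ++ [e], .cup e, r⟩ := by
    have := getElem?_kink_mid (u := u) (v := v) (l := l) (r := r) (e := e) 0
    rw [hE, hn]
    rw [widen_kinkSlices] at this ⊢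
    exact this
  have h1 : E[n + 1]? = some ⟨l, .cross .above e e, e.rev :: r⟩ := by
    rw [hE, getElem?_kink_mid, widen_kinkSlices]; rfl
  have h2 : E[n + 2]? = some ⟨l ++ [e], .cap e, r⟩ := by
    rw [hE, getElem?_kink_mid, widen_kinkSlices]; rfl
  have A1 (j : ℕ) (hj : j ≤ l.length) : SameComp E (n, j) (n + 1, j) :=
    CompGlue.sameComp hw (.arc _ _ (.left n j _ h0 (by simp; omega)))
  have A2 (i : ℕ) (hi : i < r.length) :
      SameComp E (n, l.length + 1 + i) (n + 1, l.length + 3 + i) := by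
    have := CompGlue.sameComp hw (.arc _ _ (.right n i _ h0 hi))
    simpa [Piece.bot, Piece.top, add_assoc] using this
  have B1 (j : ℕ) (hj : j < l.length) : SameComp E (n + 1, j) (n + 2, j) :=
    CompGlue.sameComp hw (.arc _ _ (.left (n + 1) j _ h1 hj))
  have B2 (i : ℕ) (hi : i < r.length + 1) :
      SameComp E (n + 1, l.length + 2 + i) (n + 2, l.length + 2 + i) :=
    CompGlue.sameComp hw (.arc _ _ (.right (n + 1) i _ h1 (by simpa using hi)))
  have C1 (j : ℕ) (hj : j ≤ l.length) : SameComp E (n + 2, j) (n + 3, j) :=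
    CompGlue.sameComp hw (.arc _ _ (.left (n + 2) j _ h2 (by simp; omega)))
  have C2 (i : ℕ) (hi : i < r.length) :
      SameComp E (n + 2, l.length + 3 + i) (n + 3, l.length + 1 + i) := by
    have := CompGlue.sameComp hw (.arc _ _ (.right (n + 2) i _ h2 hi))
    simpa [Piece.bot, Piece.top, add_assoc] using this
  have D0 : SameComp E (n + 1, l.length + 1) (n + 1, l.length + 2) := by
    have := CompGlue.sameComp hw (.arc _ _ (.cup n _ _ _ h0))
    simpa using this
  have D2 : SameComp E (n + 2, l.length + 1) (n + 2, l.length + 2) := by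
    have := CompGlue.sameComp hw (.arc _ _ (.cap (n + 2) _ _ _ h2))
    simpa using this
  have X1 : SameComp E (n + 1, l.length) (n + 2, l.length + 1) :=
    CompGlue.sameComp hw (.cross_left (n + 1) _ _ _ _ _ h1)
  have X2 : SameComp E (n + 1, l.length + 1) (n + 2, l.length) :=
    CompGlue.sameComp hw (.cross_right (n + 1) _ _ _ _ _ h1)
  -- The kinked strand is followed from bottom to top: up across the crossing, round the maximum,
  -- down beside the crossing, round the minimum and up across the crossing again.
  have Y1 := (A1 l.length le_rfl).symm
  have Y2 := X1.symm.trans Y1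
  have Y3 := D2.symm.trans Y2
  have Y4 := (B2 0 (by omega)).trans Y3
  have Y5 := D0.trans Y4
  have Y6 := X2.symm.trans Y5
  have Y7 := Y6.symm.trans (C1 l.length le_rfl)
  refine ⟨fun j hj => ?_, fun j hj => ?_⟩
  · rcases lt_trichotomy j l.length with h | rfl | h
    · exact (A1 j h.le).trans ((B1 j h).trans (C1 j h.le))
    · exact Y7
    · obtain ⟨i, rfl⟩ := Nat.exists_eq_add_of_le h
      have := B2 (1 + i) (by omega)
      rw [show l.length + 2 + (1 + i) = l.length + 3 + i by omega] at this
      exact (A2 i (by omega)).trans (this.trans (C2 i (by omega)))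
  · unfold kinkStrand
    split_ifs with h h'
    · exact ⟨(A1 j h.le).symm, ((A1 j h.le).trans (B1 j h)).symm⟩
    · obtain ⟨i, rfl⟩ := Nat.exists_eq_add_of_le (not_lt.1 h)
      obtain rfl | rfl | rfl : i = 0 ∨ i = 1 ∨ i = 2 := by omega
      · exact ⟨Y1, Y6⟩
      · exact ⟨Y5, Y2⟩
      · exact ⟨Y4, Y3⟩
    · obtain ⟨i, rfl⟩ := Nat.exists_eq_add_of_le (show l.length + 3 ≤ j by omega)
      have := B2 (1 + i) (by omega)
      rw [show l.length + 2 + (1 + i) = l.length + 3 + i by omega] at this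
      have h3 := (A2 i (by omega)).symm
      rw [show l.length + 3 + i - 2 = l.length + 1 + i by omega]
      exact ⟨h3, this.symm.trans h3⟩

lemma level_kink_mid {d : ℕ} (hd : d = 1 ∨ d = 2) :
    level (u ++ widen l r (kinkSlices e) ++ v) (u.length + d) = l ++ [e, e, e.rev] ++ r := by
  unfold level
  rw [getElem?_kink_mid, widen_kinkSlices]
  rcases hd with rfl | rfl <;> simp [Slice.bot, Piece.bot]

lemma kinkStrand_comp {j : ℕ} {e' : Strand c} (h : (l ++ [e, e, e.rev] ++ r)[j]? = some e') :
    ∃ e'', (l ++ [e] ++ r)[kinkStrand l.length j]? = some e'' ∧ e''.comp = e'.comp := by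
  unfold kinkStrand
  split_ifs with h1 h2
  · rw [List.append_assoc, List.getElem?_append_left h1] at h ⊢
    exact ⟨e', h, rfl⟩
  · obtain ⟨i, rfl⟩ := Nat.exists_eq_add_of_le (not_lt.1 h1)
    refine ⟨e, by simp, ?_⟩
    obtain rfl | rfl | rfl : i = 0 ∨ i = 1 ∨ i = 2 := by omega
    · obtain rfl : e = e' := by simpa using h
      rfl
    · obtain rfl : e = e' := by simpa using h
      rfl
    · obtain rfl : e.rev = e' := by simpa using h
      rfl
  · obtain ⟨i, rfl⟩ := Nat.exists_eq_add_of_le (show l.length + 3 ≤ j by omega)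
    refine ⟨e', ?_, rfl⟩
    rw [List.getElem?_append_right (by simp)] at h
    rw [show l.length + 3 + i - 2 = l.length + 1 + i by omega,
      List.getElem?_append_right (by simp)]
    simpa using h

lemma SameComp.refl_of {w : List (Slice c)} {p : ℕ × ℕ} (hp : p.2 < (level w p.1).length) :
    SameComp w p p := ⟨hp, hp, rfl⟩

/-- A positive kink may be inserted everywhere. -/
lemma LinkDiagram.exists_kink (D : LinkDiagram c) (i : Fin c) :
    ∃ E : LinkDiagram c, NumberedIsotopic D E ∧
      ∀ i', E.writhe i' = D.writhe i' + if i' = i then 1 else 0 := by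
  obtain ⟨p, hp⟩ := D.exists_point i
  obtain ⟨s, hs, he⟩ := p.exists_slice
  obtain ⟨u, v, hD, hu⟩ : ∃ u v, D.slices = u ++ v ∧ u.length = p.1.1 := by
    refine ⟨D.slices.take p.1.1, D.slices.drop p.1.1, (List.take_append_drop _ _).symm, ?_⟩
    have := (List.getElem?_eq_some_iff.1 hs).1
    rw [List.length_take]; omega
  obtain ⟨l, r, hlr, hl⟩ : ∃ l r, s.bot = l ++ [p.strand] ++ r ∧ l.length = p.1.2 := by
    obtain ⟨h, h'⟩ := List.getElem?_eq_some_iff.1 he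
    refine ⟨s.bot.take p.1.2, s.bot.drop (p.1.2 + 1), ?_, by rw [List.length_take]; omega⟩
    rw [← h', List.append_assoc, List.singleton_append, List.getElem_cons_drop,
      List.take_append_drop]
  generalize p.strand = e at hp he hlr
  rw [← hu] at hs
  have hrD := D.closed
  rw [hD] at hrD
  have hlev : level (u ++ v) u.length = l ++ [e] ++ r := by
    rw [level_of_getElem? (by rw [← hD]; exact hs), hlr]
  have hrE : Runs [] (u ++ widen l r (kinkSlices e) ++ v) [] := by
    obtain ⟨t, h1, h2⟩ := runs_append.1 hrD
    refine runs_append.2 ⟨t, runs_append.2 ⟨t, h1, ?_⟩, h2⟩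
    have ht : t = l ++ [e] ++ r := by
      cases v with
      | nil => rw [hD] at hs; simp at hs
      | cons s' v =>
        rw [hD] at hs
        obtain rfl : s' = s := by simpa using hs
        rw [← hlr]; exact h2.1.symm
    rw [ht]
    exact (runs_kinkSlices e).widen l r
  set w := u ++ widen l r (kinkSlices e) ++ v with hw
  obtain ⟨K1, K2⟩ := sameComp_kink hrE
  have K1' (j : ℕ) (hj : j < (level (u ++ v) u.length).length) :
      SameComp w (u.length, j) (u.length + 3, j) := by
    rw [hlev] at hj; exact K1 j (by simp only [List.length_append, List.length_singleton] at hj; exact hj)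
  have lift_valid {p : ℕ × ℕ} (hp : p.2 < (level (u ++ v) p.1).length) :
      (liftPoint u.length p).2 < (level w (liftPoint u.length p).1).length := by
    rwa [level_kink_lift, liftPoint_snd]
  -- A point on the level of the kink has copies below and above it. `liftPoint` selects the upper
  -- copy, but the slices of `u` end at the lower one; both lie on the same component.
  have low {p : ℕ × ℕ} (hp : p.2 < (level (u ++ v) p.1).length) (hk : p.1 ≤ u.length) :
      SameComp w p (liftPoint u.length p) := by
    rcases hk.lt_or_eq with hk | hk
    · have := SameComp.refl_of (lift_valid hp)
      rwa [liftPoint, if_pos hk] at this ⊢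
    · obtain ⟨k, j⟩ := p
      obtain rfl : k = u.length := hk
      rw [liftPoint, if_neg (lt_irrefl _)]
      exact K1' j hp
  -- A gluing takes place within one slice, which survives unchanged, at its old height in `u` and
  -- three steps higher in `v`.
  have lift_glue {p q : ℕ × ℕ} (h : CompGlue (u ++ v) p q) :
      SameComp w (liftPoint u.length p) (liftPoint u.length q) := by
    obtain ⟨hp, hq, -⟩ := h.sameComp hrD
    obtain ⟨k, s', d, d', hs', hd, hd', e1, e2, h'⟩ := h.exists_slice
    rcases lt_or_ge k u.length with hk | hk
    · have h3 := (h' w k (by rw [hw, getElem?_kink_low hk, hs'])).sameComp hrE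
      rw [← e1, ← e2] at h3
      exact (low hp (by omega)).symm.trans (h3.trans (low hq (by omega)))
    · have h3 := (h' w (k + 3) (by rw [hw, getElem?_kink_high hk, hs'])).sameComp hrE
      rw [liftPoint, liftPoint, if_neg (by omega), if_neg (by omega), e1, e2]
      rwa [add_right_comm k 3 d, add_right_comm k 3 d'] at h3
  have lift_comp {p q : Point (u ++ v)} (h : p.component = q.component) :
      SameComp w (liftPoint u.length p.1) (liftPoint u.length q.1) := by
    have := Quot.eqvGen_exact h
    clear h
    induction this with
    | rel p q h => exact lift_glue h
    | refl p => exact .refl_of (lift_valid p.2)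
    | symm p q _ ih => exact ih.symm
    | trans p q t _ _ ih ih' => exact ih.trans ih'
  -- Every point of the new diagram is joined to the lift of an old point with the same component
  -- number. With `lift_comp` this carries the numbering of the components over.
  have back (q : Point w) : ∃ p : Point (u ++ v), p.strand.comp = q.strand.comp ∧
      SameComp w q.1 (liftPoint u.length p.1) := by
    have hq : (level w q.1.1)[q.1.2]? = some q.strand := List.getElem?_eq_getElem q.2
    suffices h : ∃ p : ℕ × ℕ, ∃ e', (level (u ++ v) p.1)[p.2]? = some e' ∧
        e'.comp = q.strand.comp ∧ SameComp w q.1 (liftPoint u.length p) by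
      obtain ⟨p, e', h1, h2, h3⟩ := h
      obtain ⟨h4, h5⟩ := List.getElem?_eq_some_iff.1 h1
      exact ⟨⟨p, h4⟩, by rw [← h2, ← h5]; rfl, h3⟩
    generalize q.strand = e' at hq ⊢
    obtain ⟨⟨k, j⟩, hq'⟩ := q
    simp only at hq hq' ⊢
    rcases lt_or_ge k u.length with hk | hk
    · have hl : liftPoint u.length (k, j) = (k, j) := if_pos hk
      have h1 := level_kink_lift (u := u) (v := v) (l := l) (r := r) (e := e) (k, j)
      rw [hl] at h1
      exact ⟨(k, j), e', by rw [← h1]; exact hq, rfl, by rw [hl]; exact .refl_of hq'⟩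
    obtain ⟨d, rfl⟩ := Nat.exists_eq_add_of_le hk
    have hn (j : ℕ) : liftPoint u.length (u.length, j) = (u.length + 3, j) := if_neg (lt_irrefl _)
    have mid (hd : d = 1 ∨ d = 2) : j < l.length + 3 + r.length ∧
        ∃ e'', (level (u ++ v) u.length)[kinkStrand l.length j]? = some e'' ∧
          e''.comp = e'.comp ∧
          SameComp w (u.length, kinkStrand l.length j) (u.length + 3, kinkStrand l.length j) := by
      rw [hw, level_kink_mid hd] at hq hq'
      obtain ⟨e'', h1, h2⟩ := kinkStrand_comp hq
      rw [← hlev] at h1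
      refine ⟨?_, e'', h1, h2, K1' _ (List.getElem?_eq_some_iff.1 h1).1⟩
      simp only [List.length_append, List.length_cons, List.length_nil] at hq'
      omega
    obtain rfl | rfl | rfl | hd : d = 0 ∨ d = 1 ∨ d = 2 ∨ 3 ≤ d := by omega
    · have h1 : level w u.length = level (u ++ v) u.length := by
        rw [hlev]
        unfold level
        have := getElem?_kink_mid (u := u) (v := v) (l := l) (r := r) (e := e) 0
        rw [← hw, add_zero, widen_kinkSlices] at this
        rw [this]
        simp [Slice.bot, Piece.bot]
      rw [add_zero] at hq hq'
      rw [h1] at hq hq'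
      exact ⟨(u.length, j), e', hq, rfl, by rw [hn]; exact K1' j hq'⟩
    · obtain ⟨hj, e'', h1, h2, h3⟩ := mid (.inl rfl)
      exact ⟨(u.length, _), e'', h1, h2, by rw [hn]; exact (K2 j hj).1.trans h3⟩
    · obtain ⟨hj, e'', h1, h2, h3⟩ := mid (.inr rfl)
      exact ⟨(u.length, _), e'', h1, h2, by rw [hn]; exact (K2 j hj).2.trans h3⟩
    · obtain ⟨d, rfl⟩ := Nat.exists_eq_add_of_le' hd
      have hl : liftPoint u.length (u.length + d, j) = (u.length + (d + 3), j) :=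
        if_neg (by simp)
      have h1 := level_kink_lift (u := u) (v := v) (l := l) (r := r) (e := e) (u.length + d, j)
      rw [hl] at h1
      exact ⟨(u.length + d, j), e', by rw [← h1]; exact hq, rfl, by rw [hl]; exact .refl_of hq'⟩
  have hD1 : ∀ i', ∃ p : Point (u ++ v), p.strand.comp = i' := by
    rw [← hD]; exact D.exists_point
  have hD2 : ∀ p q : Point (u ++ v), p.strand.comp = q.strand.comp →
      p.component = q.component := by
    rw [← hD]; exact fun p q h => D.component_eq h
  have hnum (i' : Fin c) : ∃! C : Component w, ∃ p : Point w, p.component = C ∧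
      p.strand.comp = i' := by
    obtain ⟨p, hp⟩ := hD1 i'
    have hp' : (level (u ++ v) p.1.1)[p.1.2]? = some p.strand := List.getElem?_eq_getElem p.2
    refine ⟨Point.component ⟨liftPoint u.length p.1, lift_valid p.2⟩, ⟨_, rfl, ?_⟩, ?_⟩
    · rw [← level_kink_lift (l := l) (r := r) (e := e), ← liftPoint_snd u.length p.1] at hp'
      rw [← hp]
      congr 1
      exact Option.some.inj ((List.getElem?_eq_getElem _).symm.trans hp')
    · rintro _ ⟨q, rfl, hq⟩
      obtain ⟨q', h1, h2⟩ := back q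
      obtain ⟨_, _, h3⟩ := h2.trans (lift_comp (hD2 q' p (by rw [h1, hq, hp])))
      exact h3
  refine ⟨⟨w, hrE, hnum⟩, ?_, fun i' => ?_⟩
  -- The move removes kinks, so the insertion is its inverse.
  · refine .symm _ _ (.rel _ _ ⟨u, v, l, r, kinkSlices e, [], .kink_right .above e, rfl, ?_⟩)
    simpa [widen] using hD
  · simp only [LinkDiagram.writhe_eq_wordWrithe, hD, hw, wordWrithe_append, wordWrithe_widen]
    have : wordWrithe i' (kinkSlices e) = if i' = i then 1 else 0 := by
      have h := piece_writhe_kink .above e i'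
      simp only [wordWrithe, kinkSlices, List.map_cons, List.map_nil, List.sum_cons, List.sum_nil,
        h, hp, eq_comm (a := i)]
      simp [Piece.writhe, CrossKind.kinkSign]
    rw [this]
    ring

/-- Positive kinks may be inserted in any number. -/
lemma LinkDiagram.exists_add_writhe (D : LinkDiagram c) (T : Fin c → ℕ) :
    ∃ E : LinkDiagram c, NumberedIsotopic D E ∧ ∀ i, E.writhe i = D.writhe i + T i := by
  have one (i : Fin c) (n : ℕ) (D : LinkDiagram c) : ∃ E : LinkDiagram c, NumberedIsotopic D E ∧
      ∀ i', E.writhe i' = D.writhe i' + if i' = i then (n : ℤ) else 0 := by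
    induction n with
    | zero => exact ⟨D, .refl D, fun i' => by simp⟩
    | succ n ih =>
      obtain ⟨E, h1, h2⟩ := ih
      obtain ⟨F, h3, h4⟩ := E.exists_kink i
      refine ⟨F, .trans _ _ _ h1 h3, fun i' => ?_⟩
      rw [h4, h2]
      split_ifs <;> push_cast <;> ring
  have many (s : Finset (Fin c)) : ∃ E : LinkDiagram c, NumberedIsotopic D E ∧
      ∀ i, E.writhe i = D.writhe i + if i ∈ s then (T i : ℤ) else 0 := by
    induction s using Finset.induction_on with
    | empty => exact ⟨D, .refl D, fun i => by simp⟩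
    | insert j s hj ih =>
      obtain ⟨E, h1, h2⟩ := ih
      obtain ⟨F, h3, h4⟩ := one j (T j) E
      refine ⟨F, .trans _ _ _ h1 h3, fun i => ?_⟩
      rw [h4, h2]
      by_cases h : i = j
      · subst h; simp [hj]
      · simp [h]
  obtain ⟨E, h1, h2⟩ := many Finset.univ
  exact ⟨E, h1, fun i => by simpa using h2 i⟩

lemma LinkDiagram.nonempty_framingTile (D : LinkDiagram c) {N : ℕ} (hN : 0 < N) :
    Nonempty (FramingTile D N) := by
  have : NeZero N := ⟨hN.ne'⟩
  have key (w : Fin c → ZMod N) : ∃ E : LinkDiagram c, NumberedIsotopic D E ∧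
      ∀ i, (E.writhe i : ZMod N) = w i := by
    -- The least nonnegative representative of the missing writhe, so positive kinks suffice.
    obtain ⟨E, h1, h2⟩ := D.exists_add_writhe fun i => (w i - D.writhe i).val
    refine ⟨E, h1, fun i => ?_⟩
    rw [h2]
    simp
  choose E h1 h2 using key
  exact ⟨⟨E, h1, h2⟩⟩

end Kink

/-! ## Labelings with beads -/

section BeadLabeling

variable {X : Type uX} {S : Type uS} {b : VirtualBirack X} (σ : Shadow b S) {c : ℕ}

lemma step_eq_iff {G : Type uG} {A B : S} {u : Bool} {l : X × G} :
    B = step σ A u l ↔ if u then A = σ.act l.1 B else B = σ.act l.1 A := by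
  cases u
  · simp [step]
  · simp only [step, if_true, Equiv.eq_symm_apply]
    exact eq_comm

/-- A labeling of a diagram together with values for the beads. -/
@[ext] structure BeadLabeling (w : List (Slice c)) (G : Type uG) [AddCommGroup G]
    [Module (Alg b σ) G] where
  arc : Semiarc w → X × G
  region : Region w → S
  crossing : ∀ χ : Crossing w, SignRel σ χ.sign (region χ.side) (arc χ.inL) (arc χ.inR)
    (arc χ.outL) (arc χ.outR)
  shadow : ∀ (p : Point w) (g h : Gap w), g.1 = p.1 → h.1 = (p.1.1, p.1.2 + 1) →
    region h.region = step σ (region g.region) p.strand.up (arc p.arc)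

variable {σ} {w : List (Slice c)} {G : Type uG} [AddCommGroup G] [Module (Alg b σ) G]

/-- The value of a homomorphism on a bead. -/
def beadValue {f : Labeling b σ w} (h : HomModule f G) (a : Semiarc w) : G :=
  h (Submodule.Quotient.mk (bead a))

lemma HomModule.ext' {f : Labeling b σ w} {h h' : HomModule f G}
    (e : ∀ a, beadValue h a = beadValue h' a) : h = h' := by
  refine Submodule.linearMap_qext _ (Finsupp.lhom_ext' fun a => LinearMap.ext_ring ?_)
  exact e a

/-- The homomorphism on the free module with given values on the beads. -/
def beadHom (g : Semiarc w → G) : (Semiarc w →₀ Alg b σ) →ₗ[Alg b σ] G :=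
  Finsupp.linearCombination (Alg b σ) g

lemma beadHom_bead (g : Semiarc w → G) (a : Semiarc w) :
    beadHom (σ := σ) g (bead a) = g a := by
  simp [beadHom, bead]

lemma beadValue_rel {f : Labeling b σ w} (h : HomModule f G) {q : Semiarc w →₀ Alg b σ}
    (hq : BeadRel f q) : h (Submodule.Quotient.mk q) = 0 := by
  rw [(Submodule.Quotient.mk_eq_zero _).2 (Submodule.subset_span hq), map_zero]

/-- A homomorphism from the fundamental module assigns values to the beads. -/
def beadLabelingOf (t : (f : Labeling b σ w) × HomModule f G) : BeadLabeling σ w G where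
  arc a := (t.1.arc a, beadValue t.2 a)
  region := t.1.region
  crossing χ := by
    obtain ⟨f, h⟩ := t
    have hc := f.crossing χ
    have h1 := fun h0 => beadValue_rel h (.pos_left χ h0)
    have h2 := fun h0 => beadValue_rel h (.pos_right χ h0)
    have h3 := fun h0 => beadValue_rel h (.neg_left χ h0)
    have h4 := fun h0 => beadValue_rel h (.neg_right χ h0)
    have h5 := fun h0 => beadValue_rel h (.virt_left χ h0)
    have h6 := fun h0 => beadValue_rel h (.virt_right χ h0)
    simp only [Submodule.Quotient.mk_sub, Submodule.Quotient.mk_add, Submodule.Quotient.mk_smul,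
      map_sub, map_add, map_smul, sub_eq_zero] at h1 h2 h3 h4 h5 h6
    generalize χ.sign = g at hc h1 h2 h3 h4 h5 h6
    cases g
    · exact ⟨hc, h1 rfl, h2 rfl⟩
    · exact ⟨hc, h3 rfl, h4 rfl⟩
    · exact ⟨hc, h5 rfl, h6 rfl⟩
  shadow p g h hg hh := by
    rw [step_eq_iff]
    exact t.1.shadow p g h hg hh

/-- The underlying labeling. -/
def BeadLabeling.labeling (J : BeadLabeling σ w G) : Labeling b σ w where
  arc a := (J.arc a).1
  region := J.region
  crossing χ := by
    have h := J.crossing χ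
    generalize χ.sign = g at h
    cases g
    · exact h.1
    · exact h.1
    · exact h.1
  shadow p g h hg hh := by
    have := J.shadow p g h hg hh
    rwa [step_eq_iff] at this

/-- The homomorphism given by the values of the beads. -/
def BeadLabeling.hom (J : BeadLabeling σ w G) : HomModule J.labeling G :=
  Submodule.liftQ _ (beadHom fun a => (J.arc a).2) <| by
    rw [Submodule.span_le]
    intro q hq
    rw [SetLike.mem_coe, LinearMap.mem_ker]
    cases hq with
    | pos_left χ h =>
      have := J.crossing χ
      rw [h] at this
      simp only [map_sub, map_add, map_smul, beadHom_bead, sub_eq_zero]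
      exact this.2.1
    | pos_right χ h =>
      have := J.crossing χ
      rw [h] at this
      simp only [map_sub, map_smul, beadHom_bead, sub_eq_zero]
      exact this.2.2
    | neg_left χ h =>
      have := J.crossing χ
      rw [h] at this
      simp only [map_sub, map_add, map_smul, beadHom_bead, sub_eq_zero]
      exact this.2.1
    | neg_right χ h =>
      have := J.crossing χ
      rw [h] at this
      simp only [map_sub, map_smul, beadHom_bead, sub_eq_zero]
      exact this.2.2
    | virt_left χ h =>
      have := J.crossing χ
      rw [h] at this
      simp only [map_sub, map_smul, beadHom_bead, sub_eq_zero]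
      exact this.2.1
    | virt_right χ h =>
      have := J.crossing χ
      rw [h] at this
      simp only [map_sub, map_smul, beadHom_bead, sub_eq_zero]
      exact this.2.2

lemma BeadLabeling.beadValue_hom (J : BeadLabeling σ w G) (a : Semiarc w) :
    beadValue J.hom a = (J.arc a).2 := by
  simp only [beadValue, BeadLabeling.hom]
  exact (Submodule.liftQ_apply _ _ _).trans (beadHom_bead _ a)

/-- The universal property of the fundamental module: a homomorphism to `G` is a choice of values
for the beads satisfying the bead relations. -/
lemma beadLabelingOf_bijective :
    Function.Bijective (beadLabelingOf : (f : Labeling b σ w) × HomModule f G → BeadLabeling σ w G) := by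
  constructor
  · rintro ⟨f, h⟩ ⟨f', h'⟩ e
    have e1 := congrArg BeadLabeling.arc e
    have e2 := congrArg BeadLabeling.region e
    simp only [beadLabelingOf, funext_iff, Prod.mk.injEq] at e1 e2
    obtain ⟨a, r, _, _⟩ := f
    obtain ⟨a', r', _, _⟩ := f'
    obtain rfl : a = a' := funext fun x => (e1 x).1
    obtain rfl : r = r' := funext e2
    congr 1
    exact HomModule.ext' fun x => (e1 x).2
  · intro J
    refine ⟨⟨J.labeling, J.hom⟩, BeadLabeling.ext (funext fun a => ?_) rfl⟩
    exact Prod.ext rfl (J.beadValue_hom a)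

/-- Labelings with homomorphisms of the fundamental module are labelings with beads. -/
def beadLabelingEquiv : (f : Labeling b σ w) × HomModule f G ≃ BeadLabeling σ w G :=
  Equiv.ofBijective _ beadLabelingOf_bijective

variable {G' : Type uG} [AddCommGroup G'] [Module (Alg b σ) G'] (φ : G →ₗ[Alg b σ] G')

/-- Apply a linear map to all beads. -/
def BeadLabeling.map (J : BeadLabeling σ w G) : BeadLabeling σ w G' where
  arc a := mapLabel σ φ (J.arc a)
  region := J.region
  crossing χ := (J.crossing χ).map φ
  shadow p g h hg hh := by rw [step_mapLabel]; exact J.shadow p g h hg hh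

lemma beadLabelingEquiv_map (f : Labeling b σ w) (h : HomModule f G) :
    beadLabelingEquiv ⟨f, φ ∘ₗ h⟩ = (beadLabelingEquiv ⟨f, h⟩).map φ := rfl

end BeadLabeling

/-! ## Labels of a slice -/

section SliceLabels

variable {X : Type uX} {S : Type uS} {b : VirtualBirack X} {σ : Shadow b S} [Finite X]
  {G : Type uG} [AddCommGroup G] [Module (Alg b σ) G]

/-- The conditions on the labels at the bottom and the top of a slice, label by label. -/
lemma rel_slice_iff {A : S} {l r : List Bool} {p : FlatPiece} {a a' : State X G}
    (ha : a.map Prod.fst = l ++ p.bot ++ r) (ha' : a'.map Prod.fst = l ++ p.top ++ r) :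
    (Op.slice l p r).Rel σ A a a' ↔
      (∀ i < l.length, a[i]? = a'[i]?) ∧
      (∀ i < r.length, a[l.length + p.bot.length + i]? = a'[l.length + p.top.length + i]?) ∧
      match p with
      | .cup u => ∃ x, a'[l.length]? = some (u, x) ∧ a'[l.length + 1]? = some (!u, x)
      | .cap u => ∃ x, a[l.length]? = some (u, x) ∧ a[l.length + 1]? = some (!u, x)
      | .cross k u v => ∃ x y z t, a[l.length]? = some (u, x) ∧ a[l.length + 1]? = some (v, y) ∧
          a'[l.length]? = some (v, z) ∧ a'[l.length + 1]? = some (u, t) ∧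
          CrossRel σ k u v (walk σ A (a.take l.length)) x y z t := by
  obtain ⟨_, R, rfl, h, rfl⟩ := List.map_eq_append_iff.1 ha
  obtain ⟨L, M, rfl, rfl, hM⟩ := List.map_eq_append_iff.1 h
  obtain ⟨_, R', rfl, h', hR⟩ := List.map_eq_append_iff.1 ha'
  obtain ⟨L', M', rfl, hL, hM'⟩ := List.map_eq_append_iff.1 h'
  have lM : M.length = p.bot.length := by rw [← hM, List.length_map]
  have lM' : M'.length = p.top.length := by rw [← hM', List.length_map]
  have lR : R'.length = R.length := by simpa using congrArg List.length hR
  have lL : L'.length = L.length := by simpa using congrArg List.length hL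
  have e1 : (∀ i < (L.map Prod.fst).length, (L ++ M ++ R)[i]? = (L' ++ M' ++ R')[i]?) ↔
      L = L' := by
    constructor
    · intro h
      refine List.ext_getElem? fun i => ?_
      rcases lt_or_ge i L.length with hi | hi
      · have := h i (by simpa using hi)
        rwa [List.append_assoc, List.append_assoc, List.getElem?_append_left hi,
          List.getElem?_append_left (by omega)] at this
      · rw [List.getElem?_eq_none hi, List.getElem?_eq_none (by omega)]
    · rintro rfl i hi
      rw [List.length_map] at hi
      rw [List.append_assoc, List.append_assoc, List.getElem?_append_left hi,
        List.getElem?_append_left hi]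
  have e2 : (∀ i < (R.map Prod.fst).length,
      (L ++ M ++ R)[(L.map Prod.fst).length + p.bot.length + i]? =
        (L' ++ M' ++ R')[(L.map Prod.fst).length + p.top.length + i]?) ↔ R = R' := by
    have hb (i : ℕ) : (L ++ M ++ R)[(L.map Prod.fst).length + p.bot.length + i]? = R[i]? := by
      rw [List.getElem?_append_right (by simp; omega)]
      congr 1; simp; omega
    have ht (i : ℕ) : (L' ++ M' ++ R')[(L.map Prod.fst).length + p.top.length + i]? = R'[i]? := by
      rw [List.getElem?_append_right (by simp; omega)]
      congr 1; simp; omega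
    simp only [hb, ht]
    constructor
    · intro h
      refine List.ext_getElem? fun i => ?_
      rcases lt_or_ge i R.length with hi | hi
      · exact h i (by simpa using hi)
      · rw [List.getElem?_eq_none hi, List.getElem?_eq_none (by omega)]
    · rintro rfl i _; rfl
  have e3 : (Op.slice (L.map Prod.fst) p (R.map Prod.fst)).Rel σ A (L ++ M ++ R)
      (L' ++ M' ++ R') ↔ L = L' ∧ R = R' ∧ PieceRel σ (walk σ A L) p M M' := by
    constructor
    · rintro ⟨L₁, M₁, M₁', R₁, h1, h2, h3, h4, h5⟩
      obtain ⟨rfl, rfl, rfl⟩ := append_append_inj h1 h3.symm h4.symm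
      obtain ⟨rfl, rfl, rfl⟩ := append_append_inj h2 hL hR
      exact ⟨rfl, rfl, h5⟩
    · rintro ⟨rfl, rfl, h⟩
      exact ⟨L, M, M', R, rfl, rfl, rfl, rfl, h⟩
  rw [e1, e2, e3]
  refine and_congr_right ?_
  rintro rfl
  refine and_congr_right ?_
  rintro rfl
  rw [List.length_map]
  cases p with
  | cup u =>
    obtain rfl := List.length_eq_zero_iff.1 lM
    obtain ⟨⟨u₁, x⟩, ⟨u₂, y⟩, rfl⟩ := List.length_eq_two.1 lM'
    simp only [FlatPiece.top, List.map_cons, List.map_nil, List.cons.injEq, and_true] at hM'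
    obtain ⟨rfl, rfl⟩ := hM'
    simp [PieceRel, eq_comm]
  | cap u =>
    obtain rfl := List.length_eq_zero_iff.1 lM'
    obtain ⟨⟨u₁, x⟩, ⟨u₂, y⟩, rfl⟩ := List.length_eq_two.1 lM
    simp only [FlatPiece.bot, List.map_cons, List.map_nil, List.cons.injEq, and_true] at hM
    obtain ⟨rfl, rfl⟩ := hM
    simp [PieceRel, eq_comm]
  | cross k u v =>
    obtain ⟨⟨u₁, x⟩, ⟨u₂, y⟩, rfl⟩ := List.length_eq_two.1 lM
    obtain ⟨⟨u₃, z⟩, ⟨u₄, t⟩, rfl⟩ := List.length_eq_two.1 lM'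
    simp only [FlatPiece.top, FlatPiece.bot, List.map_cons, List.map_nil, List.cons.injEq,
      and_true] at hM hM'
    obtain ⟨rfl, rfl⟩ := hM
    obtain ⟨rfl, rfl⟩ := hM'
    simp only [PieceRel, List.cons.injEq, Prod.mk.injEq, true_and, and_true]
    constructor
    · rintro ⟨_, _, _, _, ⟨rfl, rfl⟩, ⟨rfl, rfl⟩, h⟩
      exact ⟨x, y, z, t, by simp, by simp, by simp, by simp, by simpa using h⟩
    · rintro ⟨x', y', z', t', h1, h2, h3, h4, h⟩
      simp only [List.append_assoc, List.cons_append, List.nil_append, le_refl,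
        List.getElem?_append_right, Nat.sub_self, List.getElem?_cons_zero, Nat.le_add_right,
        Nat.add_sub_cancel_left, List.getElem?_cons_succ, Option.some.injEq, Prod.mk.injEq,
        true_and] at h1 h2 h3 h4
      refine ⟨x, y, z, t, ⟨rfl, rfl⟩, ⟨rfl, rfl⟩, ?_⟩
      rw [h1, h2, h3, h4]
      simpa using h

end SliceLabels

/-! ## Labelings level by level -/

section LevelLabeling

variable {X : Type uX} {S : Type uS} {b : VirtualBirack X} (σ : Shadow b S) {c : ℕ}

/-- The relation at a crossing, in terms of the labels around it as drawn. -/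
lemma Crossing.signRel_iff {w : List (Slice c)} (χ : Crossing w) {G : Type uG} [AddCommGroup G]
    [Module (Alg b σ) G] (arc : Semiarc w → X × G) (region : Region w → S)
    (hs : region χ.south.region = step σ (region χ.west.region) χ.sl.up (arc χ.bl.arc))
    (he : region χ.east.region = step σ (region χ.south.region) χ.sr.up (arc χ.br.arc))
    (hn : region χ.north.region = step σ (region χ.west.region) χ.sr.up (arc χ.tl.arc)) :
    SignRel σ χ.sign (region χ.side) (arc χ.inL) (arc χ.inR) (arc χ.outL) (arc χ.outR) ↔
      CrossRel σ χ.kind χ.sl.up χ.sr.up (region χ.west.region) (arc χ.bl.arc) (arc χ.br.arc)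
        (arc χ.tl.arc) (arc χ.tr.arc) := by
  simp only [Crossing.sign, crossSign_eq, Crossing.side, Crossing.inL, Crossing.inR, Crossing.outL,
    Crossing.outR]
  cases h1 : χ.sl.up <;> cases h2 : χ.sr.up <;> simp only [h1, h2] at hs he hn <;>
    simp [CrossRel, hs, he, hn]

/-- A family of labels of the levels of a diagram, and the label of the unbounded region. -/
@[ext] structure LevelLabeling [Finite X] (w : List (Slice c)) (G : Type uG) [AddCommGroup G]
    [Module (Alg b σ) G] where
  outer : S
  state : ℕ → State X G
  dir : ∀ k, (state k).map Prod.fst = ups (level w k)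
  rel : ∀ (k : ℕ) (s : Slice c), w[k]? = some s → s.op.Rel σ outer (state k) (state (k + 1))

variable {σ} {w : List (Slice c)}

lemma Point.getElem? (p : Point w) : (level w p.1.1)[p.1.2]? = some p.strand :=
  List.getElem?_eq_getElem p.2

lemma Slice.bot_left (s : Slice c) {i : ℕ} (hi : i < s.left.length) :
    s.bot[i]? = some s.left[i] := by
  rw [Slice.bot, List.append_assoc, List.getElem?_append_left hi, List.getElem?_eq_getElem hi]

lemma Slice.top_left (s : Slice c) {i : ℕ} (hi : i < s.left.length) :
    s.top[i]? = some s.left[i] := by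
  rw [Slice.top, List.append_assoc, List.getElem?_append_left hi, List.getElem?_eq_getElem hi]

lemma Slice.bot_right (s : Slice c) {i : ℕ} (hi : i < s.right.length) :
    s.bot[s.left.length + s.piece.bot.length + i]? = some s.right[i] := by
  rw [Slice.bot, List.getElem?_append_right (by simp), ← List.getElem?_eq_getElem hi]
  simp

lemma Slice.top_right (s : Slice c) {i : ℕ} (hi : i < s.right.length) :
    s.top[s.left.length + s.piece.top.length + i]? = some s.right[i] := by
  rw [Slice.top, List.getElem?_append_right (by simp), ← List.getElem?_eq_getElem hi]
  simp

lemma Runs.level_zero {a : List (Strand c)} (hw : Runs a w []) : level w 0 = a := by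
  cases w with
  | nil => exact hw.symm
  | cons s w => exact hw.1

variable {G : Type uG} [AddCommGroup G] [Module (Alg b σ) G]

lemma rel_op_iff [Finite X] {A : S} {s : Slice c} {a a' : State X G} (ha : a.map Prod.fst = ups s.bot)
    (ha' : a'.map Prod.fst = ups s.top) :
    s.op.Rel σ A a a' ↔ (∀ i < s.left.length, a[i]? = a'[i]?) ∧
      (∀ i < s.right.length, a[s.left.length + s.piece.bot.length + i]? =
        a'[s.left.length + s.piece.top.length + i]?) ∧
      match s.piece with
      | .cup u => ∃ x, a'[s.left.length]? = some (u.up, x) ∧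
          a'[s.left.length + 1]? = some (u.rev.up, x)
      | .cap u => ∃ x, a[s.left.length]? = some (u.up, x) ∧
          a[s.left.length + 1]? = some (u.rev.up, x)
      | .cross k u v => ∃ x y z t, a[s.left.length]? = some (u.up, x) ∧
          a[s.left.length + 1]? = some (v.up, y) ∧ a'[s.left.length]? = some (v.up, z) ∧
          a'[s.left.length + 1]? = some (u.up, t) ∧
          CrossRel σ k u.up v.up (walk σ A (a.take s.left.length)) x y z t := by
  obtain ⟨l, p, r⟩ := s
  rw [Slice.bot_ups] at ha
  rw [Slice.top_ups] at ha'
  have := rel_slice_iff (σ := σ) (A := A) ha ha'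
  simp only [List.length_map] at this
  cases p <;> exact this

/-! ### From semiarcs to levels -/

namespace BeadLabeling

variable (J : BeadLabeling σ w G)

/-- The labels on a level. -/
def state (k : ℕ) : State X G :=
  List.ofFn fun j : Fin (level w k).length =>
    ((level w k)[j].up, J.arc (Point.arc (w := w) ⟨(k, j), j.2⟩))

lemma getElem?_state (p : Point w) :
    (J.state p.1.1)[p.1.2]? = some (p.strand.up, J.arc p.arc) := by
  rw [List.getElem?_eq_getElem (by simpa [state] using p.2)]
  simp only [state, List.getElem_ofFn]
  rfl

lemma getElem?_state_of {k i : ℕ} {e : Strand c} (h : (level w k)[i]? = some e) :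
    ∃ p : Point w, p.1 = (k, i) ∧ p.strand = e ∧ (J.state k)[i]? = some (e.up, J.arc p.arc) := by
  obtain ⟨hi, rfl⟩ := List.getElem?_eq_some_iff.1 h
  exact ⟨⟨(k, i), hi⟩, rfl, rfl, J.getElem?_state ⟨(k, i), hi⟩⟩

lemma map_fst_state (k : ℕ) : (J.state k).map Prod.fst = ups (level w k) := by
  refine List.ext_getElem (by simp [state]) fun i h1 h2 => ?_
  simp [state]

/-- The unbounded region. -/
def outerGap (w : List (Slice c)) : Gap w := ⟨(0, 0), Nat.zero_le _, Nat.zero_le _⟩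

/-- The leftmost intervals of successive lines are glued to each other, so all of them lie in the
unbounded region. -/
lemma region_left (k : ℕ) (g : Gap w) (hg : g.1 = (k, 0)) : g.region = (outerGap w).region := by
  induction k generalizing g with
  | zero => exact congrArg Gap.region (Subtype.ext hg)
  | succ k ih =>
    have hk : k + 1 ≤ w.length := by have := g.2.1; rwa [hg] at this
    have h := List.getElem?_eq_getElem (show k < w.length by omega)
    rw [← ih ⟨(k, 0), by omega, Nat.zero_le _⟩ rfl]
    exact (Quot.sound (by rw [hg]; exact GapGlue.left k 0 _ h (Nat.zero_le _))).symm

/-- Thus region labels are redundant given the outer one: the shadow condition propagates it from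
left to right along each level. -/
lemma walk_state (g : Gap w) :
    walk σ (J.region (outerGap w).region) ((J.state g.1.1).take g.1.2) = J.region g.region := by
  obtain ⟨⟨k, j⟩, hk, hj⟩ := g
  dsimp only at hk hj ⊢
  induction j with
  | zero => rw [List.take_zero, walk_nil, ← region_left k ⟨(k, 0), hk, hj⟩ rfl]
  | succ j ih =>
    have hj' : j < (level w k).length := hj
    have := J.getElem?_state ⟨(k, j), hj'⟩
    rw [List.take_add_one, walk_append, ih hj'.le, this]
    exact (J.shadow ⟨(k, j), hj'⟩ ⟨(k, j), hk, hj'.le⟩ ⟨(k, j + 1), hk, hj⟩ rfl rfl).symm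

variable [Finite X] (hw : Runs [] w [])

/-- The labels of the levels. -/
def level : LevelLabeling σ w G where
  outer := J.region (outerGap w).region
  state := J.state
  dir := J.map_fst_state
  rel k s hs := by
    have hb := level_of_getElem? hs
    have ht := level_succ hw hs
    have hk : k + 1 ≤ w.length := (List.getElem?_eq_some_iff.1 hs).1
    rw [rel_op_iff (by rw [J.map_fst_state, hb]) (by rw [J.map_fst_state, ht])]
    refine ⟨fun i hi => ?_, fun i hi => ?_, ?_⟩
    · obtain ⟨p, hp, -, h1⟩ := J.getElem?_state_of (hb ▸ s.bot_left hi)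
      obtain ⟨q, hq, -, h2⟩ := J.getElem?_state_of (ht ▸ s.top_left hi)
      rw [h1, h2, show p.arc = q.arc from Quot.sound (by rw [hp, hq]; exact .left k i s hs hi)]
    · obtain ⟨p, hp, -, h1⟩ := J.getElem?_state_of (hb ▸ s.bot_right hi)
      obtain ⟨q, hq, -, h2⟩ := J.getElem?_state_of (ht ▸ s.top_right hi)
      rw [h1, h2, show p.arc = q.arc from Quot.sound (by rw [hp, hq]; exact .right k i s hs hi)]
    · obtain ⟨l, p, r⟩ := s
      cases p with
      | cup u =>
        obtain ⟨p, hp, -, h1⟩ := J.getElem?_state_of (k := k + 1) (i := l.length) (e := u)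
          (by rw [ht]; simp [Slice.top, Piece.top])
        obtain ⟨q, hq, -, h2⟩ := J.getElem?_state_of (k := k + 1) (i := l.length + 1) (e := u.rev)
          (by rw [ht]; simp [Slice.top, Piece.top])
        refine ⟨J.arc p.arc, h1, ?_⟩
        rw [show p.arc = q.arc from Quot.sound (by rw [hp, hq]; exact .cup k l r u hs)]
        exact h2
      | cap u =>
        obtain ⟨p, hp, -, h1⟩ := J.getElem?_state_of (k := k) (i := l.length) (e := u)
          (by rw [hb]; simp [Slice.bot, Piece.bot])
        obtain ⟨q, hq, -, h2⟩ := J.getElem?_state_of (k := k) (i := l.length + 1) (e := u.rev)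
          (by rw [hb]; simp [Slice.bot, Piece.bot])
        refine ⟨J.arc p.arc, h1, ?_⟩
        rw [show p.arc = q.arc from Quot.sound (by rw [hp, hq]; exact .cap k l r u hs)]
        exact h2
      | cross κ u v =>
        obtain ⟨bl, hbl, ebl, h1⟩ := J.getElem?_state_of (k := k) (i := l.length) (e := u)
          (by rw [hb]; simp [Slice.bot, Piece.bot])
        obtain ⟨br, hbr, ebr, h2⟩ := J.getElem?_state_of (k := k) (i := l.length + 1) (e := v)
          (by rw [hb]; simp [Slice.bot, Piece.bot])
        obtain ⟨tl, htl, etl, h3⟩ := J.getElem?_state_of (k := k + 1) (i := l.length) (e := v)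
          (by rw [ht]; simp [Slice.top, Piece.top])
        obtain ⟨tr, htr, etr, h4⟩ := J.getElem?_state_of (k := k + 1) (i := l.length + 1) (e := u)
          (by rw [ht]; simp [Slice.top, Piece.top])
        have lb : l.length + 2 ≤ (VirtualShadow.level w k).length := by
          rw [hb]; simp [Slice.bot, Piece.bot]
        have lt : l.length + 2 ≤ (VirtualShadow.level w (k + 1)).length := by
          rw [ht]; simp [Slice.top, Piece.top]
        let χ : Crossing w :=
          { height := k, left := l, right := r, kind := κ, sl := u, sr := v, slice_eq := hs,
            bl := bl, br := br, tl := tl, tr := tr, bl_eq := hbl, br_eq := hbr, tl_eq := htl,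
            tr_eq := htr,
            west := ⟨(k, l.length), by omega, by dsimp only; omega⟩
            south := ⟨(k, l.length + 1), by omega, by dsimp only; omega⟩
            north := ⟨(k + 1, l.length + 1), hk, by dsimp only; omega⟩
            east := ⟨(k, l.length + 2), by omega, lb⟩
            west_eq := rfl, south_eq := rfl, north_eq := rfl, east_eq := rfl }
        refine ⟨_, _, _, _, h1, h2, h3, h4, ?_⟩
        have hχ : walk σ (J.region (outerGap w).region) ((J.state k).take l.length) =
            J.region χ.west.region := J.walk_state χ.west
        dsimp only
        rw [hχ]
        refine (χ.signRel_iff σ J.arc J.region ?_ ?_ ?_).1 (J.crossing χ)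
        · rw [J.shadow bl χ.west χ.south hbl.symm (by rw [hbl]), ebl]
        · rw [J.shadow br χ.south χ.east hbr.symm (by rw [hbr]), ebr]
        -- The northern region is reached along the upper line, whose interval `g` belongs to the
        -- western region.
        · let g : Gap w := ⟨(k + 1, l.length), hk, by dsimp only; omega⟩
          have hg : χ.west.region = g.region := Quot.sound (.left k l.length _ hs le_rfl)
          rw [J.shadow tl g χ.north htl.symm (by rw [htl]), etl, hg]

end BeadLabeling

variable [Finite X]

/-! ### From levels to semiarcs -/

namespace LevelLabeling

variable (M : LevelLabeling σ w G)

lemma length_state (k : ℕ) : (M.state k).length = (level w k).length := by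
  simpa using congrArg List.length (M.dir k)

/-- The label at a point. -/
def label (p : Point w) : X × G :=
  ((M.state p.1.1)[p.1.2]'(by rw [M.length_state]; exact p.2)).2

lemma getElem?_state (p : Point w) :
    (M.state p.1.1)[p.1.2]? = some (p.strand.up, M.label p) := by
  have hp : p.1.2 < (M.state p.1.1).length := by rw [M.length_state]; exact p.2
  rw [List.getElem?_eq_getElem hp, Option.some_inj]
  refine Prod.ext ?_ rfl
  have := congrArg (·[p.1.2]?) (M.dir p.1.1)
  simp only [List.getElem?_map, p.getElem?, List.getElem?_eq_getElem hp, Option.map_some,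
    Option.some_inj] at this
  exact this

lemma label_eq_of {p : Point w} {k i : ℕ} {u : Bool} {x : X × G} (hp : p.1 = (k, i))
    (h : (M.state k)[i]? = some (u, x)) : M.label p = x := by
  have := M.getElem?_state p
  rw [hp, h] at this
  simp only [Option.some_inj, Prod.mk.injEq] at this
  exact this.2.symm

lemma label_congr {p q : Point w} {k i k' i' : ℕ} (hp : p.1 = (k, i)) (hq : q.1 = (k', i'))
    (h : (M.state k)[i]? = (M.state k')[i']?) : M.label p = M.label q := by
  have := M.getElem?_state q
  rw [hq, ← h] at this
  exact M.label_eq_of hp this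

lemma rel_iff (hw : Runs [] w []) {k : ℕ} {s : Slice c} (hs : w[k]? = some s) :
    (∀ i < s.left.length, (M.state k)[i]? = (M.state (k + 1))[i]?) ∧
      (∀ i < s.right.length, (M.state k)[s.left.length + s.piece.bot.length + i]? =
        (M.state (k + 1))[s.left.length + s.piece.top.length + i]?) ∧
      match s.piece with
      | .cup u => ∃ x, (M.state (k + 1))[s.left.length]? = some (u.up, x) ∧
          (M.state (k + 1))[s.left.length + 1]? = some (u.rev.up, x)
      | .cap u => ∃ x, (M.state k)[s.left.length]? = some (u.up, x) ∧
          (M.state k)[s.left.length + 1]? = some (u.rev.up, x)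
      | .cross κ u v => ∃ x y z t, (M.state k)[s.left.length]? = some (u.up, x) ∧
          (M.state k)[s.left.length + 1]? = some (v.up, y) ∧
          (M.state (k + 1))[s.left.length]? = some (v.up, z) ∧
          (M.state (k + 1))[s.left.length + 1]? = some (u.up, t) ∧
          CrossRel σ κ u.up v.up (walk σ M.outer ((M.state k).take s.left.length)) x y z t :=
  (rel_op_iff (by rw [M.dir, level_of_getElem? hs]) (by rw [M.dir, level_succ hw hs])).1
    (M.rel k s hs)

/-- The label of a semiarc. -/
def arc (hw : Runs [] w []) : Semiarc w → X × G :=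
  Quot.lift M.label <| by
    intro p q h
    generalize hp : p.1 = p', hq : q.1 = q' at h
    cases h with
    | left k i s hs hi => exact M.label_congr hp hq ((M.rel_iff hw hs).1 i hi)
    | right k i s hs hi => exact M.label_congr hp hq ((M.rel_iff hw hs).2.1 i hi)
    | cup k l r s hs =>
      obtain ⟨x, h1, h2⟩ := (M.rel_iff hw hs).2.2
      rw [M.label_eq_of hp h1, M.label_eq_of hq h2]
    | cap k l r s hs =>
      obtain ⟨x, h1, h2⟩ := (M.rel_iff hw hs).2.2
      rw [M.label_eq_of hp h1, M.label_eq_of hq h2]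

/-- The label of a region. -/
def region : Region w → S :=
  Quot.lift (fun g => walk σ M.outer ((M.state g.1.1).take g.1.2)) <| by
    intro p q h
    generalize hp : p.1 = p', hq : q.1 = q' at h
    cases h with
    | left k i s hs hi =>
      obtain ⟨L, M₁, M₂, R, h1, h2, h3, -, -⟩ := M.rel k s hs
      have hL : i ≤ L.length := by
        have := congrArg List.length h3; simp only [List.length_map] at this; omega
      dsimp only
      rw [h1, h2, List.append_assoc, List.append_assoc, List.take_append_of_le_length hL,
        List.take_append_of_le_length hL]
    | right k i s hs hi =>
      obtain ⟨L, M₁, M₂, R, h1, h2, h3, -, h4⟩ := M.rel k s hs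
      have hL : s.left.length = L.length := by
        have := congrArg List.length h3; simp only [List.length_map] at this; omega
      have l1 : s.piece.bot.length = M₁.length := by
        have := congrArg List.length h4.bot_eq
        rw [Piece.bot_flat] at this; simp only [List.length_map] at this; omega
      have l2 : s.piece.top.length = M₂.length := by
        have := congrArg List.length h4.top_eq
        rw [Piece.top_flat] at this; simp only [List.length_map] at this; omega
      dsimp only
      -- To the right of the piece the walk crosses all of it, and the piece has the same effect on
      -- regions at its bottom and at its top.
      rw [h1, h2, hL, l1, l2, ← List.length_append, ← List.length_append, List.take_length_add_append,
        List.take_length_add_append]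
      simp only [walk_append, h4.walk_eq]

lemma region_gap {g : Gap w} {k i : ℕ} (hg : g.1 = (k, i)) :
    M.region g.region = walk σ M.outer ((M.state k).take i) := by
  simp only [region, Gap.region, hg]

lemma region_succ (hw : Runs [] w []) (p : Point w) (g h : Gap w) (hg : g.1 = p.1) (hh : h.1 = (p.1.1, p.1.2 + 1)) :
    M.region h.region = step σ (M.region g.region) p.strand.up (M.arc hw p.arc) := by
  rw [M.region_gap hh, M.region_gap hg, List.take_add_one, walk_append, M.getElem?_state]
  rfl

/-- The labels of the semiarcs and regions. -/
def bead (hw : Runs [] w []) : BeadLabeling σ w G where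
  arc := M.arc hw
  region := M.region
  shadow := M.region_succ hw
  crossing χ := by
    have hs := χ.slice_eq
    have hb := level_of_getElem? hs
    have ht := level_succ hw hs
    obtain ⟨x, y, z, t, h1, h2, h3, h4, h⟩ := (M.rel_iff hw hs).2.2
    have ebl : χ.bl.strand = χ.sl := by
      have := χ.bl.getElem?
      rw [χ.bl_eq, hb] at this
      simpa [Slice.bot, Piece.bot, eq_comm] using this
    have ebr : χ.br.strand = χ.sr := by
      have := χ.br.getElem?
      rw [χ.br_eq, hb] at this
      simpa [Slice.bot, Piece.bot, eq_comm] using this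
    have etl : χ.tl.strand = χ.sr := by
      have := χ.tl.getElem?
      rw [χ.tl_eq, ht] at this
      simpa [Slice.top, Piece.top, eq_comm] using this
    have hk : χ.height + 1 ≤ w.length := (List.getElem?_eq_some_iff.1 hs).1
    refine (χ.signRel_iff σ _ _ ?_ ?_ ?_).2 ?_
    rotate_right
    · rw [M.region_gap χ.west_eq]
      rw [← M.label_eq_of χ.bl_eq h1, ← M.label_eq_of χ.br_eq h2, ← M.label_eq_of χ.tl_eq h3,
        ← M.label_eq_of χ.tr_eq h4] at h
      exact h
    · rw [M.region_succ hw χ.bl χ.west χ.south (by rw [χ.bl_eq, χ.west_eq])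
        (by rw [χ.bl_eq, χ.south_eq]), ebl]
    · rw [M.region_succ hw χ.br χ.south χ.east (by rw [χ.br_eq, χ.south_eq])
        (by rw [χ.br_eq, χ.east_eq]), ebr]
    · let g : Gap w := ⟨(χ.height + 1, χ.left.length), hk, by
        have := χ.tl.2; rw [χ.tl_eq] at this; exact this.le⟩
      have hg : χ.west.region = g.region :=
        Quot.sound (by rw [χ.west_eq]; exact .left χ.height χ.left.length _ hs le_rfl)
      rw [M.region_succ hw χ.tl g χ.north (by rw [χ.tl_eq]) (by rw [χ.tl_eq, χ.north_eq]), etl, hg]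

end LevelLabeling

/-- Labelings of semiarcs and regions are labelings of levels. -/
def levelLabelingEquiv (hw : Runs [] w []) : BeadLabeling σ w G ≃ LevelLabeling σ w G where
  toFun J := J.level hw
  invFun M := M.bead hw
  left_inv J := by
    refine BeadLabeling.ext (funext fun a => ?_) (funext fun r => ?_)
    · obtain ⟨p, rfl⟩ := Quot.exists_rep a
      exact (J.level hw).label_eq_of rfl (J.getElem?_state p)
    · obtain ⟨g, rfl⟩ := Quot.exists_rep r
      exact J.walk_state g
  right_inv M := by
    refine LevelLabeling.ext rfl (funext fun k => List.ext_getElem? fun i => ?_)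
    rcases lt_or_ge i (level w k).length with hi | hi
    · exact ((M.bead hw).getElem?_state ⟨(k, i), hi⟩).trans (M.getElem?_state ⟨(k, i), hi⟩).symm
    · rw [List.getElem?_eq_none ((LevelLabeling.length_state _ k).trans_le hi),
        List.getElem?_eq_none ((LevelLabeling.length_state _ k).trans_le hi)]

variable {G' : Type uG} [AddCommGroup G'] [Module (Alg b σ) G'] (φ : G →ₗ[Alg b σ] G')

/-- Apply a linear map to all beads. -/
def LevelLabeling.map (M : LevelLabeling σ w G) : LevelLabeling σ w G' where
  outer := M.outer
  state k := mapState σ φ (M.state k)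
  dir k := by rw [map_fst_mapState]; exact M.dir k
  rel k s hs := (M.rel k s hs).map φ

lemma levelLabelingEquiv_map (hw : Runs [] w []) (J : BeadLabeling σ w G) :
    levelLabelingEquiv hw (J.map φ) = (levelLabelingEquiv hw J).map φ :=
  LevelLabeling.ext rfl <| funext fun k => by
    simp only [levelLabelingEquiv, Equiv.coe_fn_mk, BeadLabeling.level, LevelLabeling.map,
      BeadLabeling.state, BeadLabeling.map, mapState, List.map_ofFn]
    rfl

end LevelLabeling

/-! ## Labelings and paths -/

section PathLevels

variable {X : Type uX} {S : Type uS} {b : VirtualBirack X} {σ : Shadow b S} [Finite X] {c : ℕ}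

section Single

variable {G : Type uG} [AddCommGroup G] [Module (Alg b σ) G]

/-- The labels that a path puts on the level number `k` of a word. -/
def Path.state {A : S} : {w : List Op} → {a a' : State X G} → Path σ A w a a' → ℕ → State X G
  | [], a, _, _, _ => a
  | _ :: _, a, _, _, 0 => a
  | _ :: _, _, _, ⟨_, _, p⟩, k + 1 => Path.state p k

@[simp] lemma Path.state_zero {A : S} {w : List Op} {a a' : State X G} (p : Path σ A w a a') :
    p.state 0 = a := by
  cases w <;> rfl

lemma Path.state_of_length_le {A : S} {w : List Op} {a a' : State X G} (p : Path σ A w a a')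
    {k : ℕ} (hk : w.length ≤ k) : p.state k = a' := by
  induction w generalizing a k with
  | nil => obtain ⟨⟨rfl⟩⟩ := p; rfl
  | cons o w ih =>
    obtain ⟨m, h, p⟩ := p
    cases k with
    | zero => simp at hk
    | succ k => exact ih p (by simpa using hk)

lemma Path.rel_state {A : S} {w : List Op} {a a' : State X G} (p : Path σ A w a a')
    {k : ℕ} {o : Op} (h : w[k]? = some o) : o.Rel σ A (p.state k) (p.state (k + 1)) := by
  induction w generalizing a k with
  | nil => simp at h
  | cons o' w ih =>
    obtain ⟨m, ⟨h'⟩, p⟩ := p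
    cases k with
    | zero =>
      obtain rfl : o' = o := by simpa using h
      simpa [Path.state] using h'
    | succ k => exact ih p (by simpa using h)

lemma Path.state_injective {A : S} {w : List Op} {a a' : State X G} :
    Function.Injective (Path.state : Path σ A w a a' → ℕ → State X G) := by
  induction w generalizing a with
  | nil => rintro ⟨⟨_⟩⟩ ⟨⟨_⟩⟩ _; rfl
  | cons o w ih =>
    rintro ⟨m, ⟨h⟩, p⟩ ⟨m', ⟨h'⟩, p'⟩ e
    obtain rfl : m = m' := by simpa [Path.state] using congrFun e 1
    obtain rfl : p = p' := ih (funext fun k => congrFun e (k + 1))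
    rfl

lemma Path.exists_state {A : S} {w : List Op} {a a' : State X G} (st : ℕ → State X G)
    (h0 : st 0 = a) (hrel : ∀ (k : ℕ) (o : Op), w[k]? = some o → o.Rel σ A (st k) (st (k + 1)))
    (hlast : ∀ k, w.length ≤ k → st k = a') : ∃ p : Path σ A w a a', p.state = st := by
  induction w generalizing a st with
  | nil =>
    obtain rfl : a = a' := h0.symm.trans (hlast 0 le_rfl)
    exact ⟨⟨⟨rfl⟩⟩, funext fun k => (hlast k (Nat.zero_le _)).symm⟩
  | cons o w ih =>
    obtain ⟨p, hp⟩ := ih (fun k => st (k + 1)) rfl (fun k o h => hrel (k + 1) o (by simpa using h))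
      fun k hk => hlast (k + 1) (by simpa using hk)
    refine ⟨⟨st 1, ⟨h0 ▸ hrel 0 o rfl⟩, p⟩, funext fun k => ?_⟩
    cases k with
    | zero => exact h0.symm
    | succ k => exact congrFun hp k

lemma Slice.map_fst_of_rel {A : S} {s : Slice c} {a a' : State X G} (h : s.op.Rel σ A a a') :
    a.map Prod.fst = ups s.bot := by
  obtain ⟨L, M, M', R, rfl, rfl, h1, h2, h3⟩ := h
  rw [Slice.bot_ups, ← h1, ← h2, ← h3.bot_eq]
  simp

lemma level_of_length_le {w : List (Slice c)} {k : ℕ} (hk : w.length ≤ k) : level w k = [] := by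
  simp [level, List.getElem?_eq_none hk]

/-- The labels of the levels on a path. -/
def levelLabelingOf {w : List (Slice c)}
    (t : (A : S) × Path σ A (.twist [] 0 :: flat w) ([] : State X G) []) : LevelLabeling σ w G where
  outer := t.1
  -- Shifted by one, because the word begins with a trivial twist of the empty level.
  state k := t.2.state (k + 1)
  rel k s hs := t.2.rel_state (k := k + 1) (by simp [hs])
  dir k := by
    rcases lt_or_ge k w.length with hk | hk
    · have hs := List.getElem?_eq_getElem hk
      rw [level_of_getElem? hs]
      exact Slice.map_fst_of_rel (t.2.rel_state (k := k + 1) (o := w[k].op) (by simp [hs]))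
    · rw [level_of_length_le hk, t.2.state_of_length_le (by simpa using hk)]
      rfl

lemma levelLabelingOf_bijective {w : List (Slice c)} (hw : Runs [] w []) :
    Function.Bijective (levelLabelingOf (σ := σ) (G := G) (w := w)) := by
  constructor
  · rintro ⟨A, p⟩ ⟨A', p'⟩ e
    obtain rfl : A = A' := congrArg LevelLabeling.outer e
    obtain rfl : p = p' := Path.state_injective <| funext fun k => by
      cases k with
      | zero => simp
      | succ k => exact congrFun (congrArg LevelLabeling.state e) k
    rfl
  · intro M
    have hnil {k : ℕ} (h : level w k = []) : M.state k = [] := by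
      have := M.dir k
      rw [h] at this
      exact List.map_eq_nil_iff.1 this
    have h0 := hnil hw.level_zero
    -- Truncated subtraction repeats level 0, on both sides of the trivial twist.
    obtain ⟨p, hp⟩ := Path.exists_state (σ := σ) (A := M.outer) (w := .twist [] 0 :: flat w)
      (a := []) (a' := []) (fun k => M.state (k - 1)) h0
      (fun k o ho => by
        cases k with
        | zero =>
          obtain rfl : Op.twist [] 0 = o := by simpa using ho
          simp [h0, Op.Rel]
        | succ k =>
          obtain ⟨s, hs, rfl⟩ : ∃ s : Slice c, w[k]? = some s ∧ s.op = o := by simpa using ho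
          exact M.rel k s hs)
      (fun k hk => hnil (level_of_length_le (by simp at hk; omega)))
    exact ⟨⟨M.outer, p⟩, LevelLabeling.ext rfl (funext fun k => congrFun hp (k + 1))⟩

/-- The paths from the empty level to the empty level are the labelings of the levels. -/
def pathLevelEquiv {w : List (Slice c)} (hw : Runs [] w []) :
    ((A : S) × Path σ A (.twist [] 0 :: flat w) ([] : State X G) []) ≃ LevelLabeling σ w G :=
  Equiv.ofBijective _ (levelLabelingOf_bijective hw)

end Single

variable {G G' : Type uG} [AddCommGroup G] [Module (Alg b σ) G] [AddCommGroup G']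
  [Module (Alg b σ) G'] (φ : G →ₗ[Alg b σ] G')

lemma Path.state_map {A : S} {w : List Op} {a a' : State X G} (p : Path σ A w a a') (k : ℕ) :
    (p.map φ).state k = mapState σ φ (p.state k) := by
  induction w generalizing a k with
  | nil => rfl
  | cons o w ih =>
    obtain ⟨m, ⟨h⟩, p⟩ := p
    cases k with
    | zero => rfl
    | succ k => exact ih p k

lemma pathLevelEquiv_map {w : List (Slice c)} (hw : Runs [] w []) (A : S)
    (p : Path σ A (.twist [] 0 :: flat w) ([] : State X G) []) :
    pathLevelEquiv hw ⟨A, p.map φ⟩ = (pathLevelEquiv hw ⟨A, p⟩).map φ :=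
  LevelLabeling.ext rfl (funext fun k => p.state_map φ (k + 1))

end PathLevels

/-! ## Natural bijections of labelings with homomorphisms -/

section HomEquiv

variable {X : Type uX} {S : Type uS} {b : VirtualBirack X} (σ : Shadow b S) {c : ℕ}

/-- Bijections of the homomorphisms from fundamental modules, natural in the target. -/
structure HomEquiv (w w' : List (Slice c)) where
  equiv : ∀ (G : Type uG) [AddCommGroup G] [Module (Alg b σ) G],
    ((f : Labeling b σ w) × HomModule f G) ≃ (f : Labeling b σ w') × HomModule f G
  natural : ∀ {G G' : Type uG} [AddCommGroup G] [Module (Alg b σ) G] [AddCommGroup G']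
    [Module (Alg b σ) G'] (φ : G →ₗ[Alg b σ] G') (t : (f : Labeling b σ w) × HomModule f G),
    equiv G' ⟨t.1, φ ∘ₗ t.2⟩ = ⟨(equiv G t).1, φ ∘ₗ (equiv G t).2⟩

variable {σ} {w w' : List (Slice c)}

/-- Natural bijections of paths are natural bijections of homomorphisms. -/
lemma PathIso.nonempty_homEquiv [Finite X] (hw : Runs [] w []) (hw' : Runs [] w' [])
    (h : PathIso.{uX, uS, uG} σ (deco [] w 0) (deco [] w' 0)) :
    Nonempty (HomEquiv.{uX, uS, uG} σ w w') := by
  have e (w : List (Slice c)) :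
      PathIso.{uX, uS, uG} σ (deco [] w 0) (.twist [] 0 :: flat w) := by
    have := deco_zero_cons.{uX, uS, uG} (σ := σ) [] w 0
    rwa [atLevel_zero] at this
  obtain ⟨E⟩ := ((e w).symm.trans h).trans (e w')
  -- Homomorphisms become beads, beads become levels, and levels become closed paths; each step
  -- commutes with linear maps of the target.
  let bridge (w : List (Slice c)) (hw : Runs [] w []) (G : Type uG) [AddCommGroup G]
      [Module (Alg b σ) G] : ((f : Labeling b σ w) × HomModule f G) ≃
        ((A : S) × Path σ A (.twist [] 0 :: flat w) ([] : State X G) []) :=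
    (beadLabelingEquiv.trans (levelLabelingEquiv hw)).trans (pathLevelEquiv hw).symm
  have natural (w : List (Slice c)) (hw : Runs [] w []) {G G' : Type uG} [AddCommGroup G]
      [Module (Alg b σ) G] [AddCommGroup G'] [Module (Alg b σ) G'] (φ : G →ₗ[Alg b σ] G')
      (t : (f : Labeling b σ w) × HomModule f G) :
      bridge w hw G' ⟨t.1, φ ∘ₗ t.2⟩ = ⟨(bridge w hw G t).1, (bridge w hw G t).2.map φ⟩ := by
    simp only [bridge, Equiv.trans_apply, Equiv.symm_apply_eq]
    rw [beadLabelingEquiv_map, levelLabelingEquiv_map]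
    refine Eq.trans ?_ (pathLevelEquiv_map φ hw _ _).symm
    rw [Equiv.apply_symm_apply]
  refine ⟨⟨fun G _ _ => ((bridge w hw G).trans
    (Equiv.sigmaCongrRight fun A => E.equiv G A [] [])).trans (bridge w' hw' G).symm, ?_⟩⟩
  intro G G' _ _ _ _ φ t
  have h2 := natural w' hw' φ ((bridge w' hw' G).symm
    ((Equiv.sigmaCongrRight fun A => E.equiv G A [] []) (bridge w hw G t)))
  rw [Equiv.apply_symm_apply] at h2
  simp only [Equiv.trans_apply, Equiv.symm_apply_eq]
  refine Eq.trans ?_ h2.symm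
  rw [natural]
  exact congrArg (Sigma.mk _) (E.natural φ _ [] [] _)

namespace HomEquiv

variable (E : HomEquiv.{uX, uS, uG} σ w w') (G : Type uG) [AddCommGroup G] [Module (Alg b σ) G]

/-- Naturality for the zero endomorphism: the zero homomorphism goes to a zero homomorphism, and the
labeling assigned to `(f, h)` does not depend on `h`. -/
lemma equiv_zero (f : Labeling b σ w) (h : HomModule f G) :
    E.equiv G ⟨f, 0⟩ = ⟨(E.equiv G ⟨f, h⟩).1, 0⟩ := by
  have := E.natural (0 : G →ₗ[Alg b σ] G) ⟨f, h⟩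
  rwa [LinearMap.zero_comp, LinearMap.zero_comp] at this

lemma bijective_labeling :
    Function.Bijective fun f : Labeling b σ w => (E.equiv G ⟨f, 0⟩).1 := by
  constructor
  · intro f f' e
    have h : E.equiv G ⟨f, 0⟩ = E.equiv G ⟨f', 0⟩ := by
      rw [E.equiv_zero G f 0, E.equiv_zero G f' 0]
      exact congrArg (fun f => (⟨f, 0⟩ : (f : Labeling b σ w') × HomModule f G)) e
    exact congrArg Sigma.fst ((E.equiv G).injective h)
  · intro f'
    obtain ⟨⟨f, h⟩, e⟩ := (E.equiv G).surjective ⟨f', 0⟩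
    exact ⟨f, by dsimp only; rw [E.equiv_zero G f h, e]⟩

/-- The bijection of the labelings. -/
def labelingEquiv : Labeling b σ w ≃ Labeling b σ w' :=
  Equiv.ofBijective _ (E.bijective_labeling G)

lemma equiv_fst (f : Labeling b σ w) (h : HomModule f G) :
    (E.equiv G ⟨f, h⟩).1 = E.labelingEquiv G f :=
  (congrArg Sigma.fst (E.equiv_zero G f h)).symm

lemma exists_equiv_eq (f : Labeling b σ w) (h : HomModule f G) :
    ∃ k : HomModule (E.labelingEquiv G f) G,
      E.equiv G ⟨f, h⟩ = ⟨E.labelingEquiv G f, k⟩ := by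
  have := E.equiv_fst G f h
  generalize E.equiv G ⟨f, h⟩ = t at this
  obtain ⟨f', k⟩ := t
  obtain rfl : f' = _ := this
  exact ⟨k, rfl⟩

/-- A natural bijection is linear on the homomorphisms from each fundamental module. -/
theorem nonempty_linearEquiv (f : Labeling b σ w) :
    Nonempty (HomModule f G ≃ₗ[Module.End (Alg b σ) G] HomModule (E.labelingEquiv G f) G) := by
  choose L hL using E.exists_equiv_eq G f
  have smul (φ : G →ₗ[Alg b σ] G) (h : HomModule f G) : L (φ ∘ₗ h) = φ ∘ₗ L h := by
    have := E.natural φ ⟨f, h⟩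
    rw [hL, hL] at this
    exact eq_of_heq (Sigma.mk.inj this).2
  -- The pair `(h, h')` is one homomorphism to `G × G`. Naturality along the two projections and
  -- along their sum shows that its image has components `L h` and `L h'`, whose sum is `L (h +
  -- h')`.
  have add (h h' : HomModule f G) : L (h + h') = L h + L h' := by
    have key (ψ : G × G →ₗ[Alg b σ] G) :
        E.equiv G ⟨f, ψ ∘ₗ h.prod h'⟩ = ⟨(E.equiv (G × G) ⟨f, h.prod h'⟩).1,
          ψ ∘ₗ (E.equiv (G × G) ⟨f, h.prod h'⟩).2⟩ := E.natural ψ ⟨f, h.prod h'⟩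
    generalize E.equiv (G × G) ⟨f, h.prod h'⟩ = t at key
    obtain ⟨f', k⟩ := t
    obtain rfl : f' = E.labelingEquiv G f := by
      rw [← E.equiv_fst G f (LinearMap.fst _ G G ∘ₗ h.prod h'), key]
    have key' (ψ : G × G →ₗ[Alg b σ] G) : L (ψ ∘ₗ h.prod h') = ψ ∘ₗ k := by
      have := key ψ
      rw [hL] at this
      exact eq_of_heq (Sigma.mk.inj this).2
    have h1 := key' (LinearMap.fst _ G G)
    have h2 := key' (LinearMap.snd _ G G)
    have h3 := key' (LinearMap.fst _ G G + LinearMap.snd _ G G)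
    rw [LinearMap.fst_prod] at h1
    rw [LinearMap.snd_prod] at h2
    rw [LinearMap.add_comp, LinearMap.add_comp, LinearMap.fst_prod, LinearMap.snd_prod, ← h1,
      ← h2] at h3
    exact h3
  refine ⟨LinearEquiv.ofBijective
    { toFun := L, map_add' := add, map_smul' := smul } ⟨fun h h' e => ?_, fun k => ?_⟩⟩
  · have e' : E.equiv G ⟨f, h⟩ = E.equiv G ⟨f, h'⟩ := by
      rw [hL, hL]
      exact congrArg (Sigma.mk _) e
    exact eq_of_heq (Sigma.mk.inj ((E.equiv G).injective e')).2
  · obtain ⟨⟨f', h⟩, e⟩ := (E.equiv G).surjective ⟨E.labelingEquiv G f, k⟩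
    have e1 : E.labelingEquiv G f' = E.labelingEquiv G f := by
      rw [← E.equiv_fst G f' h, e]
    obtain rfl := (E.labelingEquiv G).injective e1
    refine ⟨h, ?_⟩
    rw [hL] at e
    exact eq_of_heq (Sigma.mk.inj e).2

end HomEquiv

end HomEquiv

/-! ## The invariants -/

section Tiles

variable {X : Type uX} {S : Type uS} {b : VirtualBirack X} {σ : Shadow b S} [Finite X] {c : ℕ}
  (G : Type uG) [AddCommGroup G] [Module (Alg b σ) G] {D D' : LinkDiagram c}

/-- The labelings and modules on the tiles of diagrams of isotopic links correspond to each other. -/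
theorem FramingTile.exists_equiv (h : VirtuallyIsotopic D D') (F : FramingTile D b.rank)
    (F' : FramingTile D' b.rank) : ∃ (ρ : Equiv.Perm (Fin c → ZMod b.rank))
      (e : ∀ v, Labeling b σ (F.diagram v).slices ≃ Labeling b σ (F'.diagram (ρ v)).slices),
      ∀ v f, Nonempty (HomModule f G ≃ₗ[Module.End (Alg b σ) G] HomModule (e v f) G) := by
  obtain ⟨π, hπ⟩ := h.exists_linked.{uX, uS, uG} σ
  -- Framing vectors follow the renumbering: entry `π i` of `ρ v` is entry `i` of `v`.
  let ρ : Equiv.Perm (Fin c → ZMod b.rank) := π.arrowCongr (Equiv.refl _)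
  have key (v : Fin c → ZMod b.rank) :
      Nonempty (HomEquiv.{uX, uS, uG} σ (F.diagram v).slices (F'.diagram (ρ v)).slices) := by
    have hl : Linked.{uX, uS, uG} σ π (F.diagram v) (F'.diagram (ρ v)) := by
      -- The two framed diagrams are compared through `D` and `D'`. In particular the choice of
      -- diagrams in the tiles is irrelevant.
      simpa using ((F.isotopic v).linked.symm.trans hπ).trans (F'.isotopic (ρ v)).linked
    refine (hl.pathIso fun i => ?_).nonempty_homEquiv (F.diagram v).closed
      (F'.diagram (ρ v)).closed
    rw [F.writhe_eq, F'.writhe_eq]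
    simp [ρ]
  exact ⟨ρ, fun v => (key v).some.labelingEquiv G, fun v => (key v).some.nonempty_linearEquiv G⟩

theorem sameModuleMultiset_of_isotopic (h : VirtuallyIsotopic D D') (F : FramingTile D b.rank)
    (F' : FramingTile D' b.rank) : SameModuleMultiset σ G F F' := by
  obtain ⟨ρ, e, he⟩ := F.exists_equiv (σ := σ) G h F'
  exact ⟨Equiv.sigmaCongr ρ e, fun f => he f.1 f.2⟩

theorem modulePolynomial_eq_of_isotopic (h : VirtuallyIsotopic D D') (F : FramingTile D b.rank)
    (F' : FramingTile D' b.rank) : modulePolynomial σ G F = modulePolynomial σ G F' := by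
  obtain ⟨ρ, e, he⟩ := F.exists_equiv (σ := σ) G h F'
  unfold modulePolynomial
  refine Eq.trans (finsum_congr fun v => ?_) (finsum_comp_equiv ρ
    (f := fun v => ∑ᶠ f : Labeling b σ (F'.diagram v).slices,
      (Polynomial.X ^ Nat.card (HomModule f G) : Polynomial ℤ)))
  rw [← finsum_comp_equiv (e v)]
  exact finsum_congr fun f => by rw [Nat.card_congr (he v f).some.toEquiv]

end Tiles

end VirtualShadow

end

open VirtualShadow in
theorem theorem4 {X S G : Type*} [Finite X] (b : VirtualBirack X) (σ : Shadow b S)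
    [AddCommGroup G] [Module (Alg b σ) G] {c : ℕ} (D D' : LinkDiagram c)
    (h : VirtuallyIsotopic D D') :
    Nonempty (FramingTile D b.rank) ∧ Nonempty (FramingTile D' b.rank) ∧
    ∀ (F : FramingTile D b.rank) (F' : FramingTile D' b.rank),
      SameModuleMultiset σ G F F' ∧
      (Finite S → modulePolynomial σ G F = modulePolynomial σ G F') :=
  ⟨D.nonempty_framingTile (rank_pos b), D'.nonempty_framingTile (rank_pos b), fun F F' =>
    ⟨sameModuleMultiset_of_isotopic G h F F', fun _ => modulePolynomial_eq_of_isotopic G h F F'⟩⟩
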